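/- Let $(M,\mu)$ be a closed weighted Riemannian manifold: $M$ is a compact connected smooth Riemannian manifold without boundary, of dimension $n\ge 1$, with Riemannian distance $d$ and Riemannian volume $\mathrm{vol}_M$, and $\mu$ is a Borel probability measure of the form $d\mu=e^{-V}\,d\mathrm{vol}_M$ with $V\in C^2(M)$. Let $0=\lambda_0(M,\mu)<\lambda_1(M,\mu)\le\lambda_2(M,\mu)\le\cdots\nearrow\infty$ be the eigenvalues, listed with multiplicity, of $-\Delta_\mu$, where $\Delta_\mu=\Delta-\nabla V\cdot\nabla$ is the weighted Laplacian; that is, of the problem $$\int_M\langle\nabla u,\nabla\varphi\rangle\,d\mu=\lambda\int_M u\,\varphi\,d\mu\quad\text{for all Lipschitz }\varphi:M\to\mathbb R,\qquad u\in W^{1,2}(\mu),$$ where $W^{1,2}(\mu)$ is the completion of the Lipschitz functions for the norm $(\|f\|_{L^2(\mu)}^2+\|\nabla f\|_{L^2(\mu)}^2)^{1/2}$. For a Borel set $A\subseteq M$ let $$\mu^+(A)=\liminf_{r\to0^+}\frac{\mu(O_r(A))-\mu(A)}{r},\qquad O_r(A)=\{x\in M:\ d(x,a)<r\text{ for some }a\in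 A\},$$ and, if $\mu(A)>0$, let $\phi(A)=\mu^+(A)/\mu(A)\in[0,\infty]$. For a nonnegative Lipschitz function $f:M\to\mathbb R$ that is not identically zero, put $$\phi(f)=\inf\bigl\{\phi(\{f>t\}):\ t\ge0,\ \mu(\{f>t\})>0\bigr\},\qquad \mathcal R(f)=\frac{\int_M|\nabla f|^2\,d\mu}{\int_M f^2\,d\mu}.$$ **Theorem.** For every integer $k\ge1$ and every nonnegative Lipschitz function $f:M\to\mathbb R$ that is not identically zero, $$\phi(f)\le 8\sqrt2\,k\,\frac{\mathcal R(f)}{\sqrt{\lambda_k(M,\mu)}}.$$ -/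

import Mathlib

open MeasureTheory Filter Set Bundle Manifold
open scoped Topology ENNReal NNReal ContDiff

noncomputable section

namespace WeightedManifold

/-! ### Gradients and the Riemannian volume -/

section Gradient

variable {n : ℕ} {M : Type*} [TopologicalSpace M] [ChartedSpace (EuclideanSpace ℝ (Fin n)) M]
  [RiemannianBundle (fun x : M ↦ TangentSpace (𝓡 n) x)]

/-- The tangent spaces are finite-dimensional. -/
instance instFiniteDimensionalTangent (x : M) :
    FiniteDimensional ℝ (TangentSpace (𝓡 n) x) :=
  inferInstanceAs (FiniteDimensional ℝ (EuclideanSpace ℝ (Fin n)))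

/-- The tangent spaces are complete for the norm given by the Riemannian metric. -/
instance instCompleteTangent (x : M) : CompleteSpace (TangentSpace (𝓡 n) x) :=
  FiniteDimensional.complete ℝ (TangentSpace (𝓡 n) x)

variable (n) in
/-- The Riemannian gradient `∇f(x) ∈ T_x M`: the vector representing the differential of `f` at `x`
through the inner product of `T_x M`. It is `0` at points where `f` is not differentiable; for a
Lipschitz function these points form a null set. -/
def riemannianGradient (f : M → ℝ) (x : M) : TangentSpace (𝓡 n) x :=
  (InnerProductSpace.toDual ℝ (TangentSpace (𝓡 n) x)).symm (mfderiv (𝓡 n) 𝓘(ℝ, ℝ) f x)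

/-- The Gram matrix `g_ij = ⟨∂_i, ∂_j⟩` of the Riemannian metric in the preferred chart at `p`,
as a function of the coordinates `y`. -/
def gramMatrix (p : M) (y : EuclideanSpace ℝ (Fin n)) : Matrix (Fin n) (Fin n) ℝ :=
  Matrix.of fun i j ↦
    inner ℝ
      (mfderiv 𝓘(ℝ, EuclideanSpace ℝ (Fin n)) (𝓡 n) (extChartAt (𝓡 n) p).symm y
        (EuclideanSpace.single i (1 : ℝ)) :
          TangentSpace (𝓡 n) ((extChartAt (𝓡 n) p).symm y))
      (mfderiv 𝓘(ℝ, EuclideanSpace ℝ (Fin n)) (𝓡 n) (extChartAt (𝓡 n) p).symm y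
        (EuclideanSpace.single j (1 : ℝ)) :
          TangentSpace (𝓡 n) ((extChartAt (𝓡 n) p).symm y))

variable [MeasurableSpace M]

/-- The Riemannian volume on the domain of the preferred chart at `p` (and `0` outside of it):
the measure `√(det g_ij) dy` on the target of the chart, transported to `M`. -/
def chartVolume (p : M) : Measure M :=
  ((volume.restrict (extChartAt (𝓡 n) p).target).withDensity
    fun y ↦ ENNReal.ofReal √(gramMatrix p y).det).map (extChartAt (𝓡 n) p).symm

variable (n M) in
/-- The Riemannian volume measure of `M`. The chart volumes agree on overlaps of charts, so that
their supremum, the smallest measure that dominates all of them, is the measure that coincides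
with each of them on the domain of the corresponding chart. -/
def riemannianVolume : Measure M := ⨆ p : M, chartVolume (n := n) p

variable (n) in
/-- The weighted measure `dμ = e^{-V} d vol`. -/
def weightedMeasure (V : M → ℝ) : Measure M :=
  (riemannianVolume n M).withDensity fun x ↦ ENNReal.ofReal (Real.exp (-V x))

variable (n) in
/-- The Dirichlet form `∫ ⟨∇f, ∇g⟩ dμ`. -/
def dirichletForm (μ : Measure M) (f g : M → ℝ) : ℝ :=
  ∫ x, inner ℝ (riemannianGradient n f x) (riemannianGradient n g x) ∂μ

variable (n) in
/-- The Rayleigh quotient `∫ |∇f|² dμ / ∫ f² dμ`. -/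
def rayleigh (μ : Measure M) (f : M → ℝ) : ℝ :=
  (∫ x, ‖riemannianGradient n f x‖ ^ 2 ∂μ) / ∫ x, f x ^ 2 ∂μ

end Gradient

/-! ### Eigenvalues of the weighted Laplacian -/

section Eigenvalues

variable {n : ℕ} {M : Type*} [PseudoEMetricSpace M] [ChartedSpace (EuclideanSpace ℝ (Fin n)) M]
  [RiemannianBundle (fun x : M ↦ TangentSpace (𝓡 n) x)] [MeasurableSpace M]

/-- Real-valued Lipschitz functions. -/
def IsLipschitz {X : Type*} [PseudoEMetricSpace X] (f : X → ℝ) : Prop :=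
  ∃ K : ℝ≥0, LipschitzWith K f

variable (n) in
/-- `f` is a sequence of Lipschitz functions that represents `u ∈ L²(μ)` as an element of
`W^{1,2}(μ)`, the completion of the Lipschitz functions for the norm
`(‖f‖² + ‖∇f‖²)^{1/2}`: it converges to `u` in `L²(μ)` and its gradients form a Cauchy sequence
in `L²(μ)`. -/
structure IsSobolevApprox (μ : Measure M) (u : Lp ℝ 2 μ) (f : ℕ → M → ℝ) : Prop where
  lipschitz : ∀ m, IsLipschitz (f m)
  tendsto : Tendsto (fun m ↦ eLpNorm (fun x ↦ f m x - u x) 2 μ) atTop (𝓝 0)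
  cauchy : ∀ ε > 0, ∃ N, ∀ l ≥ N, ∀ m ≥ N,
    ∫ x, ‖riemannianGradient n (f l) x - riemannianGradient n (f m) x‖ ^ 2 ∂μ < ε

variable (n) in
/-- `u` belongs to `W^{1,2}(μ)` and satisfies `-Δ_μ u = a u` for the weighted Laplacian
`Δ_μ = Δ - ∇V · ∇` of `dμ = e^{-V} d vol`, in the weak sense
`∫ ⟨∇u, ∇φ⟩ dμ = a ∫ u φ dμ` for all Lipschitz `φ`; the Dirichlet form extends from Lipschitz
functions to `W^{1,2}(μ)` by passing to the limit. (`u = 0` is not excluded here.) -/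
def IsWeakEigenfunction (μ : Measure M) (a : ℝ) (u : Lp ℝ 2 μ) : Prop :=
  ∃ f : ℕ → M → ℝ, IsSobolevApprox n μ u f ∧
    ∀ φ : M → ℝ, IsLipschitz φ →
      Tendsto (fun m ↦ dirichletForm n μ (f m) φ) atTop (𝓝 (a * ∫ x, u x * φ x ∂μ))

variable (n) in
/-- The `k`-th eigenvalue `λ_k(M, μ)` of (minus) the weighted Laplacian, where the eigenvalues
`λ_0 ≤ λ_1 ≤ λ_2 ≤ ⋯` are listed with multiplicity: the least `b` such that there are at least
`k + 1` linearly independent eigenfunctions with eigenvalues at most `b`. -/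
def eigenvalue (μ : Measure M) (k : ℕ) : ℝ :=
  sInf {b : ℝ | ∃ u : Fin (k + 1) → Lp ℝ 2 μ, LinearIndependent ℝ u ∧
    ∀ i, ∃ a ≤ b, IsWeakEigenfunction n μ a (u i)}

end Eigenvalues

/-! ### Isoperimetric quantities -/

section Isoperimetry

variable {M : Type*} [PseudoEMetricSpace M] [MeasurableSpace M]

/-- The boundary measure `μ⁺(A) = liminf_{r → 0+} (μ(O_r(A)) - μ(A)) / r`, where `O_r(A)` is the
open `r`-neighbourhood of `A`. -/
def boundaryMeasure (μ : Measure M) (A : Set M) : ℝ≥0∞ :=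
  liminf (fun r : ℝ ↦ (μ (Metric.thickening r A) - μ A) / ENNReal.ofReal r) (𝓝[>] 0)

/-- The ratio `φ(A) = μ⁺(A) / μ(A)`, used for sets of positive measure. -/
def isoRatio (μ : Measure M) (A : Set M) : ℝ≥0∞ := boundaryMeasure μ A / μ A

/-- `φ(f)`, the infimum of `φ({f > t})` over all `t ≥ 0` such that `{f > t}` has positive
measure. -/
def levelSetRatio (μ : Measure M) (f : M → ℝ) : ℝ≥0∞ :=
  ⨅ t ∈ {t : ℝ | 0 ≤ t ∧ 0 < μ {x | t < f x}}, isoRatio μ {x | t < f x}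

end Isoperimetry

end WeightedManifold

end

/-! Write E for the energy of f and λ for λ_k. Fix C > E/(kλ) and cut the range of f at thresholds 0
= t_0 ≤ t_1 ≤ … so that each truncation `tent (t i) (t (i + 1)) ∘ f` has squared L² norm exactly C
until the maximum of f is reached (`exists_thresholds`). The truncations have disjoint supports and
their energies add up to at most E. If 2k steps did not exhaust the range of f, at least k + 1 of
the 2k truncations would have energy at most E/k, and min-max would give λ ≤ E/(kC) < λ
(`eigenvalue_le_of_truncations`). Hence f ≤ t_{2k}.

Let H be the primitive of the sum of the 2k tents. By Cauchy–Schwarz, ∫|∇(H∘f)| ≤ √(2kC)·√E, while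
H(s) ≥ s²/(8k) on the range of f, because s splits into 2k increments, each contributing at least a
quarter of its square (`sq_div_le_integral_zigzag`). Superlevel sets of H∘f are superlevel sets of f
(`levelSetRatio_le_comp`), so the coarea inequality (`lintegral_boundaryMeasure_le`) gives φ(f)·∫H∘f
≤ ∫|∇(H∘f)|. Letting C decrease to E/(kλ) yields the constant.

Most of the work lies in the min-max bound for λ_k, which is defined through weak eigenfunctions.
The Lipschitz functions are completed in the form norm, and the map to L² is compact by a Rellich
estimate (`norm_sq_lipschitzToL2_le`), obtained by summing Poincaré inequalities over small convex
cells in charts. A global Poincaré inequality (`exists_lintegral_sq_enorm_sub_le`), which rests on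
connectedness, makes λ_k positive for k ≥ 1. Gradients are treated throughout as local Lipschitz
constants, and the measure enters only through its comparison with Lebesgue measure on chart balls
(`IsChartBall`). -/

namespace WeightedManifold

/-! ### Compact operators and the variational bound for eigenvalues -/

open scoped InnerProductSpace in
-- Let P be the orthogonal projection onto the span of the vectors J*h, h ∈ s. On the complement of
-- this span the finite sum vanishes, so J is within √ε of the finite-rank operator J∘P; compact
-- operators are closed in norm.
theorem isCompactOperator_of_sq_norm_le {W H : Type*} [NormedAddCommGroup W] [InnerProductSpace ℝ W]
    [CompleteSpace W] [NormedAddCommGroup H] [InnerProductSpace ℝ H] [CompleteSpace H]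
    (J : W →L[ℝ] H)
    (h : ∀ ε > 0, ∃ (s : Finset H) (C : ℝ), ∀ w,
      ‖J w‖ ^ 2 ≤ ε * ‖w‖ ^ 2 + C * ∑ h ∈ s, ⟪h, J w⟫_ℝ ^ 2) :
    IsCompactOperator J := by
  have hcl := isClosed_setOfPred_isCompactOperator (σ₁₂ := RingHom.id ℝ) (M₁ := W) (M₂ := H)
  refine hcl.closure_subset (Metric.mem_closure_iff.2 ?_)
  intro ε hε
  -- The square makes the bound on the complement read ‖J v‖ ≤ (ε/2)‖v‖; halving ε gives the strict
  -- inequality for the distance.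
  obtain ⟨s, C, hs⟩ := h ((ε / 2) ^ 2) (by positivity)
  let F : Submodule ℝ W := Submodule.span ℝ ((fun h ↦ J.adjoint h) '' (s : Set H))
  have : FiniteDimensional ℝ F :=
    FiniteDimensional.span_of_finite ℝ (s.finite_toSet.image _)
  have hP : IsCompactOperator (F.orthogonalProjectionOnto : W → F) := by
    have : IsCompactOperator (_root_.id : F → F) :=
      (isCompactOperator_id_iff_finiteDimensional (𝕜 := ℝ)).2 inferInstance
    exact this.comp_clm F.orthogonalProjectionOnto
  refine ⟨(J.comp F.subtypeL).comp F.orthogonalProjectionOnto, hP.clm_comp (J.comp F.subtypeL), ?_⟩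
  rw [dist_eq_norm]
  refine lt_of_le_of_lt (ContinuousLinearMap.opNorm_le_bound _ (half_pos hε).le fun w ↦ ?_)
    (half_lt_self hε)
  set v : W := w - F.starProjection w with hv
  have hJ : (J - (J.comp F.subtypeL).comp F.orthogonalProjectionOnto) w = J v := by
    simp [hv]
  have hvF : v ∈ Fᗮ := Submodule.sub_starProjection_mem_orthogonal w
  have hvw : ‖v‖ ≤ ‖w‖ := by
    have h1 : ‖w‖ * ‖w‖ = ‖F.starProjection w‖ * ‖F.starProjection w‖ + ‖v‖ * ‖v‖ := by
      have := norm_add_sq_eq_norm_sq_add_norm_sq_of_inner_eq_zero (F.starProjection w) v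
        ((Submodule.mem_orthogonal F v).1 hvF _ (Submodule.starProjection_apply_mem F w))
      simpa [hv] using this
    nlinarith [norm_nonneg v, norm_nonneg w, norm_nonneg (F.starProjection w)]
  have h0 : ∑ h ∈ s, ⟪h, J v⟫_ℝ ^ 2 = 0 := by
    refine Finset.sum_eq_zero fun h hh ↦ ?_
    have : ⟪J.adjoint h, v⟫_ℝ = 0 :=
      (Submodule.mem_orthogonal F v).1 hvF _ (Submodule.subset_span ⟨h, hh, rfl⟩)
    rw [ContinuousLinearMap.adjoint_inner_left] at this
    simp [this]
  have h2 := hs v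
  rw [h0, mul_zero, add_zero, ← mul_pow] at h2
  rw [hJ]
  calc ‖J v‖ ≤ ε / 2 * ‖v‖ := by
        exact (pow_le_pow_iff_left₀ (norm_nonneg _) (by positivity) two_ne_zero).1 h2
    _ ≤ ε / 2 * ‖w‖ := by gcongr

open scoped InnerProductSpace in
-- The norm of a self-adjoint operator is attained as |τ| on the spectrum; compactness makes τ ≠ 0
-- an eigenvalue, and positivity of the form excludes τ = -‖R‖.
theorem norm_lt_of_forall_eigenvalue_lt {H : Type*} [NormedAddCommGroup H]
    [InnerProductSpace ℝ H] [CompleteSpace H] (R : H →L[ℝ] H) (hR : IsCompactOperator R)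
    (hsymm : R.IsSymmetric) (hpos : ∀ u, 0 ≤ ⟪R u, u⟫_ℝ) {θ : ℝ} (hθ : 0 < θ)
    (hev : ∀ v τ, v ≠ 0 → R v = τ • v → τ < θ) : ‖R‖ < θ := by
  by_contra! hcon
  have hR0 : 0 < ‖R‖ := hθ.trans_le hcon
  have hnt : Nontrivial H := by
    by_contra hnt
    rw [not_nontrivial_iff_subsingleton] at hnt
    have : R = 0 := Subsingleton.elim _ _
    rw [this, norm_zero] at hR0
    exact lt_irrefl _ hR0
  have hrad := ContinuousLinearMap.spectralRadius_eq_nnnorm (𝕜 := ℝ) (T := R) hsymm.isSelfAdjoint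
  -- Over ℝ this is not automatic: an empty spectrum has spectral radius 0, which would force R = 0.
  have hne : (spectrum ℝ R).Nonempty := by
    by_contra hemp
    rw [Set.not_nonempty_iff_eq_empty] at hemp
    rw [spectralRadius, hemp] at hrad
    have h0 : R = 0 := by simpa using hrad.symm
    rw [h0, norm_zero] at hR0
    exact lt_irrefl _ hR0
  obtain ⟨τ, hτ, h2⟩ := spectrum.exists_nnnorm_eq_spectralRadius_of_nonempty hne
  have hτn : |τ| = ‖R‖ := by
    have h3 : ‖τ‖₊ = ‖R‖₊ := by exact_mod_cast h2.trans hrad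
    exact congrArg NNReal.toReal h3
  have hτ0 : τ ≠ 0 := by
    rintro rfl
    rw [abs_zero] at hτn
    linarith
  obtain ⟨v, hv, hv0⟩ := ((hR.hasEigenvalue_iff_mem_spectrum hτ0).2 hτ).exists_hasEigenvector
  have hv1 : R v = τ • v := Module.End.mem_eigenspace_iff.1 hv
  have hτpos : 0 ≤ τ := by
    have := hpos v
    rw [hv1, inner_smul_left, real_inner_self_eq_norm_sq] at this
    exact nonneg_of_mul_nonneg_left this (by positivity)
  rw [abs_of_nonneg hτpos] at hτn
  have := hev v τ hv0 hv1
  linarith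

open scoped InnerProductSpace in
/-- A compact symmetric operator, restricted to the orthogonal complement of its eigenvectors
with eigenvalue at least `θ`, has quadratic form less than `θ`. -/
theorem inner_apply_lt_of_mem_orthogonal {H : Type*} [NormedAddCommGroup H]
    [InnerProductSpace ℝ H] [CompleteSpace H] (T : H →L[ℝ] H) (hT : IsCompactOperator T)
    (hsymm : T.IsSymmetric) (hpos : ∀ u, 0 ≤ ⟪T u, u⟫_ℝ) {θ : ℝ} (hθ : 0 < θ)
    {g : H} (hg : g ≠ 0) (hgS : ∀ u τ, θ ≤ τ → T u = τ • u → ⟪u, g⟫_ℝ = 0) :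
    ⟪T g, g⟫_ℝ < θ * ‖g‖ ^ 2 := by
  let S : Submodule ℝ H := Submodule.span ℝ {u | ∃ τ, θ ≤ τ ∧ T u = τ • u}
  have hinv : ∀ v ∈ Sᗮ, T v ∈ Sᗮ := by
    intro v hv
    rw [Submodule.mem_orthogonal] at hv ⊢
    intro u hu
    induction hu using Submodule.span_induction with
    | mem u hu =>
      obtain ⟨τ, hτ, h⟩ := hu
      have := hv u (Submodule.subset_span ⟨τ, hτ, h⟩)
      have h2 : ⟪T u, v⟫_ℝ = ⟪u, T v⟫_ℝ := hsymm u v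
      rw [← h2, h, inner_smul_left, this, mul_zero]
    | zero => simp
    | add x y _ _ hx hy => rw [inner_add_left, hx, hy, add_zero]
    | smul a x _ hx => rw [inner_smul_left, hx, mul_zero]
  let R : Sᗮ →L[ℝ] Sᗮ := T.restrict hinv
  have hR : IsCompactOperator R := hT.restrict' hinv
  have hRs : R.IsSymmetric := hsymm.restrict_invariant hinv
  have hgm : g ∈ Sᗮ := by
    rw [Submodule.mem_orthogonal]
    intro u hu
    induction hu using Submodule.span_induction with
    | mem u hu => obtain ⟨τ, hτ, h⟩ := hu; exact hgS u τ hτ h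
    | zero => simp
    | add x y _ _ hx hy => rw [inner_add_left, hx, hy, add_zero]
    | smul a x _ hx => rw [inner_smul_left, hx, mul_zero]
  -- An eigenvector in Sᗮ with eigenvalue at least θ would also lie in S, hence vanish.
  have hnorm : ‖R‖ < θ := by
    refine norm_lt_of_forall_eigenvalue_lt R hR hRs (fun v ↦ hpos (v : H)) hθ fun v τ hv0 hv ↦ ?_
    by_contra! hcon
    have hv2 : T (v : H) = τ • (v : H) := congrArg Subtype.val hv
    have hvS : (v : H) ∈ S := Submodule.subset_span ⟨τ, hcon, hv2⟩
    have h0 := (Submodule.mem_orthogonal S _).1 v.2 _ hvS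
    exact hv0 (Subtype.ext (inner_self_eq_zero.1 h0))
  have hgpos : 0 < ‖g‖ := norm_pos_iff.2 hg
  have h1 : ‖T g‖ ≤ ‖R‖ * ‖g‖ := R.le_opNorm ⟨g, hgm⟩
  calc ⟪T g, g⟫_ℝ ≤ ‖T g‖ * ‖g‖ := real_inner_le_norm _ _
    _ ≤ ‖R‖ * ‖g‖ * ‖g‖ := by gcongr
    _ < θ * ‖g‖ * ‖g‖ := by gcongr
    _ = θ * ‖g‖ ^ 2 := by ring

open scoped InnerProductSpace in
set_option maxHeartbeats 800000 in
/-- The variational upper bound for eigenvalues, for a Hilbert space `W` compactly mapped to `H`. -/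
theorem exists_linearIndependent_eigenvectors {W H : Type*} [NormedAddCommGroup W]
    [InnerProductSpace ℝ W] [CompleteSpace W] [NormedAddCommGroup H] [InnerProductSpace ℝ H]
    [CompleteSpace H] (J : W →L[ℝ] H) (hJ : IsCompactOperator J) {k : ℕ} {b : ℝ} (hb : 0 ≤ b)
    (G : Fin (k + 1) → W) (hli : LinearIndependent ℝ (J ∘ G))
    (hG : ∀ c : Fin (k + 1) → ℝ, ‖∑ i, c i • G i‖ ^ 2 ≤ (1 + b) * ‖J (∑ i, c i • G i)‖ ^ 2) :
    ∃ u : Fin (k + 1) → H, LinearIndependent ℝ u ∧ ∀ i, ∃ a ≤ b, ∃ w : W, J w = u i ∧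
      ∀ v, ⟪w, v⟫_ℝ = (1 + a) * ⟪u i, J v⟫_ℝ := by
  -- An eigenvalue τ of J J* corresponds to the weak eigenvalue a with 1 + a = 1/τ, so a ≤ b means τ
  -- ≥ 1/(1 + b) = θ.
  let T : H →L[ℝ] H := J.comp J.adjoint
  have hTc : IsCompactOperator T := hJ.comp_clm J.adjoint
  have hTi : ∀ u v, ⟪T u, v⟫_ℝ = ⟪J.adjoint u, J.adjoint v⟫_ℝ := fun u v ↦
    (ContinuousLinearMap.adjoint_inner_right J (J.adjoint u) v).symm
  have hsymm : T.IsSymmetric := fun u v ↦ by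
    change ⟪T u, v⟫_ℝ = ⟪u, T v⟫_ℝ
    rw [hTi, real_inner_comm (T v) u, hTi, real_inner_comm]
  have hpos : ∀ u, 0 ≤ ⟪T u, u⟫_ℝ := fun u ↦ by rw [hTi]; exact real_inner_self_nonneg
  set θ : ℝ := 1 / (1 + b) with hθdef
  have hθ : 0 < θ := by positivity
  let s : Set H := {u | ∃ τ, θ ≤ τ ∧ T u = τ • u}
  obtain ⟨B, hBs, hBspan, hBli⟩ := exists_linearIndependent ℝ s
  -- If B had at most k elements, some nonzero combination w of the `G i` would have J w orthogonal
  -- to B, hence to all of s. Then ‖J*J w‖² = ⟪T J w, J w⟫ < θ‖J w‖², and ‖J w‖² ≤ ‖w‖‖J*J w‖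
  -- contradicts ‖w‖² ≤ (1 + b)‖J w‖².
  have key : ((k + 1 : ℕ) : ℕ∞) ≤ B.encard := by
    by_contra! hcon
    have hfin : B.Finite := Set.finite_of_encard_le_coe hcon.le
    have := hfin.fintype
    have hcard : Fintype.card B < k + 1 := by
      rw [← Set.coe_fintypeCard] at hcon
      exact_mod_cast hcon
    let Φ : (Fin (k + 1) → ℝ) →ₗ[ℝ] (B → ℝ) :=
      LinearMap.pi fun β ↦ ((innerₛₗ ℝ (β : H)).comp J.toLinearMap).comp
        (Fintype.linearCombination ℝ G)
    have hker : LinearMap.ker Φ ≠ ⊥ := by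
      apply LinearMap.ker_ne_bot_of_finrank_lt
      simpa using hcard
    obtain ⟨c, hc, hc0⟩ := Submodule.exists_mem_ne_zero_of_ne_bot hker
    set w : W := ∑ i, c i • G i with hw
    have hwo : ∀ β ∈ B, ⟪β, J w⟫_ℝ = 0 := fun β hβ ↦ by
      have := congrFun (LinearMap.mem_ker.1 hc) ⟨β, hβ⟩
      simpa [Φ, Fintype.linearCombination_apply, hw, inner_sum] using this
    have hg0 : J w ≠ 0 := by
      intro h0
      apply hc0
      have h1 : ∑ i, c i • (J ∘ G) i = 0 := by
        rw [← h0, hw]; simp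
      ext i
      exact Fintype.linearIndependent_iff.1 hli c h1 i
    have hlt : ⟪T (J w), J w⟫_ℝ < θ * ‖J w‖ ^ 2 := by
      refine inner_apply_lt_of_mem_orthogonal T hTc hsymm hpos hθ hg0 fun u τ hτ hu ↦ ?_
      have hu' : u ∈ Submodule.span ℝ B := hBspan ▸ Submodule.subset_span ⟨τ, hτ, hu⟩
      clear hu
      induction hu' using Submodule.span_induction with
      | mem u hu => exact hwo u hu
      | zero => simp
      | add x y _ _ hx hy => rw [inner_add_left, hx, hy, add_zero]
      | smul a x _ hx => rw [inner_smul_left, hx, mul_zero]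
    have h1 : ‖J w‖ ^ 2 ≤ ‖w‖ * ‖J.adjoint (J w)‖ := by
      rw [← real_inner_self_eq_norm_sq, ← ContinuousLinearMap.adjoint_inner_right]
      exact real_inner_le_norm _ _
    have h2 : ‖J.adjoint (J w)‖ ^ 2 < θ * ‖J w‖ ^ 2 := by
      rw [← real_inner_self_eq_norm_sq, ← hTi]; exact hlt
    have h3 := hG c
    rw [← hw] at h3
    have hgp : 0 < ‖J w‖ ^ 2 := by positivity
    have h4 : (‖J w‖ ^ 2) ^ 2 ≤ ‖w‖ ^ 2 * ‖J.adjoint (J w)‖ ^ 2 := by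
      rw [← mul_pow]; gcongr
    have h5 : ‖w‖ ^ 2 * ‖J.adjoint (J w)‖ ^ 2 < ((1 + b) * ‖J w‖ ^ 2) * (θ * ‖J w‖ ^ 2) :=
      mul_lt_mul' h3 h2 (by positivity) (by positivity)
    have h6 : ((1 + b) * ‖J w‖ ^ 2) * (θ * ‖J w‖ ^ 2) = (‖J w‖ ^ 2) ^ 2 := by
      rw [hθdef]; field_simp
    linarith
  obtain ⟨B', hB', hcard⟩ := Set.exists_subset_encard_eq key
  have hfin : B'.Finite := Set.finite_of_encard_eq_coe hcard
  have := hfin.fintype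
  have hc : Fintype.card B' = k + 1 := by
    rw [← Set.coe_fintypeCard] at hcard
    exact_mod_cast hcard
  let e : Fin (k + 1) ≃ B' := (Fintype.equivFinOfCardEq hc).symm
  refine ⟨fun i ↦ (e i : H), ?_, fun i ↦ ?_⟩
  · exact hBli.comp (fun i ↦ ⟨e i, hB' (e i).2⟩ : Fin (k + 1) → B)
      fun i j hij ↦ e.injective (Subtype.ext (congrArg (fun x : B ↦ (x : H)) hij))
  · obtain ⟨τ, hτ, hu⟩ := hBs (hB' (e i).2)
    have hτ0 : 0 < τ := hθ.trans_le hτ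
    -- The preimage w = J*u/τ satisfies J w = T u/τ = u.
    refine ⟨1 / τ - 1, ?_, (1 / τ) • J.adjoint (e i), ?_, fun v ↦ ?_⟩
    · have : 1 / τ ≤ 1 / θ := one_div_le_one_div_of_le hθ hτ
      rw [hθdef, one_div_one_div] at this
      linarith
    · rw [map_smul]
      change (1 / τ) • T (e i) = _
      rw [hu, smul_smul, one_div_mul_cancel hτ0.ne', one_smul]
    · rw [inner_smul_left, ContinuousLinearMap.adjoint_inner_left]
      simp

end WeightedManifold

/-! ### Weak eigenvectors of a form, by completion -/

namespace WeightedManifold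

open scoped InnerProductSpace in
/-- The variational upper bound for the eigenvalues of a form `E` on a space `L` that is mapped to
a Hilbert space `H` compactly with respect to the form norm; the eigenvectors are limits of
sequences in `L`. -/
theorem exists_linearIndependent_weak_eigenvectors {L H : Type*} [AddCommGroup L] [Module ℝ L]
    [NormedAddCommGroup H] [InnerProductSpace ℝ H] [CompleteSpace H]
    (ι : L →ₗ[ℝ] H) (E : L →ₗ[ℝ] L →ₗ[ℝ] ℝ) (hsymm : ∀ f g, E f g = E g f)
    (hnn : ∀ f, 0 ≤ E f f)
    (hcpt : ∀ ε > 0, ∃ (s : Finset H) (C : ℝ), ∀ f,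
      ‖ι f‖ ^ 2 ≤ ε * (‖ι f‖ ^ 2 + E f f) + C * ∑ h ∈ s, ⟪h, ι f⟫_ℝ ^ 2)
    {k : ℕ} {b : ℝ} (hb : 0 ≤ b) (G : Fin (k + 1) → L) (hli : LinearIndependent ℝ (ι ∘ G))
    (hG : ∀ c : Fin (k + 1) → ℝ,
      E (∑ i, c i • G i) (∑ i, c i • G i) ≤ b * ‖ι (∑ i, c i • G i)‖ ^ 2) :
    ∃ u : Fin (k + 1) → H, LinearIndependent ℝ u ∧ ∀ i, ∃ a ≤ b, ∃ f : ℕ → L,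
      Tendsto (fun m ↦ ι (f m)) atTop (𝓝 (u i)) ∧
      (∀ ε > 0, ∃ N, ∀ l ≥ N, ∀ m ≥ N, E (f l - f m) (f l - f m) < ε) ∧
      ∀ φ, Tendsto (fun m ↦ E (f m) φ) atTop (𝓝 (a * ⟪u i, ι φ⟫_ℝ)) := by
  -- The form norm is only a seminorm here; the separated completion W below identifies elements at
  -- distance zero and plays the role of W^{1,2}.
  let core : PreInnerProductSpace.Core ℝ L :=
    { inner := fun f g ↦ ⟪ι f, ι g⟫_ℝ + E f g
      conj_inner_symm := fun f g ↦ by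
        simp [hsymm f g, real_inner_comm]
      re_inner_nonneg := fun f ↦ by
        simpa using add_nonneg (sq_nonneg ‖ι f‖) (hnn f)
      add_left := fun f g h ↦ by
        simp only [map_add, inner_add_left, LinearMap.add_apply]; ring
      smul_left := fun f g r ↦ by
        simp only [map_smul, inner_smul_left, LinearMap.smul_apply, smul_eq_mul]
        simp; ring }
  let _ : SeminormedAddCommGroup L := @InnerProductSpace.Core.toSeminormedAddCommGroup ℝ L _ _ _ core
  let _ : InnerProductSpace ℝ L := InnerProductSpace.ofCore core
  have hinner : ∀ f g : L, ⟪f, g⟫_ℝ = ⟪ι f, ι g⟫_ℝ + E f g := fun f g ↦ rfl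
  have hnorm : ∀ f : L, ‖f‖ ^ 2 = ‖ι f‖ ^ 2 + E f f := fun f ↦ by
    rw [← real_inner_self_eq_norm_sq, hinner, real_inner_self_eq_norm_sq]
  let ι' : L →L[ℝ] H := ι.mkContinuous 1 fun f ↦ by
    rw [one_mul]
    refine (pow_le_pow_iff_left₀ (norm_nonneg _) (norm_nonneg _) two_ne_zero).1 ?_
    rw [hnorm]
    linarith [hnn f]
  let W := UniformSpace.Completion L
  let j : L →L[ℝ] W := UniformSpace.Completion.toComplL
  have hjd : DenseRange j := UniformSpace.Completion.denseRange_coe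
  have hjnorm : ∀ f : L, ‖j f‖ = ‖f‖ := fun f ↦ UniformSpace.Completion.norm_coe f
  have hjinner : ∀ f g : L, ⟪j f, j g⟫_ℝ = ⟪f, g⟫_ℝ := fun f g ↦ UniformSpace.Completion.inner_coe f g
  let J : W →L[ℝ] H := ι'.extend j
  have hJ : ∀ f, J (j f) = ι f := fun f ↦
    ContinuousLinearMap.extend_eq ι' hjd (UniformSpace.Completion.isUniformInducing_coe L) f
  have hJc : IsCompactOperator J := by
    refine isCompactOperator_of_sq_norm_le J fun ε hε ↦ ?_
    obtain ⟨s, C, h⟩ := hcpt ε hε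
    refine ⟨s, C, fun w ↦ ?_⟩
    refine hjd.induction_on (p := fun w ↦ ‖J w‖ ^ 2 ≤ ε * ‖w‖ ^ 2 + C * ∑ h ∈ s, ⟪h, J w⟫_ℝ ^ 2) w
      (isClosed_le (by fun_prop) (by fun_prop)) fun f ↦ ?_
    simp only [hJ, hjnorm, hnorm]
    exact h f
  obtain ⟨u, hu, hu'⟩ := exists_linearIndependent_eigenvectors J hJc hb (fun i ↦ j (G i))
    (by convert hli using 1; ext i; simp [hJ]) (fun c ↦ by
      have : ∑ i, c i • j (G i) = j (∑ i, c i • G i) := by simp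
      rw [this, hJ, hjnorm, hnorm]
      linarith [hG c])
  refine ⟨u, hu, fun i ↦ ?_⟩
  obtain ⟨a, ha, w, hw, hwv⟩ := hu' i
  obtain ⟨f, hf⟩ : ∃ f : ℕ → L, Tendsto (fun m ↦ j (f m)) atTop (𝓝 w) := by
    have hmem : w ∈ closure (Set.range j) := hjd w
    obtain ⟨x, hx, hxt⟩ := mem_closure_iff_seq_limit.1 hmem
    choose f hf using hx
    exact ⟨f, by simpa only [hf] using hxt⟩
  have hιf : Tendsto (fun m ↦ ι (f m)) atTop (𝓝 (u i)) := by
    have := (J.continuous.tendsto w).comp hf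
    rw [hw] at this
    simpa only [Function.comp_def, hJ] using this
  refine ⟨a, ha, f, hιf, fun ε hε ↦ ?_, fun φ ↦ ?_⟩
  · have hcau := hf.cauchySeq
    rw [Metric.cauchySeq_iff] at hcau
    obtain ⟨N, hN⟩ := hcau (√ε) (Real.sqrt_pos.2 hε)
    refine ⟨N, fun l hl m hm ↦ ?_⟩
    have h1 := hN l hl m hm
    rw [dist_eq_norm, ← map_sub, hjnorm] at h1
    have h2 : ‖f l - f m‖ ^ 2 < ε := by
      rw [← Real.sq_sqrt hε.le]
      gcongr
    rw [hnorm] at h2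
    nlinarith [sq_nonneg ‖ι (f l - f m)‖]
  -- E(f_m, φ) is the form inner product minus the one of H, so its limit is ((1 + a) - 1)⟪u, ι φ⟫.
  · have h1 : Tendsto (fun m ↦ ⟪j (f m), j φ⟫_ℝ - ⟪ι (f m), ι φ⟫_ℝ) atTop
        (𝓝 (⟪w, j φ⟫_ℝ - ⟪u i, ι φ⟫_ℝ)) :=
      (hf.inner tendsto_const_nhds).sub (hιf.inner tendsto_const_nhds)
    rw [hwv, hJ] at h1
    convert h1 using 2
    · rw [hjinner, hinner]; ring
    · ring

end WeightedManifold

/-! ### The Poincaré inequality on convex Euclidean sets, and grids of cells -/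

namespace WeightedManifold

theorem sq_lintegral_le {α : Type*} [MeasurableSpace α] (μ : Measure α) {f : α → ℝ≥0∞}
    (hf : AEMeasurable f μ) : (∫⁻ x, f x ∂μ) ^ 2 ≤ μ univ * ∫⁻ x, f x ^ 2 ∂μ := by
  have h := ENNReal.lintegral_mul_le_Lp_mul_Lq μ Real.HolderConjugate.two_two hf
    (aemeasurable_const (b := (1 : ℝ≥0∞)))
  simp only [Pi.mul_apply, mul_one, ENNReal.one_rpow, lintegral_const, one_mul] at h
  calc (∫⁻ x, f x ∂μ) ^ 2
      ≤ ((∫⁻ x, f x ^ (2 : ℝ) ∂μ) ^ (1 / (2 : ℝ)) * μ univ ^ (1 / (2 : ℝ))) ^ 2 := by gcongr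
    _ = μ univ * ∫⁻ x, f x ^ 2 ∂μ := by
      rw [mul_pow, ← ENNReal.rpow_natCast, ← ENNReal.rpow_natCast, ← ENNReal.rpow_mul,
        ← ENNReal.rpow_mul]
      norm_num
      rw [mul_comm]

section Poincare

variable {E : Type*} [NormedAddCommGroup E] [NormedSpace ℝ E] [FiniteDimensional ℝ E]
  [MeasurableSpace E] [BorelSpace E]

theorem lintegral_comp_add_smul (μ : Measure E) [μ.IsAddHaarMeasure] {G : E → ℝ≥0∞}
    (hG : Measurable G) (a : E) {t : ℝ} (ht : t ≠ 0) :
    ∫⁻ y, G (a + t • y) ∂μ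
      = ENNReal.ofReal |(t ^ Module.finrank ℝ E)⁻¹| * ∫⁻ z, G z ∂μ := by
  have h1 : ∫⁻ y, G (a + t • y) ∂μ = ∫⁻ z, G (a + z) ∂(Measure.map (t • ·) μ) := by
    exact (lintegral_map (f := fun z ↦ G (a + z)) (hG.comp (measurable_const_add a))
      (measurable_const_smul t)).symm
  rw [h1, Measure.map_addHaar_smul μ ht, lintegral_smul_measure, lintegral_add_left_eq_self]
  rfl

theorem lintegral_comp_add_smul_le (μ : Measure E) [μ.IsAddHaarMeasure] {G : E → ℝ≥0∞}
    (hG : Measurable G) (a : E) {t : ℝ} (ht : 1 / 2 ≤ t) :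
    ∫⁻ y, G (a + t • y) ∂μ ≤ 2 ^ Module.finrank ℝ E * ∫⁻ z, G z ∂μ := by
  have ht0 : 0 < t := by linarith
  rw [lintegral_comp_add_smul μ hG a ht0.ne']
  gcongr
  rw [← inv_pow, abs_pow, abs_of_pos (by positivity), ENNReal.ofReal_pow (by positivity)]
  gcongr
  refine ENNReal.ofReal_le_of_le_toReal ?_
  rw [ENNReal.toReal_ofNat]
  exact inv_le_of_inv_le₀ (by norm_num) (by linarith)

/-- One of t and 1 - t is at least 1/2. Changing variables in the corresponding point, with the
other one frozen, costs at most 2^dim uniformly in t. -/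
theorem lintegral_lintegral_comp_segment_le (μ : Measure E) [μ.IsAddHaarMeasure] {G : E → ℝ≥0∞}
    (hG : Measurable G) (q : Set E) (t : ℝ) :
    ∫⁻ x in q, ∫⁻ y in q, G ((1 - t) • x + t • y) ∂μ ∂μ
      ≤ 2 ^ Module.finrank ℝ E * μ q * ∫⁻ z, G z ∂μ := by
  have main : ∀ t : ℝ, 1 / 2 ≤ t →
      ∫⁻ x in q, ∫⁻ y in q, G ((1 - t) • x + t • y) ∂μ ∂μ
        ≤ 2 ^ Module.finrank ℝ E * μ q * ∫⁻ z, G z ∂μ := by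
    intro t ht
    calc ∫⁻ x in q, ∫⁻ y in q, G ((1 - t) • x + t • y) ∂μ ∂μ
        ≤ ∫⁻ _ in q, 2 ^ Module.finrank ℝ E * ∫⁻ z, G z ∂μ ∂μ := by
          refine lintegral_mono fun x ↦ (setLIntegral_le_lintegral _ _).trans ?_
          exact lintegral_comp_add_smul_le μ hG _ ht
      _ = 2 ^ Module.finrank ℝ E * μ q * ∫⁻ z, G z ∂μ := by
          rw [setLIntegral_const]; ring
  rcases le_total (1 / 2) t with h | h
  · exact main t h
  · rw [lintegral_lintegral_swap (by
      refine Measurable.aemeasurable (hG.comp ?_)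
      fun_prop)]
    have := main (1 - t) (by linarith)
    simpa only [sub_sub_cancel, add_comm] using this

omit [FiniteDimensional ℝ E] [MeasurableSpace E] [BorelSpace E] in
-- A Lipschitz function is absolutely continuous on the segment, so the fundamental theorem of
-- calculus and Cauchy–Schwarz on [0, 1] apply.
theorem sq_enorm_sub_le_lintegral {F : E → ℝ} {K : ℝ≥0} (hF : LipschitzWith K F) (x y : E) :
    ‖F x - F y‖ₑ ^ 2 ≤ ∫⁻ t in Icc (0 : ℝ) 1, ‖deriv (fun t ↦ F ((1 - t) • x + t • y)) t‖ₑ ^ 2 := by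
  set φ : ℝ → ℝ := fun t ↦ F ((1 - t) • x + t • y) with hφ
  have hline : ∀ s t : ℝ, dist ((1 - s) • x + s • y) ((1 - t) • x + t • y) = dist s t * ‖y - x‖ := by
    intro s t
    rw [dist_eq_norm, Real.dist_eq, ← Real.norm_eq_abs, ← norm_smul]
    congr 1
    module
  have hφL : LipschitzWith (K * ‖y - x‖₊) φ := by
    refine LipschitzWith.of_dist_le_mul fun s t ↦ ?_
    calc dist (φ s) (φ t) ≤ K * dist ((1 - s) • x + s • y) ((1 - t) • x + t • y) :=
          hF.dist_le_mul _ _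
      _ = _ := by rw [hline]; push_cast; ring
  have hac := (hφL.lipschitzOnWith (s := uIcc 0 1)).absolutelyContinuousOnInterval
  have hftc := hac.integral_deriv_eq_sub
  have h01 : φ 1 - φ 0 = F y - F x := by simp [hφ]
  rw [h01] at hftc
  have h1 : ‖F x - F y‖ₑ ≤ ∫⁻ t in Icc (0 : ℝ) 1, ‖deriv φ t‖ₑ := by
    rw [← enorm_neg, neg_sub, ← hftc, intervalIntegral.integral_of_le zero_le_one,
      ← integral_Icc_eq_integral_Ioc]
    exact enorm_integral_le_lintegral_enorm _
  calc ‖F x - F y‖ₑ ^ 2 ≤ (∫⁻ t in Icc (0 : ℝ) 1, ‖deriv φ t‖ₑ) ^ 2 := by gcongr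
    _ ≤ _ := by
      refine (sq_lintegral_le _ (measurable_deriv φ).enorm.aemeasurable).trans ?_
      simp

/-- The Poincaré inequality on convex sets, in the form of a double integral. -/
theorem lintegral_lintegral_sq_enorm_sub_le (μ : Measure E) [μ.IsAddHaarMeasure] {F : E → ℝ}
    {K : ℝ≥0} (hF : LipschitzWith K F) {q : Set E} (hq : Convex ℝ q) (hqm : MeasurableSet q)
    {δ : ℝ≥0∞} (hδ : ∀ x ∈ q, ∀ y ∈ q, edist x y ≤ δ) :
    ∫⁻ x in q, ∫⁻ y in q, ‖F x - F y‖ₑ ^ 2 ∂μ ∂μ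
      ≤ 2 ^ Module.finrank ℝ E * δ ^ 2 * μ q * ∫⁻ z in q, ‖fderiv ℝ F z‖ₑ ^ 2 ∂μ := by
  classical
  -- A segment may run inside the null set where F is not differentiable. There `fderiv` is 0 by
  -- default and does not control the derivative along the segment, so it is replaced by the
  -- Lipschitz constant. By Rademacher's theorem this does not change the integral.
  let g : E → ℝ≥0∞ := {z | DifferentiableAt ℝ F z}.piecewise (fun z ↦ ‖fderiv ℝ F z‖ₑ) fun _ ↦ K
  have hgm : Measurable g := Measurable.piecewise (measurableSet_of_differentiableAt ℝ F)
    (measurable_fderiv ℝ F).enorm measurable_const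
  let G : E → ℝ≥0∞ := q.indicator fun z ↦ g z ^ 2
  have hGm : Measurable G := (hgm.pow_const 2).indicator hqm
  have hder : ∀ x ∈ q, ∀ y ∈ q, ∀ t ∈ Icc (0 : ℝ) 1,
      ‖deriv (fun t ↦ F ((1 - t) • x + t • y)) t‖ₑ ^ 2 ≤ δ ^ 2 * G ((1 - t) • x + t • y) := by
    intro x hx y hy t ht
    have hz : (1 - t) • x + t • y ∈ q := hq hx hy (by linarith [ht.2]) ht.1 (by ring)
    have hline : HasDerivAt (fun t : ℝ ↦ (1 - t) • x + t • y) (y - x) t := by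
      have h1 : HasDerivAt (fun t : ℝ ↦ (1 - t) • x + t • y) ((0 - 1 : ℝ) • x + (1 : ℝ) • y) t :=
        (((hasDerivAt_const t (1 : ℝ)).sub (hasDerivAt_id t)).smul_const x).add
          ((hasDerivAt_id t).smul_const y)
      convert h1 using 1
      module
    have hyx : ‖y - x‖ₑ ≤ δ := by
      rw [← edist_eq_enorm_sub]; exact hδ y hy x hx
    simp only [G, indicator_of_mem hz]
    rw [← mul_pow]
    gcongr
    by_cases hd : DifferentiableAt ℝ F ((1 - t) • x + t • y)
    · have : g ((1 - t) • x + t • y) = ‖fderiv ℝ F ((1 - t) • x + t • y)‖ₑ :=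
        Set.piecewise_eq_of_mem _ _ _ hd
      have h2 := (hd.hasFDerivAt.comp_hasDerivAt t hline).deriv
      rw [this]
      simp only [Function.comp_def] at h2
      rw [h2, mul_comm]
      exact (ContinuousLinearMap.le_opENorm _ _).trans (by gcongr)
    · have : g ((1 - t) • x + t • y) = K := Set.piecewise_eq_of_notMem _ _ _ hd
      rw [this, mul_comm]
      have hL : LipschitzWith (K * ‖y - x‖₊) fun t : ℝ ↦ F ((1 - t) • x + t • y) := by
        refine LipschitzWith.of_dist_le_mul fun s t ↦ (hF.dist_le_mul _ _).trans_eq ?_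
        rw [dist_eq_norm, Real.dist_eq, ← Real.norm_eq_abs, NNReal.coe_mul, coe_nnnorm, mul_assoc,
          mul_comm ‖y - x‖, ← norm_smul]
        congr 2
        module
      have h3 : ‖deriv (fun t : ℝ ↦ F ((1 - t) • x + t • y)) t‖₊ ≤ K * ‖y - x‖₊ :=
        norm_deriv_le_of_lipschitz hL
      calc ‖deriv (fun t : ℝ ↦ F ((1 - t) • x + t • y)) t‖ₑ ≤ ((K * ‖y - x‖₊ : ℝ≥0) : ℝ≥0∞) := by
            exact_mod_cast h3
        _ = K * ‖y - x‖ₑ := by push_cast; rfl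
        _ ≤ K * δ := by gcongr
  have hGint : ∫⁻ z, G z ∂μ = ∫⁻ z in q, ‖fderiv ℝ F z‖ₑ ^ 2 ∂μ := by
    simp only [G]
    rw [lintegral_indicator hqm]
    refine lintegral_congr_ae (ae_restrict_of_ae ?_)
    filter_upwards [hF.ae_differentiableAt (μ := μ)] with z hz
    rw [show g z = ‖fderiv ℝ F z‖ₑ from Set.piecewise_eq_of_mem _ _ _ hz]
  have hm3 : Measurable fun p : (E × E) × ℝ ↦ G ((1 - p.2) • p.1.1 + p.2 • p.1.2) :=
    hGm.comp (by fun_prop)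
  -- Tonelli moves the segment parameter t outermost, where the bound uniform in t applies.
  calc ∫⁻ x in q, ∫⁻ y in q, ‖F x - F y‖ₑ ^ 2 ∂μ ∂μ
      ≤ ∫⁻ x in q, ∫⁻ y in q, ∫⁻ t in Icc (0 : ℝ) 1,
          δ ^ 2 * G ((1 - t) • x + t • y) ∂volume ∂μ ∂μ := by
        refine setLIntegral_mono' hqm fun x hx ↦ setLIntegral_mono' hqm fun y hy ↦ ?_
        refine (sq_enorm_sub_le_lintegral hF x y).trans ?_
        exact setLIntegral_mono' measurableSet_Icc fun t ht ↦ hder x hx y hy t ht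
    _ = ∫⁻ x in q, ∫⁻ t in Icc (0 : ℝ) 1, ∫⁻ y in q,
          δ ^ 2 * G ((1 - t) • x + t • y) ∂μ ∂volume ∂μ := by
        refine lintegral_congr fun x ↦ lintegral_lintegral_swap (Measurable.aemeasurable ?_)
        exact (hm3.comp (((measurable_const (a := x)).prodMk measurable_fst).prodMk
          measurable_snd)).const_mul _
    _ = ∫⁻ t in Icc (0 : ℝ) 1, ∫⁻ x in q, ∫⁻ y in q,
          δ ^ 2 * G ((1 - t) • x + t • y) ∂μ ∂μ := by
        refine lintegral_lintegral_swap (Measurable.aemeasurable ?_)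
        refine Measurable.lintegral_prod_right' (f := fun p : (E × ℝ) × E ↦
          δ ^ 2 * G ((1 - p.1.2) • p.1.1 + p.1.2 • p.2)) ?_
        exact (hm3.comp ((measurable_fst.fst.prodMk measurable_snd).prodMk
          measurable_fst.snd)).const_mul _
    _ ≤ ∫⁻ _ in Icc (0 : ℝ) 1, δ ^ 2 * (2 ^ Module.finrank ℝ E * μ q * ∫⁻ z, G z ∂μ) := by
        refine setLIntegral_mono' measurableSet_Icc fun t ht ↦ ?_
        have h1 : ∀ x, ∫⁻ y in q, δ ^ 2 * G ((1 - t) • x + t • y) ∂μ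
            = δ ^ 2 * ∫⁻ y in q, G ((1 - t) • x + t • y) ∂μ := fun x ↦
          lintegral_const_mul _ (hGm.comp (by fun_prop))
        simp_rw [h1]
        rw [lintegral_const_mul]
        · gcongr
          exact lintegral_lintegral_comp_segment_le μ hGm q t
        · refine Measurable.lintegral_prod_right' (f := fun p : E × E ↦
            G ((1 - t) • p.1 + t • p.2)) (hGm.comp (by fun_prop))
    _ = 2 ^ Module.finrank ℝ E * δ ^ 2 * μ q * ∫⁻ z in q, ‖fderiv ℝ F z‖ₑ ^ 2 ∂μ := by
        rw [setLIntegral_const, hGint]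
        simp
        ring

end Poincare

section Cells

variable {n : ℕ}

/-- The cell with index `c` of the grid with mesh `d`. -/
def gridCell (d : ℝ) (c : Fin n → ℤ) : Set (EuclideanSpace ℝ (Fin n)) :=
  {y | ∀ i, ⌊y i / d⌋ = c i}

theorem gridCell_eq {d : ℝ} (hd : 0 < d) (c : Fin n → ℤ) :
    gridCell d c = ⋂ i, (EuclideanSpace.proj i : EuclideanSpace ℝ (Fin n) →L[ℝ] ℝ) ⁻¹'
      Ico (c i * d) ((c i + 1) * d) := by
  ext y
  simp only [gridCell, mem_ofPred_eq, Int.floor_eq_iff, mem_iInter, mem_preimage, mem_Ico,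
    le_div_iff₀ hd, div_lt_iff₀ hd]
  rfl

theorem convex_gridCell {d : ℝ} (hd : 0 < d) (c : Fin n → ℤ) : Convex ℝ (gridCell d c) := by
  rw [gridCell_eq hd]
  exact convex_iInter fun i ↦ (convex_Ico _ _).linear_preimage
    (EuclideanSpace.proj i : EuclideanSpace ℝ (Fin n) →L[ℝ] ℝ).toLinearMap

theorem measurableSet_gridCell {d : ℝ} (hd : 0 < d) (c : Fin n → ℤ) :
    MeasurableSet (gridCell d c) := by
  rw [gridCell_eq hd]
  exact MeasurableSet.iInter fun i ↦ (EuclideanSpace.proj i : EuclideanSpace ℝ (Fin n) →L[ℝ] ℝ).measurable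
    measurableSet_Ico

/-- A ball is a finite disjoint union of convex sets of small diameter. -/
theorem exists_convex_cells (p : EuclideanSpace ℝ (Fin n)) (r : ℝ) {δ : ℝ} (hδ : 0 < δ) :
    ∃ (s : Finset (Fin n → ℤ)) (q : (Fin n → ℤ) → Set (EuclideanSpace ℝ (Fin n))),
      (∀ c, Convex ℝ (q c)) ∧ (∀ c, MeasurableSet (q c)) ∧
      (∀ c, ∀ x ∈ q c, ∀ y ∈ q c, edist x y ≤ ENNReal.ofReal δ) ∧
      Pairwise (Function.onFun Disjoint q) ∧ Metric.ball p r = ⋃ c ∈ s, q c := by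
  -- A cell of mesh d has diameter at most √n·d ≤ δ; the summand 1 keeps the denominator positive.
  set d : ℝ := δ / (√n + 1) with hd
  have hd0 : 0 < d := by positivity
  have hfin : (⋃ y ∈ Metric.ball p r, {c : Fin n → ℤ | y ∈ gridCell d c}).Finite := by
    refine (Set.finite_Icc (fun i ↦ ⌊(p i - r) / d⌋) (fun i ↦ ⌊(p i + r) / d⌋)).subset ?_
    intro c hc
    simp only [mem_iUnion, mem_ofPred_eq, exists_prop] at hc
    obtain ⟨y, hy, hc⟩ := hc
    have h1 : ∀ i, |y i - p i| < r := fun i ↦ by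
      have h2 := PiLp.norm_apply_le (y - p) i
      rw [PiLp.sub_apply, Real.norm_eq_abs] at h2
      exact h2.trans_lt (by simpa [dist_eq_norm] using hy)
    constructor
    · intro i
      rw [← hc i]
      have := abs_lt.1 (h1 i)
      exact Int.floor_le_floor (by gcongr; linarith)
    · intro i
      rw [← hc i]
      have := abs_lt.1 (h1 i)
      exact Int.floor_le_floor (by gcongr; linarith)
  refine ⟨hfin.toFinset, fun c ↦ Metric.ball p r ∩ gridCell d c,
    fun c ↦ (convex_ball p r).inter (convex_gridCell hd0 c),
    fun c ↦ measurableSet_ball.inter (measurableSet_gridCell hd0 c), ?_, ?_, ?_⟩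
  · rintro c x ⟨-, hx⟩ y ⟨-, hy⟩
    rw [edist_dist]
    refine ENNReal.ofReal_le_ofReal ?_
    rw [gridCell_eq hd0] at hx hy
    simp only [mem_iInter, mem_preimage, mem_Ico] at hx hy
    rw [EuclideanSpace.dist_eq]
    calc √(∑ i, dist (x i) (y i) ^ 2) ≤ √(∑ _i : Fin n, d ^ 2) := by
          refine Real.sqrt_le_sqrt (Finset.sum_le_sum fun i _ ↦ ?_)
          have : dist (x i) (y i) ≤ d := by
            rw [Real.dist_eq, abs_le]
            have h1 : c i * d ≤ x i ∧ x i < (c i + 1) * d := hx i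
            have h2 : c i * d ≤ y i ∧ y i < (c i + 1) * d := hy i
            constructor <;> linarith
          gcongr
      _ = √n * d := by
          simp [Real.sqrt_sq hd0.le]
      _ ≤ δ := by
          rw [hd, mul_div_assoc', div_le_iff₀ (by positivity)]
          nlinarith
  · intro c c' hcc
    refine Set.disjoint_left.2 fun y hy hy' ↦ hcc ?_
    ext i
    rw [← hy.2 i, ← hy'.2 i]
  · ext y
    simp only [mem_iUnion, Finite.mem_toFinset, mem_ofPred_eq, exists_prop, mem_inter_iff]
    constructor
    · intro hy
      exact ⟨fun i ↦ ⌊y i / d⌋, ⟨y, hy, fun i ↦ rfl⟩, hy, fun i ↦ rfl⟩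
    · rintro ⟨c, -, hy, -⟩
      exact hy

end Cells

end WeightedManifold

/-! ### Truncations on the line and the choice of thresholds -/

namespace WeightedManifold

/-- The distance from `t` to the complement of the interval `(a, b)`. -/
def tent (a b t : ℝ) : ℝ := max 0 (min (t - a) (b - t))

theorem tent_nonneg (a b t : ℝ) : 0 ≤ tent a b t := le_max_left _ _

theorem continuous_tent (a b : ℝ) : Continuous (tent a b) := by unfold tent; fun_prop

theorem tent_eq_zero {a b t : ℝ} (h : t ∉ Ioo a b) : tent a b t = 0 := by
  rw [tent, max_eq_left]
  by_contra! hlt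
  exact h ⟨by linarith [(lt_min_iff.1 hlt).1], by linarith [(lt_min_iff.1 hlt).2]⟩

theorem tent_pos {a b t : ℝ} (h : t ∈ Ioo a b) : 0 < tent a b t :=
  lt_max_of_lt_right (lt_min (by linarith [h.1]) (by linarith [h.2]))

theorem abs_tent_sub_le (a b s t : ℝ) : |tent a b s - tent a b t| ≤ |s - t| := by
  unfold tent
  grind

theorem tent_le {a b t : ℝ} (h : a ≤ b) : tent a b t ≤ b - a := by
  unfold tent
  grind

theorem min_le_tent (a b t : ℝ) : min (t - a) (b - t) ≤ tent a b t := le_max_right _ _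

/-- With c = min s b, the tent lies above t - a on the left half of [a, c] and above c - t on the
right half: two triangles of area (c - a)²/8. For s ≤ a the left side is 0. -/
theorem sq_div_four_le_integral_tent {a b s : ℝ} (ha : 0 ≤ a) (hab : a ≤ b) (hs : 0 ≤ s) :
    (min s b - min s a) ^ 2 / 4 ≤ ∫ t in (0 : ℝ)..s, tent a b t := by
  rcases le_total s a with h | h
  · rw [min_eq_left h, min_eq_left (h.trans hab)]
    simpa using intervalIntegral.integral_nonneg hs fun t _ ↦ tent_nonneg a b t
  · rw [min_eq_right h]
    set c := min s b with hc
    have hac : a ≤ c := le_min h hab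
    have hcs : c ≤ s := min_le_left _ _
    have hcb : c ≤ b := min_le_right _ _
    set m := (a + c) / 2 with hm
    have hint : ∀ x y : ℝ, IntervalIntegrable (tent a b) volume x y := fun x y ↦
      (continuous_tent a b).intervalIntegrable x y
    have h1 : (c - a) ^ 2 / 8 ≤ ∫ t in a..m, tent a b t := by
      have h2 : ∫ t in a..m, (t - a) ≤ ∫ t in a..m, tent a b t := by
        refine intervalIntegral.integral_mono_on (by linarith)
          (Continuous.intervalIntegrable (by fun_prop) _ _) (hint _ _) ?_
        intro t ht
        refine le_trans ?_ (min_le_tent a b t)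
        exact le_min le_rfl (by linarith [ht.2])
      have h3 : ∫ t in a..m, (t - a) = (c - a) ^ 2 / 8 := by
        rw [intervalIntegral.integral_comp_sub_right (fun t ↦ t), integral_id, hm]; ring
      linarith
    have h2 : (c - a) ^ 2 / 8 ≤ ∫ t in m..c, tent a b t := by
      have h2 : ∫ t in m..c, (c - t) ≤ ∫ t in m..c, tent a b t := by
        refine intervalIntegral.integral_mono_on (by linarith)
          (Continuous.intervalIntegrable (by fun_prop) _ _) (hint _ _) ?_
        intro t ht
        refine le_trans ?_ (min_le_tent a b t)
        exact le_min (by linarith [ht.1]) (by linarith)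
      have h3 : ∫ t in m..c, (c - t) = (c - a) ^ 2 / 8 := by
        rw [intervalIntegral.integral_comp_sub_left (fun t ↦ t), integral_id, hm]; ring
      linarith
    have h3 : 0 ≤ ∫ t in (0 : ℝ)..a, tent a b t :=
      intervalIntegral.integral_nonneg ha fun t _ ↦ tent_nonneg a b t
    have h4 : 0 ≤ ∫ t in c..s, tent a b t :=
      intervalIntegral.integral_nonneg hcs fun t _ ↦ tent_nonneg a b t
    rw [← intervalIntegral.integral_add_adjacent_intervals (hint 0 a) (hint a s),
      ← intervalIntegral.integral_add_adjacent_intervals (hint a c) (hint c s),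
      ← intervalIntegral.integral_add_adjacent_intervals (hint a m) (hint m c)]
    linarith

/-- The sum of the tents over consecutive thresholds. -/
def zigzag (t : ℕ → ℝ) (N : ℕ) (s : ℝ) : ℝ := ∑ i ∈ Finset.range N, tent (t i) (t (i + 1)) s

theorem continuous_zigzag (t : ℕ → ℝ) (N : ℕ) : Continuous (zigzag t N) :=
  continuous_finsetSum _ fun _ _ ↦ continuous_tent _ _

theorem zigzag_nonneg (t : ℕ → ℝ) (N : ℕ) (s : ℝ) : 0 ≤ zigzag t N s :=
  Finset.sum_nonneg fun _ _ ↦ tent_nonneg _ _ _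

theorem zigzag_le {t : ℕ → ℝ} (ht : Monotone t) (N : ℕ) (s : ℝ) :
    zigzag t N s ≤ t N - t 0 := by
  rw [← Finset.sum_range_sub]
  exact Finset.sum_le_sum fun i _ ↦ tent_le (ht (Nat.le_succ i))

theorem tent_mul_tent_eq_zero {t : ℕ → ℝ} (ht : Monotone t) {i j : ℕ} (hij : i ≠ j) (s : ℝ) :
    tent (t i) (t (i + 1)) s * tent (t j) (t (j + 1)) s = 0 := by
  wlog h : i < j generalizing i j
  · rw [mul_comm]; exact this hij.symm (by omega)
  by_contra hne
  have h1 : s ∈ Ioo (t i) (t (i + 1)) := by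
    by_contra hs; exact hne (by rw [tent_eq_zero hs, zero_mul])
  have h2 : s ∈ Ioo (t j) (t (j + 1)) := by
    by_contra hs; exact hne (by rw [tent_eq_zero hs, mul_zero])
  linarith [h1.2, h2.1, ht (Nat.succ_le_of_lt h)]

/-- Distinct tents have disjoint supports, so the cross terms vanish. -/
theorem sq_sum_mul_tent {t : ℕ → ℝ} (ht : Monotone t) {ι : Type*} (S : Finset ι) {e : ι → ℕ}
    (he : Function.Injective e) (c : ι → ℝ) (s : ℝ) :
    (∑ i ∈ S, c i * tent (t (e i)) (t (e i + 1)) s) ^ 2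
      = ∑ i ∈ S, c i ^ 2 * tent (t (e i)) (t (e i + 1)) s ^ 2 := by
  classical
  rw [sq, Finset.sum_mul_sum]
  refine Finset.sum_congr rfl fun i hi ↦ ?_
  rw [Finset.sum_eq_single_of_mem i hi]
  · ring
  · intro j _ hji
    have := tent_mul_tent_eq_zero ht (he.ne hji.symm) s
    linear_combination c i * c j * this

theorem sq_zigzag {t : ℕ → ℝ} (ht : Monotone t) (N : ℕ) (s : ℝ) :
    zigzag t N s ^ 2 = ∑ i ∈ Finset.range N, tent (t i) (t (i + 1)) s ^ 2 := by
  simpa [zigzag] using sq_sum_mul_tent ht (Finset.range N) Function.injective_id (fun _ ↦ 1) s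

/-- The thresholds cut s into N increments, so Cauchy–Schwarz bounds s² by N times the sum of their
squares, and each square is at most four times the integral of its tent. The bound does not depend
on the spacing of the thresholds. -/
theorem sq_div_le_integral_zigzag {t : ℕ → ℝ} (ht : Monotone t) (ht0 : t 0 = 0) {N : ℕ}
    {s : ℝ} (hs : 0 ≤ s) (hsN : s ≤ t N) :
    s ^ 2 ≤ 4 * N * ∫ x in (0 : ℝ)..s, zigzag t N x := by
  have h1 : ∑ i ∈ Finset.range N, (min s (t (i + 1)) - min s (t i)) = s := by
    rw [Finset.sum_range_sub (fun i ↦ min s (t i)), ht0, min_eq_left hsN, min_eq_right hs, sub_zero]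
  have h2 := sq_sum_le_card_mul_sum_sq (s := Finset.range N)
    (f := fun i ↦ min s (t (i + 1)) - min s (t i))
  rw [h1, Finset.card_range] at h2
  have h3 : ∫ x in (0 : ℝ)..s, zigzag t N x
      = ∑ i ∈ Finset.range N, ∫ x in (0 : ℝ)..s, tent (t i) (t (i + 1)) x :=
    intervalIntegral.integral_finsetSum fun i _ ↦ (continuous_tent _ _).intervalIntegrable _ _
  have h4 : ∑ i ∈ Finset.range N, (min s (t (i + 1)) - min s (t i)) ^ 2 / 4
      ≤ ∫ x in (0 : ℝ)..s, zigzag t N x := by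
    rw [h3]
    refine Finset.sum_le_sum fun i _ ↦ ?_
    exact sq_div_four_le_integral_tent (ht0 ▸ ht (Nat.zero_le i)) (ht (Nat.le_succ i)) hs
  rw [← Finset.sum_div] at h4
  nlinarith [Nat.cast_nonneg (α := ℝ) N]

theorem continuous_integral_sq_tent {X : Type*} [MeasurableSpace X] (μ : Measure X)
    [IsFiniteMeasure μ] {f : X → ℝ} (hf : Measurable f) (a : ℝ) :
    Continuous fun b ↦ ∫ x, tent a b (f x) ^ 2 ∂μ := by
  rw [continuous_iff_continuousAt]
  intro b
  -- The bound holds for all parameters at distance less than 1 from b.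
  refine continuousAt_of_dominated (bound := fun _ ↦ (|b| + 1 + |a|) ^ 2)
    (Eventually.of_forall fun b ↦ ?_) ?_ (integrable_const _) ?_
  · exact (((continuous_tent a b).measurable.comp hf).pow_const 2).aestronglyMeasurable
  · filter_upwards [Metric.ball_mem_nhds b one_pos] with c hc
    refine Eventually.of_forall fun x ↦ ?_
    rw [Metric.mem_ball, Real.dist_eq] at hc
    rw [Real.norm_eq_abs, abs_pow]
    have h1 : |tent a c (f x)| ≤ |b| + 1 + |a| := by
      unfold tent
      grind
    gcongr
  · refine Eventually.of_forall fun x ↦ ?_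
    unfold tent
    fun_prop

/-- The integral is continuous in b and vanishes at b = a. Either it stays below C up to the cap m,
and b = m is taken, or the intermediate value theorem gives a b with value C. -/
theorem exists_next_threshold {X : Type*} [MeasurableSpace X] (μ : Measure X)
    [IsFiniteMeasure μ] {f : X → ℝ} (hf : Measurable f) {C m a : ℝ} (hC : 0 ≤ C) (ha : a ≤ m) :
    ∃ b, a ≤ b ∧ b ≤ m ∧ ∫ x, tent a b (f x) ^ 2 ∂μ ≤ C ∧
      (b < m → ∫ x, tent a b (f x) ^ 2 ∂μ = C) := by
  rcases le_total (∫ x, tent a m (f x) ^ 2 ∂μ) C with h | h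
  · exact ⟨m, ha, le_rfl, h, fun hlt ↦ absurd hlt (lt_irrefl _)⟩
  · have h0 : ∫ x, tent a a (f x) ^ 2 ∂μ = 0 := by
      simp [tent_eq_zero]
    obtain ⟨b, hb, hbC⟩ := intermediate_value_Icc ha
      (continuous_integral_sq_tent μ hf a).continuousOn ⟨h0.le.trans hC, h⟩
    exact ⟨b, hb.1, hb.2, hbC.le, fun _ ↦ hbC⟩

/-- Iterating the choice of the next threshold from 0. As long as the cap m has not been reached,
all truncations so far have norm exactly C, which is what feeds the eigenvalue bound. -/
theorem exists_thresholds {X : Type*} [MeasurableSpace X] (μ : Measure X)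
    [IsFiniteMeasure μ] {f : X → ℝ} (hf : Measurable f) {C m : ℝ} (hC : 0 ≤ C) (hm : 0 ≤ m) :
    ∃ t : ℕ → ℝ, Monotone t ∧ t 0 = 0 ∧ (∀ i, t i ≤ m) ∧
      (∀ i, ∫ x, tent (t i) (t (i + 1)) (f x) ^ 2 ∂μ ≤ C) ∧
      ∀ i, t (i + 1) < m → ∫ x, tent (t i) (t (i + 1)) (f x) ^ 2 ∂μ = C := by
  have h : ∀ a : Iic m, ∃ b : Iic m, (a : ℝ) ≤ b ∧ ∫ x, tent a b (f x) ^ 2 ∂μ ≤ C ∧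
      ((b : ℝ) < m → ∫ x, tent a b (f x) ^ 2 ∂μ = C) := fun a ↦ by
    obtain ⟨b, h1, h2, h3⟩ := exists_next_threshold μ hf hC a.2
    exact ⟨⟨b, h2⟩, h1, h3⟩
  choose F hF using h
  let t : ℕ → Iic m := fun i ↦ F^[i] ⟨0, hm⟩
  have hsucc : ∀ i, t (i + 1) = F (t i) := fun i ↦ Function.iterate_succ_apply' F i _
  refine ⟨fun i ↦ t i, monotone_nat_of_le_succ fun i ↦ ?_, rfl, fun i ↦ (t i).2, fun i ↦ ?_,
    fun i ↦ ?_⟩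
  · rw [hsucc]; exact (hF _).1
  · simp only [hsucc]; exact (hF _).2.1
  · simp only [hsucc]; exact (hF _).2.2

end WeightedManifold

/-! ### Riemannian distance in the preferred charts -/

namespace WeightedManifold

set_option linter.unusedSectionVars false

variable {n : ℕ} {M : Type*} [MetricSpace M]
    [ChartedSpace (EuclideanSpace ℝ (Fin n)) M] [IsManifold (𝓡 n) ∞ M]
    [RiemannianBundle (fun x : M ↦ TangentSpace (𝓡 n) x)]
    [IsContMDiffRiemannianBundle (𝓡 n) ∞ (EuclideanSpace ℝ (Fin n))
      (fun x : M ↦ TangentSpace (𝓡 n) x)]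
    [IsRiemannianManifold (𝓡 n) M]

instance instIsContinuousRiemannianBundleTangent :
    IsContinuousRiemannianBundle (EuclideanSpace ℝ (Fin n))
      (fun x : M ↦ TangentSpace (𝓡 n) x) := by
  obtain ⟨g, hg, h⟩ := IsContMDiffRiemannianBundle.exists_contMDiff (IB := 𝓡 n) (n := ∞)
    (F := EuclideanSpace ℝ (Fin n)) (E := fun x : M ↦ TangentSpace (𝓡 n) x)
  exact ⟨g, hg.continuous, h⟩

/-- The Riemannian norm at `x` of a tangent vector given by its coordinates. -/
noncomputable def tangentNorm (x : M) (v : EuclideanSpace ℝ (Fin n)) : ℝ :=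
  ‖(show TangentSpace (𝓡 n) x from v)‖

/-- The differential of the inverse of the preferred chart at `p`, in coordinates. -/
noncomputable def chartDeriv (p : M) (y : EuclideanSpace ℝ (Fin n)) :
    EuclideanSpace ℝ (Fin n) →L[ℝ] EuclideanSpace ℝ (Fin n) :=
  mfderiv 𝓘(ℝ, EuclideanSpace ℝ (Fin n)) (𝓡 n) (extChartAt (𝓡 n) p).symm y

theorem chartDeriv_eq_symmL (p : M) {x : M} (hx : x ∈ (extChartAt (𝓡 n) p).source)
    (v : EuclideanSpace ℝ (Fin n)) :
    chartDeriv p (extChartAt (𝓡 n) p x) v =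
      (trivializationAt (EuclideanSpace ℝ (Fin n)) (TangentSpace (𝓡 n)) p).symmL ℝ x v := by
  rw [extChartAt_source] at hx
  rw [TangentBundle.symmL_trivializationAt hx, ModelWithCorners.range_eq_univ,
    mfderivWithin_univ]
  rfl

/-- The tangent space at p is identified with the model space through the preferred chart at p
itself, so at the centre the differential is the identity. -/
theorem chartDeriv_self (p : M) (v : EuclideanSpace ℝ (Fin n)) :
    chartDeriv p (extChartAt (𝓡 n) p p) v = v := by
  have h := mfderivWithin_range_extChartAt_symm (I := 𝓡 n) (x := p)
  rw [ModelWithCorners.range_eq_univ, mfderivWithin_univ] at h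
  exact congrArg (fun L : EuclideanSpace ℝ (Fin n) →L[ℝ] EuclideanSpace ℝ (Fin n) ↦ L v) h

theorem symmL_self (p : M) (v : EuclideanSpace ℝ (Fin n)) :
    (trivializationAt (EuclideanSpace ℝ (Fin n)) (TangentSpace (𝓡 n)) p).symmL ℝ p v = v :=
  (chartDeriv_eq_symmL p (mem_extChartAt_source p) v).symm.trans (chartDeriv_self p v)

/-- The image of the straight segment is a competitor for the Riemannian distance, and L bounds its
speed. -/
theorem edist_extChartAt_symm_le (p : M) {y z : EuclideanSpace ℝ (Fin n)}
    (hyz : segment ℝ y z ⊆ (extChartAt (𝓡 n) p).target) {L : ℝ≥0∞}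
    (hL : ∀ w ∈ segment ℝ y z, ENNReal.ofReal (tangentNorm ((extChartAt (𝓡 n) p).symm w) (chartDeriv p w (z - y))) ≤ L) :
    edist ((extChartAt (𝓡 n) p).symm y) ((extChartAt (𝓡 n) p).symm z) ≤ L := by
  let η := ContinuousAffineMap.lineMap (R := ℝ) y z
  let γ : ℝ → M := (extChartAt (𝓡 n) p).symm ∘ η
  have hseg : ∀ t ∈ Icc (0 : ℝ) 1, η t ∈ segment ℝ y z := fun t ht ↦ by
    rw [segment_eq_image_lineMap]; exact ⟨t, ht, rfl⟩
  have hη : MapsTo η (Icc 0 1) (extChartAt (𝓡 n) p).target := fun t ht ↦ hyz (hseg t ht)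
  have η_smooth : CMDiff[Icc 0 1] 1 η := by
    apply ContMDiff.contMDiffOn
    rw [contMDiff_iff_contDiff]
    exact ContinuousAffineMap.contDiff _
  have h1 : riemannianEDist (𝓡 n) ((extChartAt (𝓡 n) p).symm y) ((extChartAt (𝓡 n) p).symm z)
      ≤ pathELength (𝓡 n) γ 0 1 := by
    apply riemannianEDist_le_pathELength _ _ _ zero_le_one
    · exact (contMDiffOn_extChartAt_symm p).comp η_smooth hη
    · simp [γ, η, ContinuousAffineMap.coe_lineMap_eq]
    · simp [γ, η, ContinuousAffineMap.coe_lineMap_eq]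
  rw [IsRiemannianManifold.out (I := 𝓡 n)]
  apply h1.trans
  rw [pathELength_eq_lintegral_mfderivWithin_Icc]
  have h2 : ∀ t ∈ Icc (0 : ℝ) 1, ‖mfderivWithin 𝓘(ℝ, ℝ) (𝓡 n) γ (Icc 0 1) t 1‖ₑ ≤ L := by
    intro t ht
    have h3 : mfderivWithin 𝓘(ℝ, ℝ) (𝓡 n) γ (Icc 0 1) t =
        (mfderiv 𝓘(ℝ, EuclideanSpace ℝ (Fin n)) (𝓡 n) (extChartAt (𝓡 n) p).symm (η t)) ∘L
          (mfderiv[Icc 0 1] η t) := by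
      apply mfderiv_comp_mfderivWithin
      · have := mdifferentiableWithinAt_extChartAt_symm (I := 𝓡 n) (hη ht)
        rwa [ModelWithCorners.range_eq_univ, mdifferentiableWithinAt_univ] at this
      · exact η_smooth.mdifferentiableOn one_ne_zero t ht
      · rw [uniqueMDiffWithinAt_iff_uniqueDiffWithinAt]
        exact uniqueDiffOn_Icc zero_lt_one t ht
    have h4 : fderivWithin ℝ η (Icc 0 1) t (1 : ℝ) = z - y := by
      rw [fderivWithin_eq_fderiv (uniqueDiffOn_Icc zero_lt_one _ ht)
        (ContinuousAffineMap.differentiableAt _)]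
      simp [η]
    have h5 : mfderivWithin 𝓘(ℝ, ℝ) (𝓡 n) γ (Icc 0 1) t (1 : ℝ)
        = chartDeriv p (η t) (z - y) := by
      rw [h3, mfderivWithin_eq_fderivWithin, ← h4]; rfl
    have h6 : ‖mfderivWithin 𝓘(ℝ, ℝ) (𝓡 n) γ (Icc 0 1) t (1 : ℝ)‖ₑ = ENNReal.ofReal
        (tangentNorm (γ t) (mfderivWithin 𝓘(ℝ, ℝ) (𝓡 n) γ (Icc 0 1) t (1 : ℝ))) :=
      (ofReal_norm _).symm
    refine h6.trans_le ((congrArg (fun v : EuclideanSpace ℝ (Fin n) ↦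
      ENNReal.ofReal (tangentNorm (γ t) v)) h5).trans_le (hL _ (hseg t ht)))
  calc _ ≤ ∫⁻ _ in Icc (0 : ℝ) 1, L := setLIntegral_mono' measurableSet_Icc h2
    _ = L := by simp

/-- Continuity of the metric: near x, the coordinate identification of nearby tangent spaces with
T_xM distorts norms by a factor close to 1. -/
theorem eventually_tangentNorm_chartDeriv_le (x : M) {r : ℝ} (hr : 1 < r) :
    ∀ᶠ y in 𝓝 (extChartAt (𝓡 n) x x), ∀ v,
      tangentNorm ((extChartAt (𝓡 n) x).symm y) (chartDeriv x y v) ≤ r * tangentNorm x v := by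
  have h := eventually_norm_symmL_trivializationAt_comp_self_lt (EuclideanSpace ℝ (Fin n))
    (TangentSpace (𝓡 n) : M → Type _) x hr
  have hc : Tendsto (extChartAt (𝓡 n) x).symm (𝓝 (extChartAt (𝓡 n) x x)) (𝓝 x) := by
    have := (continuousAt_extChartAt_symm (I := 𝓡 n) x).tendsto
    rwa [extChartAt_to_inv] at this
  filter_upwards [hc.eventually h, extChartAt_target_mem_nhds (I := 𝓡 n) x] with y hy hyt v
  set z := (extChartAt (𝓡 n) x).symm y with hz
  have hzs : z ∈ (extChartAt (𝓡 n) x).source := (extChartAt (𝓡 n) x).map_target hyt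
  have hyz : extChartAt (𝓡 n) x z = y := (extChartAt (𝓡 n) x).right_inv hyt
  have h1 := chartDeriv_eq_symmL x hzs v
  rw [hyz] at h1
  have hx : x ∈ (trivializationAt (EuclideanSpace ℝ (Fin n))
    (TangentSpace (𝓡 n) : M → Type _) x).baseSet := FiberBundle.mem_baseSet_trivializationAt' x
  have h2 := ContinuousLinearMap.le_of_opNorm_le _ hy.le
    ((trivializationAt (EuclideanSpace ℝ (Fin n)) (TangentSpace (𝓡 n)) x).symmL ℝ x v)
  rw [ContinuousLinearMap.comp_apply, Trivialization.continuousLinearMapAt_symmL _ hx] at h2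
  rw [symmL_self] at h2
  rw [h1]
  exact h2

theorem eventually_edist_le_tangentNorm (x : M) {r : ℝ} (hr : 1 < r) :
    ∀ᶠ y in 𝓝 (extChartAt (𝓡 n) x x), edist x ((extChartAt (𝓡 n) x).symm y) ≤
      ENNReal.ofReal (r * tangentNorm x (y - extChartAt (𝓡 n) x x)) := by
  obtain ⟨ε, hε, hball⟩ := Metric.mem_nhds_iff.1
    (inter_mem (eventually_tangentNorm_chartDeriv_le (n := n) x hr)
      (extChartAt_target_mem_nhds (I := 𝓡 n) x))
  filter_upwards [Metric.ball_mem_nhds _ hε] with y hy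
  have hseg : segment ℝ (extChartAt (𝓡 n) x x) y ⊆ Metric.ball (extChartAt (𝓡 n) x x) ε :=
    (convex_ball _ _).segment_subset (Metric.mem_ball_self hε) hy
  have := edist_extChartAt_symm_le x (hseg.trans fun w hw ↦ (hball hw).2)
    (L := ENNReal.ofReal (r * tangentNorm x (y - extChartAt (𝓡 n) x x)))
    fun w hw ↦ ENNReal.ofReal_le_ofReal ((hball (hseg hw)).1 _)
  rwa [extChartAt_to_inv] at this

/-- A nearly minimizing curve from x to a nearby point stays in the region where the metric is
r-close to the one at x, so its coordinate image, measured by the norm at x, is at most r times as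
long. The coordinate displacement is the integral of the velocity. -/
theorem eventually_tangentNorm_le_edist (x : M) {r : ℝ} (hr : 1 < r) :
    ∀ᶠ y in 𝓝 x, ENNReal.ofReal (tangentNorm x (extChartAt (𝓡 n) x y - extChartAt (𝓡 n) x x))
      ≤ ENNReal.ofReal r * edist x y := by
  have h := eventually_norm_symmL_trivializationAt_self_comp_lt (EuclideanSpace ℝ (Fin n))
    (TangentSpace (𝓡 n) : M → Type _) x hr
  obtain ⟨ρ, hρ, hball⟩ := setOfPred_riemannianEDist_lt_subset_nhds' (𝓡 n)
    (inter_mem h (chart_source_mem_nhds (EuclideanSpace ℝ (Fin n)) x))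
  have hev : ∀ᶠ y in 𝓝 x, riemannianEDist (𝓡 n) x y < ρ := eventually_riemannianEDist_lt (𝓡 n) x hρ
  let T := (trivializationAt (EuclideanSpace ℝ (Fin n)) (TangentSpace (𝓡 n) : M → Type _) x).symmL
    ℝ x
  filter_upwards [hev] with y hy
  rw [IsRiemannianManifold.out (I := 𝓡 n)]
  have hr0 : ENNReal.ofReal r ≠ 0 := by
    rw [Ne, ENNReal.ofReal_eq_zero, not_le]; linarith
  rw [mul_comm, ← ENNReal.div_le_iff hr0 ENNReal.ofReal_ne_top]
  refine le_of_forall_gt_imp_ge_of_dense fun a ha ↦ ?_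
  rw [ENNReal.div_le_iff hr0 ENNReal.ofReal_ne_top]
  -- The length of γ is below a, for the estimate, and below ρ, to keep γ in the good neighbourhood.
  obtain ⟨γ, hγ0, hγ1, hγs, hγl, -⟩ := exists_lt_locally_constant_of_riemannianEDist_lt
    (lt_min ha hy) zero_lt_one
  have hγmem : ∀ t ∈ Icc (0 : ℝ) 1, γ t ∈ {y | riemannianEDist (𝓡 n) x y < ρ} := by
    intro t ht
    have h1 : riemannianEDist (𝓡 n) x (γ t) ≤ pathELength (𝓡 n) γ 0 t :=
      riemannianEDist_le_pathELength hγs.contMDiffOn hγ0 rfl ht.1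
    exact (h1.trans (pathELength_mono le_rfl ht.2)).trans_lt (hγl.trans_le (min_le_right _ _))
  let γ' : ℝ → EuclideanSpace ℝ (Fin n) := extChartAt (𝓡 n) x ∘ γ
  have hγ' : ContDiffOn ℝ 1 γ' (Icc 0 1) := by
    rw [← contMDiffOn_iff_contDiffOn]
    exact contMDiffOn_extChartAt.comp (I' := 𝓡 n)
      (t := (chartAt (EuclideanSpace ℝ (Fin n)) x).source) hγs.contMDiffOn
      fun t ht ↦ (hball (hγmem t ht)).2
  -- T is the identity on coordinates; it only replaces the Euclidean norm by the Riemannian norm at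
  -- x.
  let Γ : ℝ → TangentSpace (𝓡 n) x := fun t ↦ T (γ' t)
  have hΓ : ContDiffOn ℝ 1 Γ (Icc 0 1) := T.contDiff.comp_contDiffOn hγ'
  have hder : ∀ t ∈ Icc (0 : ℝ) 1, ‖derivWithin Γ (Icc 0 1) t‖ₑ ≤
      ENNReal.ofReal r * ‖mfderivWithin 𝓘(ℝ, ℝ) (𝓡 n) γ (Icc 0 1) t 1‖ₑ := by
    intro t ht
    have hu : UniqueDiffWithinAt ℝ (Icc (0 : ℝ) 1) t := uniqueDiffOn_Icc zero_lt_one _ ht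
    have h1 : derivWithin Γ (Icc 0 1) t = T (derivWithin γ' (Icc 0 1) t) :=
      (T.hasFDerivAt.comp_hasDerivWithinAt t
        (hγ'.differentiableOn one_ne_zero t ht).hasDerivWithinAt).derivWithin hu
    have h2 : mfderivWithin 𝓘(ℝ, ℝ) 𝓘(ℝ, EuclideanSpace ℝ (Fin n)) γ' (Icc 0 1) t =
        (mfderiv (𝓡 n) 𝓘(ℝ, EuclideanSpace ℝ (Fin n)) (extChartAt (𝓡 n) x) (γ t)) ∘L
          (mfderivWithin 𝓘(ℝ, ℝ) (𝓡 n) γ (Icc 0 1) t) := by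
      apply mfderiv_comp_mfderivWithin
      · exact mdifferentiableAt_extChartAt (hball (hγmem t ht)).2
      · exact (hγs.mdifferentiable one_ne_zero).mdifferentiableOn _ ht
      · rwa [uniqueMDiffWithinAt_iff_uniqueDiffWithinAt]
    rw [← TangentBundle.continuousLinearMapAt_trivializationAt (hball (hγmem t ht)).2,
      mfderivWithin_eq_fderivWithin] at h2
    have h3 : derivWithin γ' (Icc 0 1) t =
        (trivializationAt (EuclideanSpace ℝ (Fin n)) (TangentSpace (𝓡 n)) x).continuousLinearMapAt ℝ
          (γ t) (mfderivWithin 𝓘(ℝ, ℝ) (𝓡 n) γ (Icc 0 1) t 1) := by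
      rw [← fderivWithin_derivWithin]
      exact congrArg (fun L : ℝ →L[ℝ] EuclideanSpace ℝ (Fin n) ↦ L 1) h2
    have h4 := ContinuousLinearMap.le_of_opNorm_le _ (hball (hγmem t ht)).1.le
      (mfderivWithin 𝓘(ℝ, ℝ) (𝓡 n) γ (Icc 0 1) t 1)
    rw [h1, h3, ← ofReal_norm, ← ofReal_norm, ← ENNReal.ofReal_mul (by linarith)]
    exact ENNReal.ofReal_le_ofReal h4
  have hΓ01 : Γ 1 - Γ 0 = extChartAt (𝓡 n) x y - extChartAt (𝓡 n) x x := by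
    have h1 : Γ 1 - Γ 0 = T (γ' 1 - γ' 0) := (map_sub T _ _).symm
    rw [h1]
    refine (symmL_self x _).trans ?_
    simp only [γ', Function.comp_apply, hγ0, hγ1]
    rfl
  have h1 := enorm_sub_le_lintegral_derivWithin_Icc_of_contDiffOn_Icc hΓ zero_le_one
  calc ENNReal.ofReal (tangentNorm x (extChartAt (𝓡 n) x y - extChartAt (𝓡 n) x x))
      = ‖Γ 1 - Γ 0‖ₑ := by
        rw [← ofReal_norm]
        exact congrArg (fun v : EuclideanSpace ℝ (Fin n) ↦
          ENNReal.ofReal (tangentNorm x v)) hΓ01.symm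
    _ ≤ ∫⁻ t in Icc (0 : ℝ) 1, ENNReal.ofReal r *
          ‖mfderivWithin 𝓘(ℝ, ℝ) (𝓡 n) γ (Icc 0 1) t 1‖ₑ :=
        h1.trans (setLIntegral_mono' measurableSet_Icc hder)
    _ = ENNReal.ofReal r * pathELength (𝓡 n) γ 0 1 := by
        rw [lintegral_const_mul' _ _ ENNReal.ofReal_ne_top,
          pathELength_eq_lintegral_mfderivWithin_Icc]
    _ ≤ a * ENNReal.ofReal r := by
        rw [mul_comm]
        gcongr
        exact (hγl.trans_le (min_le_left _ _)).le

end WeightedManifold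

/-! ### The gradient as a local Lipschitz constant -/

namespace WeightedManifold
set_option linter.unusedSectionVars false

variable {n : ℕ} {M : Type*} [MetricSpace M]
    [ChartedSpace (EuclideanSpace ℝ (Fin n)) M] [IsManifold (𝓡 n) ∞ M]
    [RiemannianBundle (fun x : M ↦ TangentSpace (𝓡 n) x)]
    [IsContMDiffRiemannianBundle (𝓡 n) ∞ (EuclideanSpace ℝ (Fin n))
      (fun x : M ↦ TangentSpace (𝓡 n) x)]
    [IsRiemannianManifold (𝓡 n) M]

theorem mdifferentiableAt_iff_differentiableAt_chart {f : M → ℝ} {p : M}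
    {y : EuclideanSpace ℝ (Fin n)} (hy : y ∈ (extChartAt (𝓡 n) p).target) :
    MDifferentiableAt (𝓡 n) 𝓘(ℝ, ℝ) f ((extChartAt (𝓡 n) p).symm y) ↔
      DifferentiableAt ℝ (f ∘ (extChartAt (𝓡 n) p).symm) y := by
  have hs : MDifferentiableAt 𝓘(ℝ, EuclideanSpace ℝ (Fin n)) (𝓡 n)
      (extChartAt (𝓡 n) p).symm y := by
    have := mdifferentiableWithinAt_extChartAt_symm (I := 𝓡 n) hy
    rwa [ModelWithCorners.range_eq_univ, mdifferentiableWithinAt_univ] at this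
  constructor
  · intro h
    rw [← mdifferentiableAt_iff_differentiableAt]
    exact h.comp y hs
  · intro h
    rw [← mdifferentiableAt_iff_differentiableAt] at h
    have hx := (extChartAt (𝓡 n) p).map_target hy
    have hyx := (extChartAt (𝓡 n) p).right_inv hy
    have hφ : MDifferentiableAt (𝓡 n) 𝓘(ℝ, EuclideanSpace ℝ (Fin n)) (extChartAt (𝓡 n) p)
        ((extChartAt (𝓡 n) p).symm y) :=
      mdifferentiableAt_extChartAt (by rwa [extChartAt_source] at hx)
    have hcomp := MDifferentiableAt.comp (I := 𝓡 n) (I' := 𝓘(ℝ, EuclideanSpace ℝ (Fin n)))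
      (I'' := 𝓘(ℝ, ℝ)) ((extChartAt (𝓡 n) p).symm y) (g := f ∘ (extChartAt (𝓡 n) p).symm)
      (f := extChartAt (𝓡 n) p) (by rwa [hyx]) hφ
    refine hcomp.congr_of_eventuallyEq ?_
    filter_upwards [extChartAt_source_mem_nhds' (I := 𝓡 n) hx] with z hz
    simp only [Function.comp_apply, (extChartAt (𝓡 n) p).left_inv hz]

/-- The differential of `f` at `x` in coordinates. -/
noncomputable def coordDeriv (f : M → ℝ) (x : M) : EuclideanSpace ℝ (Fin n) →L[ℝ] ℝ :=
  mfderiv (𝓡 n) 𝓘(ℝ, ℝ) f x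

theorem coordDeriv_of_not_mdifferentiableAt {f : M → ℝ} {x : M}
    (hf : ¬MDifferentiableAt (𝓡 n) 𝓘(ℝ, ℝ) f x) : coordDeriv (n := n) f x = 0 :=
  mfderiv_zero_of_not_mdifferentiableAt hf

theorem hasFDerivAt_comp_extChartAt_symm {f : M → ℝ} {x : M}
    (hf : MDifferentiableAt (𝓡 n) 𝓘(ℝ, ℝ) f x) :
    HasFDerivAt (f ∘ (extChartAt (𝓡 n) x).symm)
      (coordDeriv f x)
      (extChartAt (𝓡 n) x x) := by
  have h := hf.hasMFDerivAt.2
  rw [ModelWithCorners.range_eq_univ] at h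
  exact hasFDerivWithinAt_univ.1 h

theorem norm_riemannianGradient_eq (f : M → ℝ) (x : M) :
    ‖riemannianGradient n f x‖ =
      ‖(show TangentSpace (𝓡 n) x →L[ℝ] ℝ from coordDeriv (n := n) f x)‖ :=
  LinearIsometryEquiv.norm_map (InnerProductSpace.toDual ℝ (TangentSpace (𝓡 n) x)).symm
    (show TangentSpace (𝓡 n) x →L[ℝ] ℝ from coordDeriv (n := n) f x)

theorem abs_coordDeriv_le (f : M → ℝ) (x : M) (v : EuclideanSpace ℝ (Fin n)) :
    |coordDeriv f x v| ≤ ‖riemannianGradient n f x‖ * tangentNorm x v := by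
  rw [norm_riemannianGradient_eq]
  exact ContinuousLinearMap.le_opNorm
    (show TangentSpace (𝓡 n) x →L[ℝ] ℝ from coordDeriv (n := n) f x) v

theorem norm_riemannianGradient_le {f : M → ℝ} {x : M} {K : ℝ} (hK : 0 ≤ K)
    (h : ∀ v : EuclideanSpace ℝ (Fin n), |coordDeriv f x v| ≤ K * tangentNorm x v) :
    ‖riemannianGradient n f x‖ ≤ K := by
  rw [norm_riemannianGradient_eq]
  exact ContinuousLinearMap.opNorm_le_bound _ hK h

theorem exists_norm_le_tangentNorm (x : M) :
    ∃ C > 0, ∀ v : EuclideanSpace ℝ (Fin n), ‖v‖ ≤ C * tangentNorm x v := by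
  let L := (trivializationAt (EuclideanSpace ℝ (Fin n)) (TangentSpace (𝓡 n) : M → Type _)
    x).continuousLinearMapAt ℝ x
  have hx : x ∈ (trivializationAt (EuclideanSpace ℝ (Fin n))
    (TangentSpace (𝓡 n) : M → Type _) x).baseSet := FiberBundle.mem_baseSet_trivializationAt' x
  refine ⟨‖L‖ + 1, by positivity, fun v ↦ ?_⟩
  have h1 : L v = v := by
    have := Trivialization.continuousLinearMapAt_symmL (R := ℝ) (trivializationAt
      (EuclideanSpace ℝ (Fin n)) (TangentSpace (𝓡 n) : M → Type _) x) hx v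
    rwa [symmL_self] at this
  calc ‖v‖ = ‖L v‖ := by rw [h1]
    _ ≤ ‖L‖ * tangentNorm x v := L.le_opNorm v
    _ ≤ (‖L‖ + 1) * tangentNorm x v := by
      gcongr
      · exact norm_nonneg _
      · linarith

theorem tangentNorm_nonneg (x : M) (v : EuclideanSpace ℝ (Fin n)) : 0 ≤ tangentNorm x v :=
  norm_nonneg _

theorem tangentNorm_smul (x : M) (t : ℝ) (v : EuclideanSpace ℝ (Fin n)) :
    tangentNorm x (t • v) = |t| * tangentNorm x v :=
  norm_smul (β := TangentSpace (𝓡 n) x) t v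

/-- The norm of the gradient bounds the local Lipschitz constant. -/
theorem eventually_abs_sub_le_dist {f : M → ℝ} {x : M}
    (hf : MDifferentiableAt (𝓡 n) 𝓘(ℝ, ℝ) f x) {δ : ℝ} (hδ : 0 < δ) :
    ∀ᶠ y in 𝓝 x, |f y - f x| ≤ (‖riemannianGradient n f x‖ + δ) * dist x y := by
  set G := ‖riemannianGradient n f x‖ with hG
  have hG0 : 0 ≤ G := norm_nonneg _
  obtain ⟨C, hC, hCv⟩ := exists_norm_le_tangentNorm (n := n) x
  -- Half of δ absorbs the differentiability error, and this ratio is exactly the metric distortion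
  -- that turns G + δ/2 into G + δ.
  have hr : 1 < (G + δ) / (G + δ / 2) := by
    rw [one_lt_div (by positivity)]; linarith
  have h1 := (hasFDerivAt_comp_extChartAt_symm hf).isLittleO.def
    (show 0 < δ / 2 / C by positivity)
  have h2 := (continuousAt_extChartAt (I := 𝓡 n) x).eventually h1
  filter_upwards [h2, eventually_tangentNorm_le_edist (n := n) x hr,
    extChartAt_source_mem_nhds (I := 𝓡 n) x] with y hy1 hy2 hy3
  set v := extChartAt (𝓡 n) x y - extChartAt (𝓡 n) x x with hv
  have h3 : |f y - f x - coordDeriv f x v|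
      ≤ δ / 2 / C * ‖v‖ := by
    simpa only [Function.comp_apply, (extChartAt (𝓡 n) x).left_inv hy3, extChartAt_to_inv,
      Real.norm_eq_abs] using hy1
  have h4 := abs_coordDeriv_le f x v
  have h5 : δ / 2 / C * ‖v‖ ≤ δ / 2 * tangentNorm x v := by
    calc δ / 2 / C * ‖v‖ ≤ δ / 2 / C * (C * tangentNorm x v) := by gcongr; exact hCv v
      _ = _ := by field_simp
  have h6 : tangentNorm x v ≤ (G + δ) / (G + δ / 2) * dist x y := by
    rw [edist_dist, ← ENNReal.ofReal_mul (by positivity),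
      ENNReal.ofReal_le_ofReal_iff (by positivity)] at hy2
    exact hy2
  have h7 : |f y - f x| ≤ (G + δ / 2) * tangentNorm x v := by
    have := abs_sub_abs_le_abs_sub (f y - f x)
      (coordDeriv f x v)
    linarith
  calc |f y - f x| ≤ (G + δ / 2) * tangentNorm x v := h7
    _ ≤ (G + δ / 2) * ((G + δ) / (G + δ / 2) * dist x y) := by gcongr
    _ = (G + δ) * dist x y := by field_simp

/-- A local Lipschitz constant bounds the norm of the gradient. -/
theorem norm_riemannianGradient_le_of_eventually {f : M → ℝ} {x : M}
    (hf : MDifferentiableAt (𝓡 n) 𝓘(ℝ, ℝ) f x) {K : ℝ} (hK : 0 ≤ K)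
    (h : ∀ᶠ y in 𝓝 x, |f y - f x| ≤ K * dist x y) : ‖riemannianGradient n f x‖ ≤ K := by
  refine norm_riemannianGradient_le hK fun v ↦ ?_
  set L := coordDeriv (n := n) f x with hL
  have main : ∀ r : ℝ, 1 < r → |L v| ≤ r * (K * tangentNorm x v) := by
    intro r hr
    have hc : Tendsto (extChartAt (𝓡 n) x).symm (𝓝 (extChartAt (𝓡 n) x x)) (𝓝 x) := by
      have := (continuousAt_extChartAt_symm (I := 𝓡 n) x).tendsto
      rwa [extChartAt_to_inv] at this
    have hline : Tendsto (fun t : ℝ ↦ extChartAt (𝓡 n) x x + t • v) (𝓝[>] 0)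
        (𝓝 (extChartAt (𝓡 n) x x)) := by
      have : Continuous fun t : ℝ ↦ extChartAt (𝓡 n) x x + t • v := by fun_prop
      have := (this.tendsto 0).mono_left (nhdsWithin_le_nhds (s := Ioi 0))
      simpa using this
    have hlim : Tendsto (fun t : ℝ ↦ |t⁻¹ • ((f ∘ (extChartAt (𝓡 n) x).symm)
        (extChartAt (𝓡 n) x x + t • v) - (f ∘ (extChartAt (𝓡 n) x).symm)
        (extChartAt (𝓡 n) x x))|) (𝓝[>] 0) (𝓝 |L v|) := by
      have h1 := (hasFDerivAt_comp_extChartAt_symm hf).hasLineDerivAt v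
      exact (h1.tendsto_slope_zero_right).abs
    refine le_of_tendsto hlim ?_
    filter_upwards [hline.eventually (hc.eventually h),
      hline.eventually (eventually_edist_le_tangentNorm (n := n) x hr), self_mem_nhdsWithin]
      with t ht1 ht2 ht0
    rw [mem_Ioi] at ht0
    rw [add_sub_cancel_left, tangentNorm_smul, edist_dist,
      ENNReal.ofReal_le_ofReal_iff
        (by have := tangentNorm_nonneg x v; positivity), abs_of_pos ht0] at ht2
    simp only [Function.comp_apply, extChartAt_to_inv, smul_eq_mul]
    rw [abs_mul, abs_inv, abs_of_pos ht0, inv_mul_le_iff₀ ht0]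
    calc _ ≤ K * dist x ((extChartAt (𝓡 n) x).symm (extChartAt (𝓡 n) x x + t • v)) := ht1
      _ ≤ K * (r * (t * tangentNorm x v)) := by gcongr
      _ = t * (r * (K * tangentNorm x v)) := by ring
  refine ge_of_tendsto (x := 𝓝[>] (1 : ℝ)) (f := fun r : ℝ ↦ r * (K * tangentNorm x v)) ?_ ?_
  · have : Continuous fun r : ℝ ↦ r * (K * tangentNorm x v) := by fun_prop
    have := (this.tendsto 1).mono_left (nhdsWithin_le_nhds (s := Ioi 1))
    simpa using this
  · filter_upwards [self_mem_nhdsWithin] with r hr using main r hr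

theorem norm_riemannianGradient_le_of_lipschitzWith {f : M → ℝ} {K : ℝ≥0} (hf : LipschitzWith K f)
    (x : M) : ‖riemannianGradient n f x‖ ≤ K := by
  by_cases h : MDifferentiableAt (𝓡 n) 𝓘(ℝ, ℝ) f x
  · refine norm_riemannianGradient_le_of_eventually h K.2 (Eventually.of_forall fun y ↦ ?_)
    rw [← Real.dist_eq, dist_comm x]
    exact hf.dist_le_mul y x
  · refine norm_riemannianGradient_le K.2 fun v ↦ ?_
    rw [coordDeriv_of_not_mdifferentiableAt h]
    refine (abs_zero.le).trans (mul_nonneg K.2 (tangentNorm_nonneg _ _))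

/-- Since gradients are local Lipschitz constants, comparing increments replaces a chain rule. This
suits compositions with truncations, which are not differentiable everywhere. -/
theorem norm_riemannianGradient_le_norm {f g : M → ℝ} {x : M}
    (hf : MDifferentiableAt (𝓡 n) 𝓘(ℝ, ℝ) f x) (hg : MDifferentiableAt (𝓡 n) 𝓘(ℝ, ℝ) g x)
    {c : ℝ} (hc : 0 ≤ c) (h : ∀ᶠ y in 𝓝 x, |g y - g x| ≤ c * |f y - f x|) :
    ‖riemannianGradient n g x‖ ≤ c * ‖riemannianGradient n f x‖ := by
  refine ge_of_tendsto (x := 𝓝[>] (0 : ℝ))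
    (f := fun δ : ℝ ↦ c * (‖riemannianGradient n f x‖ + δ)) ?_ ?_
  · have : Continuous fun δ : ℝ ↦ c * (‖riemannianGradient n f x‖ + δ) := by fun_prop
    have := (this.tendsto 0).mono_left (nhdsWithin_le_nhds (s := Ioi 0))
    simpa using this
  · filter_upwards [self_mem_nhdsWithin] with δ hδ
    rw [mem_Ioi] at hδ
    refine norm_riemannianGradient_le_of_eventually hg (by positivity) ?_
    filter_upwards [h, eventually_abs_sub_le_dist hf hδ] with y h1 h2
    calc |g y - g x| ≤ c * |f y - f x| := h1
      _ ≤ c * ((‖riemannianGradient n f x‖ + δ) * dist x y) := by gcongr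
      _ = _ := by ring

/-- Where f is not differentiable the gradient is 0 by default, so no differentiability is needed. A
nonnegative function therefore has zero gradient at every one of its zeros, not just almost
everywhere. -/
theorem riemannianGradient_eq_zero_of_isLocalMin {f : M → ℝ} {x : M} (h : IsLocalMin f x) :
    riemannianGradient n f x = 0 := by
  rw [← norm_eq_zero]
  refine le_antisymm (norm_riemannianGradient_le le_rfl fun v ↦ ?_) (norm_nonneg _)
  by_cases hf : MDifferentiableAt (𝓡 n) 𝓘(ℝ, ℝ) f x
  · have hmin : IsLocalMin (f ∘ (extChartAt (𝓡 n) x).symm) (extChartAt (𝓡 n) x x) := by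
      have h1 := (continuousAt_extChartAt_symm (I := 𝓡 n) x).tendsto
      rw [extChartAt_to_inv] at h1
      have h2 := h1.eventually h
      filter_upwards [h2] with y hy
      simpa only [Function.comp_apply, extChartAt_to_inv] using hy
    rw [hmin.hasFDerivAt_eq_zero (hasFDerivAt_comp_extChartAt_symm hf)]
    simp
  · rw [coordDeriv_of_not_mdifferentiableAt hf]
    exact (abs_zero.le).trans (zero_mul _).ge

theorem riemannianGradient_add {f g : M → ℝ} {x : M}
    (hf : MDifferentiableAt (𝓡 n) 𝓘(ℝ, ℝ) f x) (hg : MDifferentiableAt (𝓡 n) 𝓘(ℝ, ℝ) g x) :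
    riemannianGradient n (f + g) x = riemannianGradient n f x + riemannianGradient n g x := by
  have h := (hf.hasMFDerivAt.add hg.hasMFDerivAt).mfderiv
  simp only [riemannianGradient]
  rw [h]
  exact map_add (InnerProductSpace.toDual ℝ (TangentSpace (𝓡 n) x)).symm _ _

theorem riemannianGradient_const_smul {f : M → ℝ} {x : M}
    (hf : MDifferentiableAt (𝓡 n) 𝓘(ℝ, ℝ) f x) (c : ℝ) :
    riemannianGradient n (c • f) x = c • riemannianGradient n f x := by
  have h := (hf.hasMFDerivAt.const_smul c).mfderiv
  simp only [riemannianGradient]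
  rw [h]
  exact map_smul (InnerProductSpace.toDual ℝ (TangentSpace (𝓡 n) x)).symm _ _

theorem mdifferentiableAt_const_smul {f : M → ℝ} {x : M}
    (hf : MDifferentiableAt (𝓡 n) 𝓘(ℝ, ℝ) f x) (c : ℝ) :
    MDifferentiableAt (𝓡 n) 𝓘(ℝ, ℝ) (c • f) x :=
  (hf.hasMFDerivAt.const_smul c).mdifferentiableAt

end WeightedManifold

/-! ### Lipschitz bounds for charts and continuity of the metric coefficients -/

namespace WeightedManifold
set_option linter.unusedSectionVars false

variable {n : ℕ} {M : Type*} [MetricSpace M]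
    [ChartedSpace (EuclideanSpace ℝ (Fin n)) M] [IsManifold (𝓡 n) ∞ M]
    [RiemannianBundle (fun x : M ↦ TangentSpace (𝓡 n) x)]
    [IsContMDiffRiemannianBundle (𝓡 n) ∞ (EuclideanSpace ℝ (Fin n))
      (fun x : M ↦ TangentSpace (𝓡 n) x)]
    [IsRiemannianManifold (𝓡 n) M]

theorem exists_tangentNorm_le_norm (x : M) :
    ∃ C > 0, ∀ v : EuclideanSpace ℝ (Fin n), tangentNorm x v ≤ C * ‖v‖ := by
  let L := (trivializationAt (EuclideanSpace ℝ (Fin n)) (TangentSpace (𝓡 n) : M → Type _)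
    x).symmL ℝ x
  refine ⟨‖L‖ + 1, by positivity, fun v ↦ ?_⟩
  have h : tangentNorm x (L v) ≤ ‖L‖ * ‖v‖ := L.le_opNorm v
  rw [symmL_self] at h
  nlinarith [norm_nonneg v]

/-- Around every point, the inverse of the preferred chart is Lipschitz. -/
theorem exists_ball_dist_extChartAt_symm_le (p : M) :
    ∃ C : ℝ≥0, ∀ᶠ r in 𝓝[>] (0 : ℝ),
      Metric.ball (extChartAt (𝓡 n) p p) r ⊆ (extChartAt (𝓡 n) p).target ∧
      LipschitzOnWith C (extChartAt (𝓡 n) p).symm (Metric.ball (extChartAt (𝓡 n) p p) r) := by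
  obtain ⟨C, hC, hCv⟩ := exists_tangentNorm_le_norm (n := n) p
  obtain ⟨ε, hε, hball⟩ := Metric.mem_nhds_iff.1
    (inter_mem (eventually_tangentNorm_chartDeriv_le (n := n) p one_lt_two)
      (extChartAt_target_mem_nhds (I := 𝓡 n) p))
  refine ⟨(2 * C).toNNReal, ?_⟩
  filter_upwards [Ioo_mem_nhdsGT hε] with r hr
  have hsub : Metric.ball (extChartAt (𝓡 n) p p) r ⊆ Metric.ball (extChartAt (𝓡 n) p p) ε :=
    Metric.ball_subset_ball hr.2.le
  refine ⟨fun y hy ↦ (hball (hsub hy)).2, fun y hy z hz ↦ ?_⟩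
  have hseg : segment ℝ y z ⊆ Metric.ball (extChartAt (𝓡 n) p p) ε :=
    (convex_ball _ _).segment_subset (hsub hy) (hsub hz)
  refine edist_extChartAt_symm_le p (fun w hw ↦ (hball (hseg hw)).2) fun w hw ↦ ?_
  rw [edist_comm, edist_dist, dist_eq_norm, ENNReal.ofNNReal_toNNReal,
    ← ENNReal.ofReal_mul (by positivity)]
  refine ENNReal.ofReal_le_ofReal (((hball (hseg hw)).1 _).trans ?_)
  nlinarith [hCv (z - y)]

/-- In coordinates the local Lipschitz constant of f is multiplied by at most that of the inverse
chart; where the composition is not differentiable the left side is 0. -/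
theorem norm_fderiv_comp_extChartAt_symm_le {p : M} {C : ℝ≥0} {B : Set (EuclideanSpace ℝ (Fin n))}
    (hB : IsOpen B) (hBt : B ⊆ (extChartAt (𝓡 n) p).target)
    (hL : LipschitzOnWith C (extChartAt (𝓡 n) p).symm B) (f : M → ℝ)
    {y : EuclideanSpace ℝ (Fin n)} (hy : y ∈ B) :
    ‖fderiv ℝ (f ∘ (extChartAt (𝓡 n) p).symm) y‖ ≤
      C * ‖riemannianGradient n f ((extChartAt (𝓡 n) p).symm y)‖ := by
  by_cases hd : DifferentiableAt ℝ (f ∘ (extChartAt (𝓡 n) p).symm) y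
  · have hm := (mdifferentiableAt_iff_differentiableAt_chart (hBt hy)).2 hd
    set x := (extChartAt (𝓡 n) p).symm y with hx
    refine ge_of_tendsto (x := 𝓝[>] (0 : ℝ))
      (f := fun δ : ℝ ↦ C * (‖riemannianGradient n f x‖ + δ)) ?_ ?_
    · have : Continuous fun δ : ℝ ↦ C * (‖riemannianGradient n f x‖ + δ) := by fun_prop
      have := (this.tendsto 0).mono_left (nhdsWithin_le_nhds (s := Ioi 0))
      simpa using this
    · filter_upwards [self_mem_nhdsWithin] with δ hδ
      rw [mem_Ioi] at hδ
      have hc : ContinuousAt (extChartAt (𝓡 n) p).symm y :=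
        (continuousOn_extChartAt_symm (I := 𝓡 n) p).continuousAt
          ((isOpen_extChartAt_target (I := 𝓡 n) p).mem_nhds (hBt hy))
      refine hd.hasFDerivAt.le_of_lip' (by positivity) ?_
      filter_upwards [hB.mem_nhds hy, hc.eventually (eventually_abs_sub_le_dist hm hδ)]
        with z hz1 hz2
      have h3 := hL.dist_le_mul z hz1 y hy
      rw [← dist_eq_norm z y, Real.norm_eq_abs]
      rw [dist_comm] at h3
      calc _ ≤ (‖riemannianGradient n f x‖ + δ) * dist x ((extChartAt (𝓡 n) p).symm z) := hz2
        _ ≤ (‖riemannianGradient n f x‖ + δ) * (C * dist z y) := by gcongr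
        _ = _ := by ring
  · rw [fderiv_zero_of_not_differentiableAt hd, norm_zero]
    positivity

/-- The Riemannian inner product at `x` in coordinates. -/
noncomputable def metricAt (x : M) (v w : EuclideanSpace ℝ (Fin n)) : ℝ :=
  inner ℝ (show TangentSpace (𝓡 n) x from v) (show TangentSpace (𝓡 n) x from w)

/-- The tangent map of the inverse chart is continuous, so dψ(v) is a continuous family of tangent
vectors, on which the metric is continuous. -/
theorem continuousOn_metricAt (p : M) (v w : EuclideanSpace ℝ (Fin n)) :
    ContinuousOn (fun y ↦ metricAt ((extChartAt (𝓡 n) p).symm y) (chartDeriv p y v)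
      (chartDeriv p y w)) (extChartAt (𝓡 n) p).target := by
  have hsec : ∀ v : EuclideanSpace ℝ (Fin n), ContinuousOn (fun y ↦
      (⟨(extChartAt (𝓡 n) p).symm y, chartDeriv p y v⟩ : TangentBundle (𝓡 n) M))
      (extChartAt (𝓡 n) p).target := by
    intro v
    have ho := isOpen_extChartAt_target (I := 𝓡 n) p
    have h1 : ContMDiffOn 𝓘(ℝ, EuclideanSpace ℝ (Fin n)) (𝓡 n) 1 (extChartAt (𝓡 n) p).symm
      (extChartAt (𝓡 n) p).target := contMDiffOn_extChartAt_symm p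
    have h2 := h1.continuousOn_tangentMapWithin le_rfl ho.uniqueMDiffOn
    have h3 : Continuous fun y : EuclideanSpace ℝ (Fin n) ↦
        (⟨y, v⟩ : TangentBundle 𝓘(ℝ, EuclideanSpace ℝ (Fin n)) (EuclideanSpace ℝ (Fin n))) := by
      exact (tangentBundleModelSpaceHomeomorph 𝓘(ℝ, EuclideanSpace ℝ (Fin n))).symm.continuous.comp
        (continuous_id.prodMk continuous_const)
    refine (h2.comp h3.continuousOn fun y hy ↦ hy).congr fun y hy ↦ ?_
    simp only [Function.comp_apply, tangentMapWithin]
    rw [mfderivWithin_of_mem_nhds (ho.mem_nhds hy)]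
    rfl
  exact ContinuousOn.inner_bundle (F := EuclideanSpace ℝ (Fin n))
    (E := fun x : M ↦ TangentSpace (𝓡 n) x) (hsec v) (hsec w)

end WeightedManifold

/-! ### The Riemannian volume in charts -/

namespace WeightedManifold
set_option linter.unusedSectionVars false

theorem measurableSet_inter_preimage_of_continuousOn {α β : Type*} [TopologicalSpace α]
    [MeasurableSpace α] [OpensMeasurableSpace α] [TopologicalSpace β] [MeasurableSpace β]
    [BorelSpace β] {f : α → β} {s : Set α} (hf : ContinuousOn f s) (hs : MeasurableSet s)
    {A : Set β} (hA : MeasurableSet A) : MeasurableSet (s ∩ f ⁻¹' A) := by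
  have h := (continuousOn_iff_continuous_domRestrict.1 hf).measurable hA
  have h2 := hs.subtype_image h
  convert h2 using 1
  ext x
  simp [and_comm]

variable {n : ℕ} {M : Type*} [MetricSpace M]
    [ChartedSpace (EuclideanSpace ℝ (Fin n)) M] [IsManifold (𝓡 n) ∞ M]
    [RiemannianBundle (fun x : M ↦ TangentSpace (𝓡 n) x)]
    [IsContMDiffRiemannianBundle (𝓡 n) ∞ (EuclideanSpace ℝ (Fin n))
      (fun x : M ↦ TangentSpace (𝓡 n) x)]
    [IsRiemannianManifold (𝓡 n) M]

/-- The pull-back of the metric under the inverse of the preferred chart at `p`. -/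
noncomputable def chartForm (p : M) (y : EuclideanSpace ℝ (Fin n)) :
    LinearMap.BilinForm ℝ (EuclideanSpace ℝ (Fin n)) :=
  LinearMap.mk₂ ℝ (fun v w ↦ metricAt ((extChartAt (𝓡 n) p).symm y) (chartDeriv p y v)
      (chartDeriv p y w))
    (fun v v' w ↦ by
      rw [map_add]
      exact inner_add_left (E := TangentSpace (𝓡 n) ((extChartAt (𝓡 n) p).symm y)) _ _ _)
    (fun c v w ↦ by
      rw [map_smul]
      exact real_inner_smul_left (F := TangentSpace (𝓡 n) ((extChartAt (𝓡 n) p).symm y)) _ _ _)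
    (fun v w w' ↦ by
      rw [map_add]
      exact inner_add_right (E := TangentSpace (𝓡 n) ((extChartAt (𝓡 n) p).symm y)) _ _ _)
    (fun c v w ↦ by
      rw [map_smul]
      exact real_inner_smul_right (F := TangentSpace (𝓡 n) ((extChartAt (𝓡 n) p).symm y)) _ _ _)

theorem gramMatrix_eq (p : M) (y : EuclideanSpace ℝ (Fin n)) :
    gramMatrix p y = LinearMap.BilinForm.toMatrix (EuclideanSpace.basisFun (Fin n) ℝ).toBasis
      (chartForm p y) := by
  ext i j
  rw [LinearMap.BilinForm.toMatrix_apply]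
  simp only [gramMatrix, Matrix.of_apply, OrthonormalBasis.coe_toBasis,
    EuclideanSpace.basisFun_apply]
  rfl

theorem continuousOn_det_gramMatrix (p : M) :
    ContinuousOn (fun y : EuclideanSpace ℝ (Fin n) ↦ (gramMatrix p y).det)
      (extChartAt (𝓡 n) p).target := by
  have h : ContinuousOn (fun y : EuclideanSpace ℝ (Fin n) ↦ gramMatrix p y)
      (extChartAt (𝓡 n) p).target :=
    continuousOn_pi.2 fun i ↦ continuousOn_pi.2 fun j ↦ continuousOn_metricAt p _ _
  exact (Continuous.matrix_det continuous_id).comp_continuousOn h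

/-- At the centre of the chart this is the Gram matrix of a basis of T_pM. Continuity of the
determinant carries positivity to a small ball, which suffices later. -/
theorem det_gramMatrix_self_pos (p : M) :
    0 < (gramMatrix p (extChartAt (𝓡 n) p p)).det := by
  let T := TangentSpace (𝓡 n) ((extChartAt (𝓡 n) p).symm (extChartAt (𝓡 n) p p))
  let e : Fin n → T := fun i ↦ (EuclideanSpace.basisFun (Fin n) ℝ).toBasis i
  have hli : LinearIndependent ℝ e :=
    (EuclideanSpace.basisFun (Fin n) ℝ).toBasis.linearIndependent
  have hG : gramMatrix p (extChartAt (𝓡 n) p p) = Matrix.gram ℝ e := by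
    ext i j
    rw [gramMatrix_eq, LinearMap.BilinForm.toMatrix_apply]
    simp only [Matrix.gram, Matrix.of_apply, chartForm, LinearMap.mk₂_apply, chartDeriv_self]
    rfl
  rw [hG]
  exact (Matrix.posDef_gram_of_linearIndependent (𝕜 := ℝ) hli).det_pos

variable [MeasurableSpace M] [BorelSpace M]

theorem chartVolume_apply (p : M) {A : Set M} (hA : MeasurableSet A) :
    chartVolume (n := n) p A = ∫⁻ y in (extChartAt (𝓡 n) p).target ∩
      (extChartAt (𝓡 n) p).symm ⁻¹' A, ENNReal.ofReal √(gramMatrix p y).det := by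
  have ht : MeasurableSet (extChartAt (𝓡 n) p).target :=
    (isOpen_extChartAt_target (I := 𝓡 n) p).measurableSet
  have hψ : AEMeasurable (extChartAt (𝓡 n) p).symm
      (volume.restrict (extChartAt (𝓡 n) p).target) :=
    (continuousOn_extChartAt_symm (I := 𝓡 n) p).aemeasurable ht
  have hψ' : AEMeasurable (extChartAt (𝓡 n) p).symm
      ((volume.restrict (extChartAt (𝓡 n) p).target).withDensity
        fun y ↦ ENNReal.ofReal √(gramMatrix p y).det) :=
    hψ.mono_ac (withDensity_absolutelyContinuous _ _)
  rw [chartVolume, Measure.map_apply_of_aemeasurable hψ' hA]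
  rw [withDensity_apply', Measure.restrict_restrict₀ (hψ.nullMeasurable hA), inter_comm]

/-- Under the transition map τ the Gram determinant picks up (det Dτ)², so its square root
transforms exactly as in the change of variables formula. Only an inequality arises, as the image of
τ covers the part of A that also lies in the chart at p. -/
theorem chartVolume_inter_source_le (p q : M) {A : Set M} (hA : MeasurableSet A) :
    chartVolume (n := n) p (A ∩ (extChartAt (𝓡 n) q).source) ≤ chartVolume (n := n) q A := by
  have hsq : IsOpen (extChartAt (𝓡 n) q).source := isOpen_extChartAt_source q
  have htp := isOpen_extChartAt_target (I := 𝓡 n) p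
  have hψp := continuousOn_extChartAt_symm (I := 𝓡 n) p
  rw [chartVolume_apply p (hA.inter hsq.measurableSet), chartVolume_apply q hA]
  set S := (extChartAt (𝓡 n) p).target ∩ (extChartAt (𝓡 n) p).symm ⁻¹'
    (A ∩ (extChartAt (𝓡 n) q).source) with hS
  have hSm : MeasurableSet S := measurableSet_inter_preimage_of_continuousOn hψp htp.measurableSet
    (hA.inter hsq.measurableSet)
  let τ : EuclideanSpace ℝ (Fin n) → EuclideanSpace ℝ (Fin n) :=
    extChartAt (𝓡 n) q ∘ (extChartAt (𝓡 n) p).symm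
  have hψmd : ∀ (p : M) y, y ∈ (extChartAt (𝓡 n) p).target →
      MDifferentiableAt 𝓘(ℝ, EuclideanSpace ℝ (Fin n)) (𝓡 n) (extChartAt (𝓡 n) p).symm y := by
    intro p y hy
    have := mdifferentiableWithinAt_extChartAt_symm (I := 𝓡 n) hy
    rwa [ModelWithCorners.range_eq_univ, mdifferentiableWithinAt_univ] at this
  have hτd : ∀ y ∈ S, DifferentiableAt ℝ τ y := by
    intro y hy
    rw [← mdifferentiableAt_iff_differentiableAt]
    refine MDifferentiableAt.comp (I' := 𝓡 n) y (mdifferentiableAt_extChartAt ?_) (hψmd p y hy.1)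
    rw [← extChartAt_source (𝓡 n)]
    exact hy.2.2
  have hτinv : ∀ y ∈ S, (extChartAt (𝓡 n) q).symm (τ y) = (extChartAt (𝓡 n) p).symm y :=
    fun y hy ↦ (extChartAt (𝓡 n) q).left_inv hy.2.2
  have hinj : InjOn τ S := by
    intro y hy z hz hyz
    have h1 : (extChartAt (𝓡 n) p).symm y = (extChartAt (𝓡 n) p).symm z := by
      rw [← hτinv y hy, ← hτinv z hz, hyz]
    exact (extChartAt (𝓡 n) p).symm.injOn hy.1 hz.1 h1
  have himg : τ '' S ⊆ (extChartAt (𝓡 n) q).target ∩ (extChartAt (𝓡 n) q).symm ⁻¹' A := by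
    rintro _ ⟨y, hy, rfl⟩
    refine ⟨(extChartAt (𝓡 n) q).map_source hy.2.2, ?_⟩
    rw [mem_preimage, hτinv y hy]
    exact hy.2.1
  have hform : ∀ y ∈ S, chartForm p y =
      (chartForm q (τ y)).comp (fderiv ℝ τ y).toLinearMap (fderiv ℝ τ y).toLinearMap := by
    intro y hy
    have hD : chartDeriv p y = (chartDeriv q (τ y)).comp (fderiv ℝ τ y) := by
      have h1 : MDifferentiableAt 𝓘(ℝ, EuclideanSpace ℝ (Fin n)) 𝓘(ℝ, EuclideanSpace ℝ (Fin n))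
        τ y := (hτd y hy).mdifferentiableAt
      have h2 := hψmd q (τ y) ((extChartAt (𝓡 n) q).map_source hy.2.2)
      have h3 := mfderiv_comp y h2 h1
      have h4 : ((extChartAt (𝓡 n) q).symm ∘ τ) =ᶠ[𝓝 y] (extChartAt (𝓡 n) p).symm := by
        have hc : ContinuousAt (extChartAt (𝓡 n) p).symm y := hψp.continuousAt (htp.mem_nhds hy.1)
        filter_upwards [hc.preimage_mem_nhds (hsq.mem_nhds hy.2.2)] with z hz
        exact (extChartAt (𝓡 n) q).left_inv hz
      rw [h4.mfderiv_eq, mfderiv_eq_fderiv] at h3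
      exact h3
    ext v w
    simp only [chartForm, LinearMap.mk₂_apply, LinearMap.BilinForm.comp_apply, hτinv y hy, hD]
    rfl
  have hdet : ∀ y ∈ S, √(gramMatrix p y).det =
      |(fderiv ℝ τ y).det| * √(gramMatrix q (τ y)).det := by
    intro y hy
    rw [gramMatrix_eq, hform y hy,
      LinearMap.BilinForm.toMatrix_comp (EuclideanSpace.basisFun (Fin n) ℝ).toBasis
        (EuclideanSpace.basisFun (Fin n) ℝ).toBasis, ← gramMatrix_eq, Matrix.det_mul,
      Matrix.det_mul, Matrix.det_transpose, LinearMap.det_toMatrix]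
    have : ((fderiv ℝ τ y).toLinearMap).det * (gramMatrix q (τ y)).det *
        ((fderiv ℝ τ y).toLinearMap).det = (fderiv ℝ τ y).det ^ 2 * (gramMatrix q (τ y)).det := by
      change (fderiv ℝ τ y).det * _ * (fderiv ℝ τ y).det = _
      ring
    rw [this, Real.sqrt_mul (sq_nonneg _), Real.sqrt_sq_eq_abs]
  calc ∫⁻ y in S, ENNReal.ofReal √(gramMatrix p y).det
      = ∫⁻ y in S, ENNReal.ofReal |(fderiv ℝ τ y).det| *
          ENNReal.ofReal √(gramMatrix q (τ y)).det := by
        refine setLIntegral_congr_fun hSm fun y hy ↦ ?_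
        rw [hdet y hy, ENNReal.ofReal_mul (abs_nonneg _)]
    _ = ∫⁻ z in τ '' S, ENNReal.ofReal √(gramMatrix q z).det :=
        (lintegral_image_eq_lintegral_abs_det_fderiv_mul volume hSm
          (fun y hy ↦ (hτd y hy).hasFDerivAt.hasFDerivWithinAt) hinj
          fun z ↦ ENNReal.ofReal √(gramMatrix q z).det).symm
    _ ≤ _ := lintegral_mono_set himg

theorem riemannianVolume_restrict_source (q : M) :
    (riemannianVolume n M).restrict (extChartAt (𝓡 n) q).source ≤ chartVolume (n := n) q := by
  have hsq : MeasurableSet (extChartAt (𝓡 n) q).source :=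
    (isOpen_extChartAt_source (I := 𝓡 n) q).measurableSet
  -- A measure that dominates every chart volume: the one at q on its source, and the largest
  -- measure off it. The supremum is then dominated as well.
  have h : riemannianVolume n M ≤ chartVolume (n := n) q +
      (⊤ : Measure M).restrict (extChartAt (𝓡 n) q).sourceᶜ := by
    refine iSup_le fun p ↦ Measure.le_iff.2 fun A hA ↦ ?_
    rw [← measure_inter_add_sdiff A hsq, Measure.add_apply]
    refine add_le_add (chartVolume_inter_source_le p q hA) ?_
    rw [Measure.restrict_apply hA, ← Set.sdiff_eq]
    exact Measure.le_iff'.1 le_top _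
  refine (Measure.restrict_mono_measure h _).trans ?_
  rw [Measure.restrict_add, Measure.restrict_restrict hsq, Set.inter_compl_self,
    Measure.restrict_empty, add_zero]
  exact Measure.restrict_le_self

theorem chartVolume_le_riemannianVolume (q : M) :
    chartVolume (n := n) q ≤ riemannianVolume n M :=
  le_iSup (fun p ↦ chartVolume (n := n) p) q

end WeightedManifold

/-! ### Comparison with Lebesgue measure on chart balls -/

namespace WeightedManifold
set_option linter.unusedSectionVars false

/-- One constant, larger than both f a and 1/f a, bounds f and 1/f near a. -/
theorem exists_eventually_le_of_pos {α : Type*} [TopologicalSpace α] {f : α → ℝ} {a : α}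
    (hf : ContinuousAt f a) (ha : 0 < f a) :
    ∃ c : ℝ≥0, ∀ᶠ y in 𝓝 a, ENNReal.ofReal (f y) ≤ c ∧ 1 ≤ c * ENNReal.ofReal (f y) := by
  have hc : 0 < f a + 1 + (f a)⁻¹ := by positivity
  refine ⟨(f a + 1 + (f a)⁻¹).toNNReal, ?_⟩
  have h1 : ∀ᶠ y in 𝓝 a, f y < f a + 1 + (f a)⁻¹ :=
    hf.eventually_lt_const (by linarith [inv_pos.2 ha])
  have h2 : ∀ᶠ y in 𝓝 a, 1 < (f a + 1 + (f a)⁻¹) * f y := by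
    refine (continuousAt_const.mul hf).eventually_const_lt ?_
    simp only [Pi.mul_apply]
    have : (f a)⁻¹ * f a = 1 := inv_mul_cancel₀ ha.ne'
    nlinarith
  filter_upwards [h1, h2] with y hy1 hy2
  rw [ENNReal.ofNNReal_toNNReal]
  refine ⟨ENNReal.ofReal_le_ofReal hy1.le, ?_⟩
  rw [← ENNReal.ofReal_mul hc.le, ← ENNReal.ofReal_one]
  exact ENNReal.ofReal_le_ofReal hy2.le

variable {n : ℕ} {M : Type*} [MetricSpace M]
    [ChartedSpace (EuclideanSpace ℝ (Fin n)) M] [IsManifold (𝓡 n) ∞ M]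
    [RiemannianBundle (fun x : M ↦ TangentSpace (𝓡 n) x)]
    [IsContMDiffRiemannianBundle (𝓡 n) ∞ (EuclideanSpace ℝ (Fin n))
      (fun x : M ↦ TangentSpace (𝓡 n) x)]
    [IsRiemannianManifold (𝓡 n) M] [MeasurableSpace M] [BorelSpace M]

variable (n) in
/-- On the ball of radius `r` around the image of `p` in the preferred chart at `p`, the inverse
of the chart is `c`-Lipschitz, and it transports Lebesgue measure to a measure comparable
with `μ`. -/
structure IsChartBall (μ : Measure M) (p : M) (r : ℝ) (c : ℝ≥0) : Prop where
  pos : 0 < r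
  subset : Metric.ball (extChartAt (𝓡 n) p p) r ⊆ (extChartAt (𝓡 n) p).target
  lipschitz : LipschitzOnWith c (extChartAt (𝓡 n) p).symm (Metric.ball (extChartAt (𝓡 n) p p) r)
  le_map : μ.restrict ((extChartAt (𝓡 n) p).symm '' Metric.ball (extChartAt (𝓡 n) p p) r) ≤
    (c : ℝ≥0∞) • (volume.restrict (Metric.ball (extChartAt (𝓡 n) p p) r)).map
      (extChartAt (𝓡 n) p).symm
  map_le : (volume.restrict (Metric.ball (extChartAt (𝓡 n) p p) r)).map
      (extChartAt (𝓡 n) p).symm ≤ (c : ℝ≥0∞) • μ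

theorem isOpen_symm_image {p : M} {B : Set (EuclideanSpace ℝ (Fin n))} (hB : IsOpen B)
    (hBt : B ⊆ (extChartAt (𝓡 n) p).target) : IsOpen ((extChartAt (𝓡 n) p).symm '' B) := by
  rw [PartialEquiv.symm_image_eq_source_inter_preimage _ hBt]
  exact isOpen_extChartAt_preimage' (I := 𝓡 n) p hB

theorem measurableSet_symm_image {p : M} {B : Set (EuclideanSpace ℝ (Fin n))}
    (hB : MeasurableSet B)
    (hBt : B ⊆ (extChartAt (𝓡 n) p).target) : MeasurableSet ((extChartAt (𝓡 n) p).symm '' B) := by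
  rw [PartialEquiv.symm_image_eq_source_inter_preimage _ hBt]
  exact measurableSet_inter_preimage_of_continuousOn (continuousOn_extChartAt (I := 𝓡 n) p)
    (isOpen_extChartAt_source (I := 𝓡 n) p).measurableSet hB

theorem target_inter_preimage_symm_image {p : M} {B : Set (EuclideanSpace ℝ (Fin n))}
    (hBt : B ⊆ (extChartAt (𝓡 n) p).target) (A : Set M) :
    (extChartAt (𝓡 n) p).target ∩ (extChartAt (𝓡 n) p).symm ⁻¹'
      (A ∩ (extChartAt (𝓡 n) p).symm '' B) = B ∩ (extChartAt (𝓡 n) p).symm ⁻¹' A := by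
  ext y
  constructor
  · rintro ⟨hy, hyA, z, hz, hzy⟩
    have := (extChartAt (𝓡 n) p).symm.injOn (hBt hz) hy hzy
    exact ⟨this ▸ hz, hyA⟩
  · rintro ⟨hy, hyA⟩
    exact ⟨hBt hy, hyA, mem_image_of_mem _ hy⟩

/-- The density √det g · e^{-V} is continuous and positive at the centre, so on a small ball it lies
between two positive constants. -/
theorem exists_isChartBall {V : M → ℝ} (hV : Continuous V) (p : M) :
    ∃ r c, IsChartBall n (weightedMeasure n V) p r c := by
  obtain ⟨C, hC⟩ := exists_ball_dist_extChartAt_symm_le (n := n) p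
  have htn := extChartAt_target_mem_nhds (I := 𝓡 n) p
  obtain ⟨c₁, hc₁⟩ := exists_eventually_le_of_pos
    (f := fun y : EuclideanSpace ℝ (Fin n) ↦ √(gramMatrix p y).det)
    (a := extChartAt (𝓡 n) p p)
    (Real.continuous_sqrt.continuousAt.comp ((continuousOn_det_gramMatrix p).continuousAt htn))
    (Real.sqrt_pos.2 (det_gramMatrix_self_pos p))
  obtain ⟨c₂, hc₂⟩ := exists_eventually_le_of_pos
    (f := fun y : EuclideanSpace ℝ (Fin n) ↦ Real.exp (-V ((extChartAt (𝓡 n) p).symm y)))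
    (a := extChartAt (𝓡 n) p p)
    ((Real.continuous_exp.comp hV.neg).continuousAt.comp
      ((continuousOn_extChartAt_symm (I := 𝓡 n) p).continuousAt htn)) (Real.exp_pos _)
  obtain ⟨ε, hε, hball⟩ := Metric.mem_nhds_iff.1 (inter_mem hc₁ hc₂)
  obtain ⟨r, hrC, hr⟩ := (hC.and (Ioo_mem_nhdsGT hε)).exists
  set φ := extChartAt (𝓡 n) p with hφ
  set B := Metric.ball (φ p) r with hB
  have hBt : B ⊆ φ.target := hrC.1
  have hUo : IsOpen (φ.symm '' B) := isOpen_symm_image Metric.isOpen_ball hBt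
  have hg : ∀ y ∈ B, ENNReal.ofReal √(gramMatrix p y).det ≤ c₁ ∧
      1 ≤ c₁ * ENNReal.ofReal √(gramMatrix p y).det :=
    fun y hy ↦ (hball (Metric.ball_subset_ball hr.2.le hy)).1
  have hw : ∀ x ∈ φ.symm '' B, ENNReal.ofReal (Real.exp (-V x)) ≤ c₂ ∧
      1 ≤ c₂ * ENNReal.ofReal (Real.exp (-V x)) := by
    rintro _ ⟨y, hy, rfl⟩
    exact (hball (Metric.ball_subset_ball hr.2.le hy)).2
  have hcv : ∀ A, MeasurableSet A → chartVolume (n := n) p (A ∩ φ.symm '' B) =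
      ∫⁻ y in B ∩ φ.symm ⁻¹' A, ENNReal.ofReal √(gramMatrix p y).det := by
    intro A hA
    rw [chartVolume_apply p (hA.inter hUo.measurableSet), target_inter_preimage_symm_image hBt]
  have hSm : ∀ A, MeasurableSet A → MeasurableSet (B ∩ φ.symm ⁻¹' A) := fun A hA ↦
    measurableSet_inter_preimage_of_continuousOn
      ((continuousOn_extChartAt_symm (I := 𝓡 n) p).mono hBt) measurableSet_ball hA
  have hae : AEMeasurable φ.symm (volume.restrict B) :=
    ((continuousOn_extChartAt_symm (I := 𝓡 n) p).mono hBt).aemeasurable measurableSet_ball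
  have hmap : ∀ A, MeasurableSet A →
      (volume.restrict B).map φ.symm A = volume (B ∩ φ.symm ⁻¹' A) := by
    intro A hA
    rw [Measure.map_apply_of_aemeasurable hae hA,
      Measure.restrict_apply₀ (hae.nullMeasurable hA), inter_comm]
  have hweight : ∀ A, MeasurableSet A → weightedMeasure n V A =
      ∫⁻ x in A, ENNReal.ofReal (Real.exp (-V x)) ∂(riemannianVolume n M) :=
    fun A hA ↦ withDensity_apply _ hA
  refine ⟨r, max C (c₁ * c₂), hr.1, hBt, hrC.2.weaken (le_max_left _ _), ?_, ?_⟩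
  · refine Measure.le_iff.2 fun A hA ↦ ?_
    rw [Measure.restrict_apply hA, Measure.smul_apply, smul_eq_mul, hmap A hA,
      hweight _ (hA.inter hUo.measurableSet)]
    calc ∫⁻ x in A ∩ φ.symm '' B, ENNReal.ofReal (Real.exp (-V x)) ∂(riemannianVolume n M)
        ≤ ∫⁻ x in A ∩ φ.symm '' B, c₂ ∂(riemannianVolume n M) :=
          setLIntegral_mono measurable_const fun x hx ↦ (hw x hx.2).1
      _ = c₂ * riemannianVolume n M (A ∩ φ.symm '' B) := by rw [setLIntegral_const]
      _ ≤ c₂ * chartVolume (n := n) p (A ∩ φ.symm '' B) := by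
          refine mul_le_mul_right (le_trans ?_ (Measure.le_iff'.1
            (riemannianVolume_restrict_source (n := n) p) (A ∩ φ.symm '' B))) _
          rw [Measure.restrict_apply (hA.inter hUo.measurableSet)]
          refine measure_mono fun x hx ↦ ⟨hx, ?_⟩
          obtain ⟨-, y, hy, rfl⟩ := hx
          exact φ.map_target (hBt hy)
      _ ≤ c₂ * ∫⁻ y in B ∩ φ.symm ⁻¹' A, c₁ := by
          rw [hcv A hA]
          exact mul_le_mul_right
            (setLIntegral_mono measurable_const fun y hy ↦ (hg y hy.1).1) _
      _ = (c₁ * c₂ : ℝ≥0) * volume (B ∩ φ.symm ⁻¹' A) := by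
          rw [setLIntegral_const, ENNReal.coe_mul]
          ring
      _ ≤ _ := by
          gcongr
          exact le_max_right _ _
  · refine Measure.le_iff.2 fun A hA ↦ ?_
    rw [Measure.smul_apply, smul_eq_mul, hmap A hA]
    calc volume (B ∩ φ.symm ⁻¹' A)
        = ∫⁻ y in B ∩ φ.symm ⁻¹' A, 1 := by rw [setLIntegral_one]
      _ ≤ ∫⁻ y in B ∩ φ.symm ⁻¹' A, c₁ * ENNReal.ofReal √(gramMatrix p y).det :=
          setLIntegral_mono' (hSm A hA) fun y hy ↦ (hg y hy.1).2
      _ = c₁ * chartVolume (n := n) p (A ∩ φ.symm '' B) := by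
          rw [lintegral_const_mul' _ _ ENNReal.coe_ne_top, hcv A hA]
      _ ≤ c₁ * riemannianVolume n M (A ∩ φ.symm '' B) := by
          gcongr
          exact chartVolume_le_riemannianVolume p
      _ = c₁ * ∫⁻ x in A ∩ φ.symm '' B, 1 ∂(riemannianVolume n M) := by rw [setLIntegral_one]
      _ ≤ c₁ * ∫⁻ x in A ∩ φ.symm '' B, c₂ * ENNReal.ofReal (Real.exp (-V x))
            ∂(riemannianVolume n M) := by
          exact mul_le_mul_right
            (setLIntegral_mono' (hA.inter hUo.measurableSet) fun x hx ↦ (hw x hx.2).2) _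
      _ = (c₁ * c₂ : ℝ≥0) * weightedMeasure n V (A ∩ φ.symm '' B) := by
          rw [lintegral_const_mul' _ _ ENNReal.coe_ne_top,
            hweight _ (hA.inter hUo.measurableSet), ENNReal.coe_mul, mul_assoc]
      _ ≤ (max C (c₁ * c₂) : ℝ≥0) * weightedMeasure n V A := by
          gcongr
          · exact le_max_right _ _
          · exact inter_subset_left

end WeightedManifold

/-! ### Rademacher's theorem and measurability of the gradient norm -/

namespace WeightedManifold
set_option linter.unusedSectionVars false

variable {n : ℕ} {M : Type*} [MetricSpace M]
    [ChartedSpace (EuclideanSpace ℝ (Fin n)) M] [IsManifold (𝓡 n) ∞ M]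
    [RiemannianBundle (fun x : M ↦ TangentSpace (𝓡 n) x)]
    [IsContMDiffRiemannianBundle (𝓡 n) ∞ (EuclideanSpace ℝ (Fin n))
      (fun x : M ↦ TangentSpace (𝓡 n) x)]
    [IsRiemannianManifold (𝓡 n) M] [MeasurableSpace M] [BorelSpace M]

namespace IsChartBall

variable {μ : Measure M} {p : M} {r : ℝ} {c : ℝ≥0}

theorem aemeasurable_symm (h : IsChartBall n μ p r c) : AEMeasurable (extChartAt (𝓡 n) p).symm
    (volume.restrict (Metric.ball (extChartAt (𝓡 n) p p) r)) :=
  h.lipschitz.continuousOn.aemeasurable measurableSet_ball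

theorem map_apply (h : IsChartBall n μ p r c) {A : Set M} (hA : MeasurableSet A) :
    (volume.restrict (Metric.ball (extChartAt (𝓡 n) p p) r)).map (extChartAt (𝓡 n) p).symm A =
      volume (Metric.ball (extChartAt (𝓡 n) p p) r ∩ (extChartAt (𝓡 n) p).symm ⁻¹' A) := by
  rw [Measure.map_apply_of_aemeasurable h.aemeasurable_symm hA,
    Measure.restrict_apply₀ (h.aemeasurable_symm.nullMeasurable hA), inter_comm]

theorem symm_image_mem_nhds (h : IsChartBall n μ p r c) :
    (extChartAt (𝓡 n) p).symm '' Metric.ball (extChartAt (𝓡 n) p p) r ∈ 𝓝 p :=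
  (isOpen_symm_image Metric.isOpen_ball h.subset).mem_nhds
    ⟨extChartAt (𝓡 n) p p, Metric.mem_ball_self h.pos, extChartAt_to_inv p⟩

/-- Since P need not be measurable, its exceptional set is first enclosed in a measurable null set
of coordinates; the image of that set is measurable, and null by the comparison of measures. -/
theorem ae_restrict (h : IsChartBall n μ p r c) {P : M → Prop}
    (hP : ∀ᵐ y ∂(volume.restrict (Metric.ball (extChartAt (𝓡 n) p p) r)),
      P ((extChartAt (𝓡 n) p).symm y)) :
    ∀ᵐ x ∂(μ.restrict ((extChartAt (𝓡 n) p).symm '' Metric.ball (extChartAt (𝓡 n) p p) r)),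
      P x := by
  set B := Metric.ball (extChartAt (𝓡 n) p p) r
  set ψ := (extChartAt (𝓡 n) p).symm
  have hUm : MeasurableSet (ψ '' B) :=
    (isOpen_symm_image Metric.isOpen_ball h.subset).measurableSet
  rw [ae_restrict_iff' measurableSet_ball] at hP
  obtain ⟨Z, hZ, hZm, hZ0⟩ := exists_measurable_superset_of_null hP
  rw [ae_restrict_iff' hUm]
  refine measure_mono_null (t := ψ '' (B ∩ Z)) ?_ ?_
  · intro x hx
    simp only [mem_compl_iff, mem_ofPred_eq, not_forall] at hx
    obtain ⟨⟨y, hy, rfl⟩, hx⟩ := hx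
    exact ⟨y, ⟨hy, hZ fun hP ↦ hx (hP hy)⟩, rfl⟩
  · have hm : MeasurableSet (ψ '' (B ∩ Z)) :=
      measurableSet_symm_image (measurableSet_ball.inter hZm) (inter_subset_left.trans h.subset)
    have h1 : μ (ψ '' (B ∩ Z)) = μ.restrict (ψ '' B) (ψ '' (B ∩ Z)) := by
      rw [Measure.restrict_apply hm, inter_eq_left.2 (image_mono inter_subset_left)]
    rw [h1, ← nonpos_iff_eq_zero]
    refine (h.le_map _).trans ?_
    rw [Measure.smul_apply, smul_eq_mul, h.map_apply hm]
    have h2 : volume (B ∩ ψ ⁻¹' (ψ '' (B ∩ Z))) = 0 := by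
      refine measure_mono_null ?_ hZ0
      rintro y ⟨hy, z, hz, hzy⟩
      exact ψ.injOn (h.subset hz.1) (h.subset hy) hzy ▸ hz.2
    rw [h2, mul_zero]

theorem measure_pos (h : IsChartBall n μ p r c) {A : Set M} (hA : IsOpen A) (hp : p ∈ A) :
    0 < μ A := by
  have hc : ContinuousOn (extChartAt (𝓡 n) p).symm (Metric.ball (extChartAt (𝓡 n) p p) r) :=
    h.lipschitz.continuousOn
  have h1 := hc.isOpen_inter_preimage Metric.isOpen_ball hA
  have h2 := h1.measure_pos volume ⟨extChartAt (𝓡 n) p p, Metric.mem_ball_self h.pos, by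
    rwa [mem_preimage, extChartAt_to_inv p]⟩
  rw [← h.map_apply hA.measurableSet] at h2
  have h3 := h2.trans_le (h.map_le A)
  rw [Measure.smul_apply, smul_eq_mul] at h3
  exact (ENNReal.mul_pos_iff.1 h3).2

end IsChartBall

section Global

variable {μ : Measure M}

theorem measure_pos_of_isOpen (hμ : ∀ p, ∃ r c, IsChartBall n μ p r c) {A : Set M} (hA : IsOpen A)
    (hne : A.Nonempty) : 0 < μ A := by
  obtain ⟨p, hp⟩ := hne
  obtain ⟨r, c, h⟩ := hμ p
  exact h.measure_pos hA hp

variable [CompactSpace M]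

/-- Rademacher's theorem on a Riemannian manifold. -/
theorem ae_mdifferentiableAt (hμ : ∀ p, ∃ r c, IsChartBall n μ p r c) {f : M → ℝ}
    (hf : IsLipschitz f) : ∀ᵐ x ∂μ, MDifferentiableAt (𝓡 n) 𝓘(ℝ, ℝ) f x := by
  obtain ⟨K, hK⟩ := hf
  refine measure_null_of_locally_null _ fun p _ ↦ ?_
  obtain ⟨r, c, h⟩ := hμ p
  set B := Metric.ball (extChartAt (𝓡 n) p p) r
  set ψ := (extChartAt (𝓡 n) p).symm
  have hF : LipschitzOnWith (K * c) (f ∘ ψ) B := hK.comp_lipschitzOnWith h.lipschitz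
  have h1 : ∀ᵐ y ∂(volume.restrict B), MDifferentiableAt (𝓡 n) 𝓘(ℝ, ℝ) f (ψ y) := by
    rw [ae_restrict_iff' measurableSet_ball]
    filter_upwards [hF.ae_differentiableWithinAt_of_mem (μ := volume)] with y hy hyB
    exact (mdifferentiableAt_iff_differentiableAt_chart (h.subset hyB)).2
      ((hy hyB).differentiableAt (Metric.isOpen_ball.mem_nhds hyB))
  have h2 := h.ae_restrict h1
  have hUo : IsOpen (ψ '' B) := isOpen_symm_image Metric.isOpen_ball h.subset
  rw [ae_restrict_iff' hUo.measurableSet] at h2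
  refine ⟨_ ∩ ψ '' B, inter_mem_nhdsWithin _ h.symm_image_mem_nhds, measure_mono_null ?_ h2⟩
  rintro x ⟨hx, hxU⟩ hcon
  exact hx (hcon hxU)

/-- At points of differentiability the gradient norm is the pointwise Lipschitz constant. Rational
slopes and radii 1/(j + 1) make the quantifiers countable, except for the one over y, which produces
open sets. -/
theorem lt_norm_riemannianGradient_iff {f : M → ℝ} {x : M} {a : ℝ} (ha : 0 ≤ a)
    (hx : MDifferentiableAt (𝓡 n) 𝓘(ℝ, ℝ) f x) : a < ‖riemannianGradient n f x‖ ↔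
      ∃ q : ℚ, a < q ∧ ∀ j : ℕ, ∃ y, dist y x < 1 / (j + 1) ∧ q * dist x y < |f y - f x| := by
  constructor
  · intro h
    obtain ⟨q, hq1, hq2⟩ := exists_rat_btwn h
    refine ⟨q, hq1, fun j ↦ ?_⟩
    by_contra! hcon
    refine absurd (norm_riemannianGradient_le_of_eventually hx (ha.trans hq1.le) ?_) hq2.not_ge
    filter_upwards [Metric.ball_mem_nhds x (Nat.one_div_pos_of_nat (α := ℝ) (n := j))] with y hy
    exact hcon y hy
  · rintro ⟨q, hq, hy⟩
    refine hq.trans_le (le_of_forall_pos_le_add fun δ hδ ↦ ?_)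
    by_contra! hcon
    obtain ⟨ε, hε, hball⟩ := Metric.eventually_nhds_iff.1 (eventually_abs_sub_le_dist hx hδ)
    obtain ⟨j, hj⟩ := exists_nat_one_div_lt hε
    obtain ⟨y, hy1, hy2⟩ := hy j
    have h1 := hball (hy1.trans hj)
    have h2 : (‖riemannianGradient n f x‖ + δ) * dist x y ≤ q * dist x y := by gcongr
    linarith

theorem aemeasurable_norm_riemannianGradient (hμ : ∀ p, ∃ r c, IsChartBall n μ p r c) {f : M → ℝ}
    (hf : IsLipschitz f) : AEMeasurable (fun x ↦ ‖riemannianGradient n f x‖) μ := by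
  have hae := ae_mdifferentiableAt hμ hf
  obtain ⟨K, hK⟩ := hf
  obtain ⟨Z, hZ, hZm, hZ0⟩ := exists_measurable_superset_of_null hae
  -- Off a measurable null set Z containing all points of non-differentiability, the superlevel sets
  -- are countable unions of countable intersections of open sets; on Z the value is reset to 0.
  refine ⟨Zᶜ.indicator fun x ↦ ‖riemannianGradient n f x‖, measurable_of_Ioi fun a ↦ ?_, ?_⟩
  · rcases lt_or_ge a 0 with ha | ha
    · convert MeasurableSet.univ
      refine eq_univ_of_forall fun x ↦ ?_
      exact ha.trans_le (indicator_nonneg (fun _ _ ↦ norm_nonneg _) x)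
    · have : (Zᶜ.indicator fun x ↦ ‖riemannianGradient n f x‖) ⁻¹' Ioi a = Zᶜ ∩
          ⋃ q ∈ {q : ℚ | a < q}, ⋂ j : ℕ,
            {x | ∃ y, dist y x < 1 / (j + 1 : ℝ) ∧ (q : ℝ) * dist x y < |f y - f x|} := by
        ext x
        by_cases hx : x ∈ Z
        · simp [hx, ha]
        · have hd : MDifferentiableAt (𝓡 n) 𝓘(ℝ, ℝ) f x := by
            by_contra hcon
            exact hx (hZ hcon)
          have h3 := lt_norm_riemannianGradient_iff ha hd
          have h4 : x ∈ Zᶜ := hx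
          simp only [mem_preimage, indicator_of_mem h4, mem_Ioi, mem_inter_iff, h4, true_and,
            h3, mem_iUnion, mem_iInter, mem_ofPred_eq, exists_prop]
      rw [this]
      refine hZm.compl.inter (MeasurableSet.biUnion (to_countable _) fun q _ ↦
        MeasurableSet.iInter fun j ↦ IsOpen.measurableSet ?_)
      have : {x | ∃ y, dist y x < 1 / (j + 1 : ℝ) ∧ (q : ℝ) * dist x y < |f y - f x|} =
          ⋃ y, {x | dist y x < 1 / (j + 1 : ℝ) ∧ (q : ℝ) * dist x y < |f y - f x|} := by
        ext x
        simp
      rw [this]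
      refine isOpen_iUnion fun y ↦ IsOpen.and ?_ ?_
      · exact isOpen_lt (by fun_prop) continuous_const
      · have := hK.continuous
        exact isOpen_lt (by fun_prop) (by fun_prop)
  · filter_upwards [measure_eq_zero_iff_ae_notMem.1 hZ0] with x hx
    rw [indicator_of_mem (by exact hx)]

end Global

end WeightedManifold

/-! ### The Dirichlet form on Lipschitz functions -/

namespace WeightedManifold
set_option linter.unusedSectionVars false

section Lipschitz

variable {X : Type*} [PseudoEMetricSpace X]

theorem IsLipschitz.add {f g : X → ℝ} (hf : IsLipschitz f) (hg : IsLipschitz g) :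
    IsLipschitz (f + g) := by
  obtain ⟨K, hK⟩ := hf
  obtain ⟨L, hL⟩ := hg
  exact ⟨K + L, hK.add hL⟩

theorem isLipschitz_const (c : ℝ) : IsLipschitz fun _ : X ↦ c := ⟨0, LipschitzWith.const c⟩

theorem IsLipschitz.const_smul {f : X → ℝ} (hf : IsLipschitz f) (c : ℝ) : IsLipschitz (c • f) := by
  obtain ⟨K, hK⟩ := hf
  refine ⟨‖c‖₊ * K, fun x y ↦ ?_⟩
  simp only [Pi.smul_apply]
  rw [edist_smul₀, ENNReal.coe_mul, mul_assoc]
  exact mul_le_mul_right (hK x y) _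

theorem IsLipschitz.comp {f : X → ℝ} {η : ℝ → ℝ} (hη : IsLipschitz η) (hf : IsLipschitz f) :
    IsLipschitz (η ∘ f) := by
  obtain ⟨K, hK⟩ := hf
  obtain ⟨L, hL⟩ := hη
  exact ⟨L * K, hL.comp hK⟩

theorem IsLipschitz.continuous {f : X → ℝ} (hf : IsLipschitz f) : Continuous f := by
  obtain ⟨K, hK⟩ := hf
  exact hK.continuous

theorem IsLipschitz.memLp [CompactSpace X] [MeasurableSpace X] [BorelSpace X] {μ : Measure X}
    [IsFiniteMeasure μ] {f : X → ℝ} (hf : IsLipschitz f) (p : ℝ≥0∞) : MemLp f p μ := by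
  obtain ⟨C, hC⟩ := isCompact_univ.exists_bound_of_continuousOn hf.continuous.continuousOn
  exact MemLp.of_bound hf.continuous.measurable.aestronglyMeasurable C
    (Eventually.of_forall fun x ↦ hC x (mem_univ x))

variable (X) in
/-- The space of Lipschitz functions. -/
def lipschitzFunctions : Submodule ℝ (X → ℝ) where
  carrier := {f | IsLipschitz f}
  add_mem' := IsLipschitz.add
  zero_mem' := isLipschitz_const 0
  smul_mem' c _ hf := IsLipschitz.const_smul hf c

end Lipschitz

variable {n : ℕ} {M : Type*} [MetricSpace M]
    [ChartedSpace (EuclideanSpace ℝ (Fin n)) M] [IsManifold (𝓡 n) ∞ M]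
    [RiemannianBundle (fun x : M ↦ TangentSpace (𝓡 n) x)]
    [IsContMDiffRiemannianBundle (𝓡 n) ∞ (EuclideanSpace ℝ (Fin n))
      (fun x : M ↦ TangentSpace (𝓡 n) x)]
    [IsRiemannianManifold (𝓡 n) M] [CompactSpace M] [MeasurableSpace M] [BorelSpace M]
    {μ : Measure M} [IsFiniteMeasure μ]

theorem dirichletForm_self (f : M → ℝ) :
    dirichletForm n μ f f = ∫ x, ‖riemannianGradient n f x‖ ^ 2 ∂μ := by
  simp only [dirichletForm, real_inner_self_eq_norm_sq]

theorem dirichletForm_self_nonneg (f : M → ℝ) : 0 ≤ dirichletForm n μ f f := by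
  rw [dirichletForm_self]
  positivity

theorem dirichletForm_comm (f g : M → ℝ) : dirichletForm n μ f g = dirichletForm n μ g f := by
  simp only [dirichletForm, real_inner_comm]

variable (hμ : ∀ p, ∃ r c, IsChartBall n μ p r c)
include hμ

theorem integrable_sq_norm_riemannianGradient {f : M → ℝ} (hf : IsLipschitz f) :
    Integrable (fun x ↦ ‖riemannianGradient n f x‖ ^ 2) μ := by
  have h := aemeasurable_norm_riemannianGradient hμ hf
  obtain ⟨K, hK⟩ := hf
  refine Integrable.of_bound (h.pow_const 2).aestronglyMeasurable (K ^ 2 : ℝ)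
    (Eventually.of_forall fun x ↦ ?_)
  rw [Real.norm_of_nonneg (by positivity)]
  gcongr
  exact norm_riemannianGradient_le_of_lipschitzWith hK x

/-- Polarization reduces the integrability of the inner product to the measurability of gradient
norms; gradients at different points live in different spaces. -/
theorem ae_inner_riemannianGradient_eq {f g : M → ℝ} (hf : IsLipschitz f) (hg : IsLipschitz g) :
    ∀ᵐ x ∂μ, inner ℝ (riemannianGradient n f x) (riemannianGradient n g x) =
      (‖riemannianGradient n (f + g) x‖ ^ 2 - ‖riemannianGradient n f x‖ ^ 2 -
        ‖riemannianGradient n g x‖ ^ 2) / 2 := by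
  filter_upwards [ae_mdifferentiableAt hμ hf, ae_mdifferentiableAt hμ hg] with x hx hy
  rw [riemannianGradient_add hx hy, norm_add_sq_real]
  ring

theorem integrable_inner_riemannianGradient {f g : M → ℝ} (hf : IsLipschitz f)
    (hg : IsLipschitz g) :
    Integrable (fun x ↦ inner ℝ (riemannianGradient n f x) (riemannianGradient n g x)) μ := by
  refine Integrable.congr ?_ (EventuallyEq.symm (ae_inner_riemannianGradient_eq hμ hf hg))
  exact (((integrable_sq_norm_riemannianGradient hμ (hf.add hg)).sub
    (integrable_sq_norm_riemannianGradient hμ hf)).sub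
    (integrable_sq_norm_riemannianGradient hμ hg)).div_const 2

theorem dirichletForm_add_left {f g h : M → ℝ} (hf : IsLipschitz f) (hg : IsLipschitz g)
    (hh : IsLipschitz h) :
    dirichletForm n μ (f + g) h = dirichletForm n μ f h + dirichletForm n μ g h := by
  simp only [dirichletForm]
  rw [← integral_add (integrable_inner_riemannianGradient hμ hf hh)
    (integrable_inner_riemannianGradient hμ hg hh)]
  refine integral_congr_ae ?_
  filter_upwards [ae_mdifferentiableAt hμ hf, ae_mdifferentiableAt hμ hg] with x hx hy
  rw [riemannianGradient_add hx hy, inner_add_left]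

theorem dirichletForm_smul_left {f h : M → ℝ} (hf : IsLipschitz f) (c : ℝ) :
    dirichletForm n μ (c • f) h = c * dirichletForm n μ f h := by
  simp only [dirichletForm]
  rw [← integral_const_mul]
  refine integral_congr_ae ?_
  filter_upwards [ae_mdifferentiableAt hμ hf] with x hx
  rw [riemannianGradient_const_smul hx, real_inner_smul_left]

/-- Translates the Cauchy condition on gradients in the definition of Sobolev approximations into
one on the form. -/
theorem integral_sq_norm_riemannianGradient_sub {f g : M → ℝ} (hf : IsLipschitz f)
    (hg : IsLipschitz g) :
    ∫ x, ‖riemannianGradient n f x - riemannianGradient n g x‖ ^ 2 ∂μ =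
      dirichletForm n μ (f - g) (f - g) := by
  rw [dirichletForm_self]
  refine integral_congr_ae ?_
  filter_upwards [ae_mdifferentiableAt hμ hf, ae_mdifferentiableAt hμ hg] with x hx hy
  have : f - g = f + (-1 : ℝ) • g := by
    ext x
    simp [sub_eq_add_neg]
  rw [this, riemannianGradient_add hx (mdifferentiableAt_const_smul hy _),
    riemannianGradient_const_smul hy, neg_one_smul, ← sub_eq_add_neg]

theorem lintegral_sq_enorm_riemannianGradient {f : M → ℝ} (hf : IsLipschitz f) :
    ∫⁻ x, ‖riemannianGradient n f x‖ₑ ^ 2 ∂μ = ENNReal.ofReal (dirichletForm n μ f f) := by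
  rw [dirichletForm_self, ofReal_integral_eq_lintegral_ofReal
    (integrable_sq_norm_riemannianGradient hμ hf) (Eventually.of_forall fun x ↦ by positivity)]
  refine lintegral_congr fun x ↦ ?_
  rw [ENNReal.ofReal_pow (norm_nonneg _), ofReal_norm]

/-- The Dirichlet form as a bilinear form on Lipschitz functions. -/
noncomputable def energyForm : lipschitzFunctions M →ₗ[ℝ] lipschitzFunctions M →ₗ[ℝ] ℝ :=
  LinearMap.mk₂ ℝ (fun f g ↦ dirichletForm n μ f g)
    (fun f g h ↦ dirichletForm_add_left hμ f.2 g.2 h.2)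
    (fun c f h ↦ dirichletForm_smul_left hμ f.2 c)
    (fun h f g ↦ by
      rw [dirichletForm_comm _ (f : M → ℝ), dirichletForm_comm _ (g : M → ℝ), dirichletForm_comm]
      exact dirichletForm_add_left hμ f.2 g.2 h.2)
    (fun c h f ↦ by
      rw [dirichletForm_comm _ (f : M → ℝ), dirichletForm_comm]
      exact dirichletForm_smul_left hμ f.2 c)

end WeightedManifold

/-! ### Poincaré inequalities on chart balls and on small cells -/

namespace WeightedManifold
set_option linter.unusedSectionVars false

variable {n : ℕ} {M : Type*} [MetricSpace M]
    [ChartedSpace (EuclideanSpace ℝ (Fin n)) M] [IsManifold (𝓡 n) ∞ M]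
    [RiemannianBundle (fun x : M ↦ TangentSpace (𝓡 n) x)]
    [IsContMDiffRiemannianBundle (𝓡 n) ∞ (EuclideanSpace ℝ (Fin n))
      (fun x : M ↦ TangentSpace (𝓡 n) x)]
    [IsRiemannianManifold (𝓡 n) M] [MeasurableSpace M] [BorelSpace M]
    {μ : Measure M}

namespace IsChartBall

variable {p : M} {r : ℝ} {c : ℝ≥0}

theorem restrict_map (h : IsChartBall n μ p r c) {q : Set (EuclideanSpace ℝ (Fin n))}
    (hq : q ⊆ Metric.ball (extChartAt (𝓡 n) p p) r) (hqm : MeasurableSet q) :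
    ((volume.restrict (Metric.ball (extChartAt (𝓡 n) p p) r)).map
      (extChartAt (𝓡 n) p).symm).restrict ((extChartAt (𝓡 n) p).symm '' q) =
        (volume.restrict q).map (extChartAt (𝓡 n) p).symm := by
  have hm := measurableSet_symm_image hqm (hq.trans h.subset)
  have hae : AEMeasurable (extChartAt (𝓡 n) p).symm (volume.restrict q) :=
    h.aemeasurable_symm.mono_measure (Measure.restrict_mono_set _ hq)
  ext A hA
  rw [Measure.restrict_apply hA, h.map_apply (hA.inter hm), Measure.map_apply_of_aemeasurable hae hA,
    Measure.restrict_apply₀ (hae.nullMeasurable hA)]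
  congr 1
  ext y
  constructor
  · rintro ⟨hy, hyA, z, hz, hzy⟩
    exact ⟨hyA, (extChartAt (𝓡 n) p).symm.injOn (h.subset (hq hz)) (h.subset hy) hzy ▸ hz⟩
  · rintro ⟨hyA, hy⟩
    exact ⟨hq hy, hyA, mem_image_of_mem _ hy⟩

theorem restrict_le_map (h : IsChartBall n μ p r c) {q : Set (EuclideanSpace ℝ (Fin n))}
    (hq : q ⊆ Metric.ball (extChartAt (𝓡 n) p p) r) (hqm : MeasurableSet q) :
    μ.restrict ((extChartAt (𝓡 n) p).symm '' q) ≤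
      (c : ℝ≥0∞) • (volume.restrict q).map (extChartAt (𝓡 n) p).symm := by
  have hm := measurableSet_symm_image hqm (hq.trans h.subset)
  have h1 := Measure.restrict_mono_measure h.le_map ((extChartAt (𝓡 n) p).symm '' q)
  rwa [Measure.restrict_restrict hm, inter_eq_left.2 (image_mono hq), Measure.restrict_smul,
    h.restrict_map hq hqm] at h1

theorem map_le_restrict (h : IsChartBall n μ p r c) {q : Set (EuclideanSpace ℝ (Fin n))}
    (hq : q ⊆ Metric.ball (extChartAt (𝓡 n) p p) r) (hqm : MeasurableSet q) :
    (volume.restrict q).map (extChartAt (𝓡 n) p).symm ≤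
      (c : ℝ≥0∞) • μ.restrict ((extChartAt (𝓡 n) p).symm '' q) := by
  have h1 := Measure.restrict_mono_measure h.map_le ((extChartAt (𝓡 n) p).symm '' q)
  rwa [Measure.restrict_smul, h.restrict_map hq hqm] at h1

/-- The Poincaré inequality on the image of a convex set under the inverse of a chart. -/
theorem lintegral_lintegral_sq_enorm_sub_le [CompactSpace M]
    (hμ : ∀ p, ∃ r c, IsChartBall n μ p r c) (h : IsChartBall n μ p r c)
    {q : Set (EuclideanSpace ℝ (Fin n))}
    (hq : q ⊆ Metric.ball (extChartAt (𝓡 n) p p) r) (hqm : MeasurableSet q) (hqc : Convex ℝ q)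
    {δ : ℝ≥0∞} (hδ : ∀ x ∈ q, ∀ y ∈ q, edist x y ≤ δ) {f : M → ℝ} (hf : IsLipschitz f) :
    ∫⁻ x in (extChartAt (𝓡 n) p).symm '' q, ∫⁻ y in (extChartAt (𝓡 n) p).symm '' q,
      ‖f x - f y‖ₑ ^ 2 ∂μ ∂μ ≤ (2 ^ n * c ^ 6 : ℝ≥0) * δ ^ 2 *
        μ ((extChartAt (𝓡 n) p).symm '' q) *
          ∫⁻ x in (extChartAt (𝓡 n) p).symm '' q, ‖riemannianGradient n f x‖ₑ ^ 2 ∂μ := by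
  set B := Metric.ball (extChartAt (𝓡 n) p p) r with hB
  set ψ := (extChartAt (𝓡 n) p).symm with hψ
  have hfc := hf.continuous
  have hgm := aemeasurable_norm_riemannianGradient hμ hf
  obtain ⟨K, hK⟩ := hf
  -- The Euclidean inequality is stated for globally Lipschitz functions. The extension F agrees
  -- with f∘ψ on the open ball, so the derivatives agree there too.
  obtain ⟨F, hF, hFeq⟩ := (hK.comp_lipschitzOnWith h.lipschitz).extend_real
  have hae : AEMeasurable ψ (volume.restrict q) :=
    h.aemeasurable_symm.mono_measure (Measure.restrict_mono_set _ hq)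
  set ν := (volume.restrict q).map ψ with hν
  have hle : μ.restrict (ψ '' q) ≤ (c : ℝ≥0∞) • ν := h.restrict_le_map hq hqm
  have hge : ν ≤ (c : ℝ≥0∞) • μ.restrict (ψ '' q) := h.map_le_restrict hq hqm
  have hqfin : IsFiniteMeasure (volume.restrict q) :=
    ⟨by
      rw [Measure.restrict_apply_univ]
      exact (measure_mono hq).trans_lt measure_ball_lt_top⟩
  have hm2 : Measurable fun z : M × M ↦ ‖f z.1 - f z.2‖ₑ ^ 2 := by
    have : Continuous fun z : M × M ↦ f z.1 - f z.2 := by fun_prop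
    exact this.measurable.enorm.pow_const 2
  have hm3 : Measurable fun x ↦ ∫⁻ y, ‖f x - f y‖ₑ ^ 2 ∂ν := hm2.lintegral_prod_right'
  have hm4 : ∀ x, Measurable fun y ↦ ‖f x - f y‖ₑ ^ 2 := fun x ↦ hm2.comp measurable_prodMk_left
  have hFd : ∀ y ∈ q, ‖fderiv ℝ F y‖ₑ ^ 2 ≤ c ^ 2 * ‖riemannianGradient n f (ψ y)‖ₑ ^ 2 := by
    intro y hy
    have h1 : F =ᶠ[𝓝 y] f ∘ ψ := by
      filter_upwards [Metric.isOpen_ball.mem_nhds (hq hy)] with z hz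
      exact (hFeq hz).symm
    rw [h1.fderiv_eq, ← mul_pow]
    gcongr
    have h2 := norm_fderiv_comp_extChartAt_symm_le Metric.isOpen_ball h.subset h.lipschitz f (hq hy)
    rw [← ofReal_norm, ← ofReal_norm, ← ENNReal.ofReal_coe_nnreal,
      ← ENNReal.ofReal_mul (NNReal.coe_nonneg c)]
    exact ENNReal.ofReal_le_ofReal h2
  have hgν : AEMeasurable (fun x ↦ ‖riemannianGradient n f x‖ₑ ^ 2) ν := by
    have h1 : AEMeasurable (fun x ↦ ‖riemannianGradient n f x‖) ν :=
      hgm.mono_ac (((Measure.absolutelyContinuous_of_le hge).trans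
        (Measure.smul_absolutelyContinuous)).trans Measure.absolutelyContinuous_restrict)
    have h2 : (fun x ↦ ‖riemannianGradient n f x‖ₑ ^ 2) =
        fun x ↦ ENNReal.ofReal ‖riemannianGradient n f x‖ ^ 2 := by
      ext x
      rw [ofReal_norm]
    rw [h2]
    exact h1.ennreal_ofReal.pow_const 2
  have hvol : volume q ≤ c * μ (ψ '' q) := by
    have h1 := hge univ
    rwa [hν, Measure.map_apply_of_aemeasurable hae MeasurableSet.univ, preimage_univ,
      Measure.restrict_apply_univ, Measure.smul_apply, Measure.restrict_apply_univ] at h1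
  -- The power c⁶ collects c² from the double integral, c from the volume of q, c² from the gradient
  -- in coordinates and c from returning to μ.
  calc ∫⁻ x in ψ '' q, ∫⁻ y in ψ '' q, ‖f x - f y‖ₑ ^ 2 ∂μ ∂μ
      ≤ ∫⁻ x, ∫⁻ y, ‖f x - f y‖ₑ ^ 2 ∂((c : ℝ≥0∞) • ν) ∂((c : ℝ≥0∞) • ν) :=
        lintegral_mono' hle fun x ↦ lintegral_mono' hle fun y ↦ le_rfl
    _ = c ^ 2 * ∫⁻ x, ∫⁻ y, ‖f x - f y‖ₑ ^ 2 ∂ν ∂ν := by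
        simp only [lintegral_smul_measure, smul_eq_mul]
        rw [lintegral_const_mul _ hm3, ← mul_assoc, sq]
    _ = c ^ 2 * ∫⁻ x in q, ∫⁻ y in q, ‖F x - F y‖ₑ ^ 2 := by
        congr 1
        rw [hν, lintegral_map' (hν ▸ hm3.aemeasurable) hae]
        refine setLIntegral_congr_fun hqm fun x hx ↦ ?_
        rw [lintegral_map' (hm4 _).aemeasurable hae]
        refine setLIntegral_congr_fun hqm fun y hy ↦ ?_
        rw [← hFeq (hq hx), ← hFeq (hq hy)]
        rfl
    _ ≤ c ^ 2 * (2 ^ n * δ ^ 2 * (c * μ (ψ '' q)) *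
          ∫⁻ y in q, c ^ 2 * ‖riemannianGradient n f (ψ y)‖ₑ ^ 2) := by
        refine mul_le_mul_right ((WeightedManifold.lintegral_lintegral_sq_enorm_sub_le volume hF hqc
          hqm hδ).trans ?_) _
        rw [finrank_euclideanSpace_fin]
        refine mul_le_mul' (mul_le_mul_right hvol _) (setLIntegral_mono' hqm hFd)
    _ ≤ c ^ 2 * (2 ^ n * δ ^ 2 * (c * μ (ψ '' q)) *
          (c ^ 2 * (c * ∫⁻ x in ψ '' q, ‖riemannianGradient n f x‖ₑ ^ 2 ∂μ))) := by
        rw [lintegral_const_mul' _ _ (by finiteness)]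
        refine mul_le_mul_right (mul_le_mul_right (mul_le_mul_right ?_ _) _) _
        rw [← lintegral_map' hgν hae]
        refine (lintegral_mono' hge le_rfl).trans_eq ?_
        rw [lintegral_smul_measure, smul_eq_mul]
    _ = _ := by
        push_cast
        ring

end IsChartBall

/-- The same chart ball serves two purposes: the inequality on all of U feeds the global Poincaré
inequality, and the one on cells, with C independent of δ, feeds the Rellich estimate. -/
theorem exists_cells [CompactSpace M]
    (hμ : ∀ p, ∃ r c, IsChartBall n μ p r c) (p : M) :
    ∃ U, IsOpen U ∧ p ∈ U ∧ ∃ C : ℝ≥0,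
      (∃ D : ℝ≥0, ∀ f : M → ℝ, IsLipschitz f → ∫⁻ x in U, ∫⁻ y in U, ‖f x - f y‖ₑ ^ 2 ∂μ ∂μ ≤
        D * μ U * ∫⁻ x in U, ‖riemannianGradient n f x‖ₑ ^ 2 ∂μ) ∧
      ∀ δ : ℝ, 0 < δ → ∃ (s : Finset (Fin n → ℤ)) (Q : (Fin n → ℤ) → Set M),
        (∀ i, MeasurableSet (Q i)) ∧ Pairwise (Function.onFun Disjoint Q) ∧ U = ⋃ i ∈ s, Q i ∧
        ∀ f : M → ℝ, IsLipschitz f → ∀ i,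
          ∫⁻ x in Q i, ∫⁻ y in Q i, ‖f x - f y‖ₑ ^ 2 ∂μ ∂μ ≤
            C * ENNReal.ofReal δ ^ 2 * μ (Q i) *
              ∫⁻ x in Q i, ‖riemannianGradient n f x‖ₑ ^ 2 ∂μ := by
  obtain ⟨r, c, h⟩ := hμ p
  set B := Metric.ball (extChartAt (𝓡 n) p p) r with hB
  set ψ := (extChartAt (𝓡 n) p).symm with hψ
  refine ⟨ψ '' B, isOpen_symm_image Metric.isOpen_ball h.subset,
    mem_of_mem_nhds h.symm_image_mem_nhds, 2 ^ n * c ^ 6,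
    ⟨2 ^ n * c ^ 6 * (2 * r).toNNReal ^ 2, fun f hf ↦ ?_⟩, fun δ hδ ↦ ?_⟩
  · have := h.lintegral_lintegral_sq_enorm_sub_le hμ subset_rfl measurableSet_ball
      (convex_ball _ _) (δ := ENNReal.ofReal (2 * r)) (fun x hx y hy ↦ ?_) hf
    · convert this using 3
      push_cast
      rfl
    · rw [edist_dist]
      refine ENNReal.ofReal_le_ofReal ((dist_triangle_right x y (extChartAt (𝓡 n) p p)).trans ?_)
      have h1 := Metric.mem_ball.1 hx
      have h2 := Metric.mem_ball.1 hy
      linarith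
  · obtain ⟨s, q, hqc, hqm, hqd, hqp, hqU⟩ := exists_convex_cells (extChartAt (𝓡 n) p p) r hδ
    -- The inclusion q i ⊆ B is known only for i ∈ s; intersecting with the convex ball B secures it
    -- for all i.
    refine ⟨s, fun i ↦ ψ '' (q i ∩ B), fun i ↦ measurableSet_symm_image
      ((hqm i).inter measurableSet_ball) (inter_subset_right.trans h.subset), ?_, ?_, ?_⟩
    · intro i j hij
      refine (disjoint_image_image ?_)
      rintro y ⟨hy, hyB⟩ z ⟨hz, hzB⟩ hyz
      have := ψ.injOn (h.subset hyB) (h.subset hzB) hyz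
      subst this
      exact disjoint_left.1 (hqp hij) hy hz
    · rw [← image_iUnion₂, ← iUnion₂_inter, ← hqU, inter_self]
    · intro f hf i
      exact h.lintegral_lintegral_sq_enorm_sub_le hμ inter_subset_right
        ((hqm i).inter measurableSet_ball) ((hqc i).inter (convex_ball _ _))
        (fun x hx y hy ↦ hqd i x hx.1 y hy.1) hf

end WeightedManifold

/-! ### Compactness of the map to L² (Rellich) -/

namespace WeightedManifold
set_option linter.unusedSectionVars false

theorem lintegral_lintegral_sq_enorm_sub {α : Type*} [MeasurableSpace α] {ν : Measure α}
    [IsFiniteMeasure ν] {f : α → ℝ} (hf : MemLp f 2 ν) :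
    ∫⁻ x, ∫⁻ y, ‖f x - f y‖ₑ ^ 2 ∂ν ∂ν =
      ENNReal.ofReal (2 * ν.real univ * ∫ x, f x ^ 2 ∂ν - 2 * (∫ x, f x ∂ν) ^ 2) := by
  have hf1 : Integrable f ν := hf.integrable one_le_two
  have hf2 : Integrable (fun x ↦ f x ^ 2) ν := hf.integrable_sq
  have hi : ∀ x, Integrable (fun y ↦ (f x - f y) ^ 2) ν := fun x ↦
    ((memLp_const (f x)).sub hf).integrable_sq
  have h2 : ∀ x, ∫ y, (f x - f y) ^ 2 ∂ν =
      f x ^ 2 * ν.real univ - 2 * f x * (∫ y, f y ∂ν) + ∫ y, f y ^ 2 ∂ν := by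
    intro x
    have h3 : ∀ y, (f x - f y) ^ 2 = f x ^ 2 - 2 * f x * f y + f y ^ 2 := fun y ↦ by ring
    have h4 : Integrable (fun y ↦ f x ^ 2 - 2 * f x * f y) ν :=
      (integrable_const _).sub (hf1.const_mul _)
    simp only [h3]
    rw [integral_add h4 hf2, integral_sub (integrable_const _) (hf1.const_mul _), integral_const,
      integral_const_mul, smul_eq_mul]
    ring
  have h1 : ∀ x, ∫⁻ y, ‖f x - f y‖ₑ ^ 2 ∂ν =
      ENNReal.ofReal (f x ^ 2 * ν.real univ - 2 * f x * (∫ y, f y ∂ν) + ∫ y, f y ^ 2 ∂ν) := by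
    intro x
    rw [← h2, ofReal_integral_eq_lintegral_ofReal (hi x) (Eventually.of_forall fun y ↦ sq_nonneg _)]
    refine lintegral_congr fun y ↦ ?_
    rw [← ofReal_norm, ← ENNReal.ofReal_pow (norm_nonneg _), Real.norm_eq_abs, sq_abs]
  have h5 : Integrable (fun x ↦ f x ^ 2 * ν.real univ - 2 * f x * (∫ y, f y ∂ν)) ν :=
    (hf2.mul_const _).sub ((hf1.const_mul _).mul_const _)
  have h6 : Integrable (fun x ↦ f x ^ 2 * ν.real univ - 2 * f x * (∫ y, f y ∂ν) +
      ∫ y, f y ^ 2 ∂ν) ν := h5.add (integrable_const _)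
  simp only [h1]
  rw [← ofReal_integral_eq_lintegral_ofReal h6]
  · congr 1
    rw [integral_add h5 (integrable_const _),
        integral_sub (hf2.mul_const _) ((hf1.const_mul _).mul_const _), integral_mul_const,
        integral_mul_const, integral_const_mul, integral_const, smul_eq_mul]
    ring
  · refine Eventually.of_forall fun x ↦ ?_
    have h4 : 0 ≤ ∫ y, (f x - f y) ^ 2 ∂ν := integral_nonneg fun y ↦ sq_nonneg _
    rw [h2] at h4
    exact h4

/-- If the double integral of the squared differences of `f` is controlled, then so is the
`L²`-norm of `f`, up to the mean value of `f`. -/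
theorem lintegral_sq_enorm_le_of_lintegral_lintegral_le {α : Type*} [MeasurableSpace α]
    {ν : Measure α} [IsFiniteMeasure ν] {f : α → ℝ} (hf : MemLp f 2 ν) {A : ℝ≥0∞}
    (h : ∫⁻ x, ∫⁻ y, ‖f x - f y‖ₑ ^ 2 ∂ν ∂ν ≤ A * ν univ) :
    ∫⁻ x, ‖f x‖ₑ ^ 2 ∂ν ≤ A + ENNReal.ofReal ((ν.real univ)⁻¹ * (∫ x, f x ∂ν) ^ 2) := by
  rcases eq_or_ne A ⊤ with rfl | hA
  · simp
  -- For the zero measure the inverse of the total mass is the default 0, and both sides vanish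
  -- trivially.
  rcases eq_or_ne (ν univ) 0 with h0 | h0
  · rw [Measure.measure_univ_eq_zero.1 h0]
    simp
  have hm : 0 < ν.real univ := ENNReal.toReal_pos h0 (measure_ne_top _ _)
  have h1 : ∫⁻ x, ‖f x‖ₑ ^ 2 ∂ν = ENNReal.ofReal (∫ x, f x ^ 2 ∂ν) := by
    rw [ofReal_integral_eq_lintegral_ofReal hf.integrable_sq
      (Eventually.of_forall fun y ↦ sq_nonneg _)]
    refine lintegral_congr fun y ↦ ?_
    rw [← ofReal_norm, ← ENNReal.ofReal_pow (norm_nonneg _), Real.norm_eq_abs, sq_abs]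
  rw [lintegral_lintegral_sq_enorm_sub hf, ← ENNReal.ofReal_toReal hA,
    ← ENNReal.ofReal_toReal (measure_ne_top ν univ), ← ENNReal.ofReal_mul ENNReal.toReal_nonneg,
    ENNReal.ofReal_le_ofReal_iff (by positivity)] at h
  rw [h1, ← ENNReal.ofReal_toReal hA, ← ENNReal.ofReal_add ENNReal.toReal_nonneg (by positivity)]
  refine ENNReal.ofReal_le_ofReal ?_
  change _ ≤ A.toReal * ν.real univ at h
  -- The double integral is 2ν(univ)∫f² - 2(∫f)², so even A/2 suffices.
  have h2 : ∫ x, f x ^ 2 ∂ν ≤ A.toReal / 2 + (ν.real univ)⁻¹ * (∫ x, f x ∂ν) ^ 2 := by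
    have h3 : A.toReal / 2 + (ν.real univ)⁻¹ * (∫ x, f x ∂ν) ^ 2 =
        (A.toReal * ν.real univ + 2 * (∫ x, f x ∂ν) ^ 2) / (2 * ν.real univ) := by
      field_simp
    rw [h3, le_div_iff₀ (by positivity)]
    linarith
  have := ENNReal.toReal_nonneg (a := A)
  linarith

section Embedding

variable {X : Type*} [PseudoEMetricSpace X] [CompactSpace X] [MeasurableSpace X] [BorelSpace X]

/-- The map from Lipschitz functions to `L²(μ)`. -/
noncomputable def lipschitzToL2 (μ : Measure X) [IsFiniteMeasure μ] :
    lipschitzFunctions X →ₗ[ℝ] Lp ℝ 2 μ where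
  toFun f := (f.2.memLp 2).toLp
  map_add' _ _ := rfl
  map_smul' _ _ := rfl

variable {μ : Measure X} [IsFiniteMeasure μ]

theorem coeFn_lipschitzToL2 (f : lipschitzFunctions X) : lipschitzToL2 μ f =ᵐ[μ] (f : X → ℝ) :=
  MemLp.coeFn_toLp (f.2.memLp 2)

theorem inner_lipschitzToL2 (u : Lp ℝ 2 μ) (f : lipschitzFunctions X) :
    inner ℝ u (lipschitzToL2 μ f) = ∫ x, u x * (f : X → ℝ) x ∂μ := by
  rw [L2.inner_def]
  refine integral_congr_ae ?_
  filter_upwards [coeFn_lipschitzToL2 (μ := μ) f] with x hx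
  rw [hx]
  simp [mul_comm]

theorem norm_sq_lipschitzToL2 (f : lipschitzFunctions X) :
    ‖lipschitzToL2 μ f‖ ^ 2 = ∫ x, (f : X → ℝ) x ^ 2 ∂μ := by
  rw [← real_inner_self_eq_norm_sq, inner_lipschitzToL2]
  refine integral_congr_ae ?_
  filter_upwards [coeFn_lipschitzToL2 (μ := μ) f] with x hx
  rw [hx, sq]

theorem lintegral_sq_enorm_lipschitz (f : lipschitzFunctions X) :
    ∫⁻ x, ‖(f : X → ℝ) x‖ₑ ^ 2 ∂μ = ENNReal.ofReal (‖lipschitzToL2 μ f‖ ^ 2) := by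
  rw [norm_sq_lipschitzToL2, ofReal_integral_eq_lintegral_ofReal (f.2.memLp 2).integrable_sq
      (Eventually.of_forall fun y ↦ sq_nonneg _)]
  refine lintegral_congr fun y ↦ ?_
  rw [← ofReal_norm, ← ENNReal.ofReal_pow (norm_nonneg _), Real.norm_eq_abs, sq_abs]

theorem inner_indicator_lipschitzToL2 {Q : Set X} (hQ : MeasurableSet Q)
    (f : lipschitzFunctions X) :
    inner ℝ (indicatorConstLp 2 hQ (measure_ne_top μ Q) (1 : ℝ)) (lipschitzToL2 μ f) =
      ∫ x in Q, (f : X → ℝ) x ∂μ := by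
  rw [L2.inner_indicatorConstLp_one]
  exact integral_congr_ae (ae_restrict_of_ae (coeFn_lipschitzToL2 f))

end Embedding

variable {n : ℕ} {M : Type*} [MetricSpace M]
    [ChartedSpace (EuclideanSpace ℝ (Fin n)) M] [IsManifold (𝓡 n) ∞ M]
    [RiemannianBundle (fun x : M ↦ TangentSpace (𝓡 n) x)]
    [IsContMDiffRiemannianBundle (𝓡 n) ∞ (EuclideanSpace ℝ (Fin n))
      (fun x : M ↦ TangentSpace (𝓡 n) x)]
    [IsRiemannianManifold (𝓡 n) M] [CompactSpace M] [MeasurableSpace M] [BorelSpace M]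
    {μ : Measure M} [IsFiniteMeasure μ]

/-- On cells of diameter δ the oscillation of f costs only Cδ² ≤ ε times its energy; what is left
are the finitely many cell means, which are inner products with indicator functions. -/
theorem exists_isOpen_lintegral_sq_le (hμ : ∀ p, ∃ r c, IsChartBall n μ p r c) (p : M) :
    ∃ U, IsOpen U ∧ p ∈ U ∧ ∀ ε : ℝ, 0 < ε → ∃ (s : Finset (Lp ℝ 2 μ)) (C : ℝ≥0),
      ∀ f : lipschitzFunctions M, ∫⁻ x in U, ‖(f : M → ℝ) x‖ₑ ^ 2 ∂μ ≤
        ENNReal.ofReal ε * ∫⁻ x, ‖riemannianGradient n f x‖ₑ ^ 2 ∂μ +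
          C * ENNReal.ofReal (∑ h ∈ s, inner ℝ h (lipschitzToL2 μ f) ^ 2) := by
  classical
  obtain ⟨U, hU, hp, C, -, hcells⟩ := exists_cells hμ p
  refine ⟨U, hU, hp, fun ε hε ↦ ?_⟩
  obtain ⟨δ, hδ, hδC⟩ : ∃ δ : ℝ, 0 < δ ∧ C * δ ^ 2 ≤ ε := by
    refine ⟨√(ε / (C + 1)), by positivity, ?_⟩
    rw [Real.sq_sqrt (by positivity), mul_div_assoc', div_le_iff₀ (by positivity)]
    nlinarith [C.2]
  obtain ⟨s, Q, hQm, hQd, hUQ, hQ⟩ := hcells δ hδ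
  let e : (Fin n → ℤ) → Lp ℝ 2 μ := fun i ↦ indicatorConstLp 2 (hQm i) (measure_ne_top μ _) 1
  -- Different null cells give the same class in L², hence the image; each mean is then bounded by
  -- the whole sum. Null cells contribute 0 to the constant, as the inverse of 0 is 0.
  refine ⟨s.image e, (∑ i ∈ s, (μ.real (Q i))⁻¹).toNNReal, fun f ↦ ?_⟩
  have hstep : ∀ i ∈ s, ∫⁻ x in Q i, ‖(f : M → ℝ) x‖ₑ ^ 2 ∂μ ≤
      ENNReal.ofReal ε * ∫⁻ x in Q i, ‖riemannianGradient n f x‖ₑ ^ 2 ∂μ +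
        ENNReal.ofReal ((μ.real (Q i))⁻¹ *
          ∑ h ∈ s.image e, inner ℝ h (lipschitzToL2 μ f) ^ 2) := by
    intro i hi
    have h1 := lintegral_sq_enorm_le_of_lintegral_lintegral_le (ν := μ.restrict (Q i))
      (f := f) ((f.2.memLp 2).restrict _)
      (A := ENNReal.ofReal ε * ∫⁻ x in Q i, ‖riemannianGradient n f x‖ₑ ^ 2 ∂μ) ?_
    · refine h1.trans (add_le_add le_rfl (ENNReal.ofReal_le_ofReal ?_))
      rw [measureReal_restrict_apply_univ]
      refine mul_le_mul_of_nonneg_left ?_ (by positivity)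
      rw [← inner_indicator_lipschitzToL2 (hQm i)]
      exact Finset.single_le_sum (f := fun h ↦ inner ℝ h (lipschitzToL2 μ f) ^ 2)
        (fun h _ ↦ sq_nonneg _) (Finset.mem_image_of_mem e hi)
    · rw [Measure.restrict_apply_univ]
      refine (hQ f f.2 i).trans ?_
      calc _ = (C * ENNReal.ofReal δ ^ 2) *
            (∫⁻ x in Q i, ‖riemannianGradient n f x‖ₑ ^ 2 ∂μ) * μ (Q i) := by ring
        _ ≤ _ := by
          gcongr
          rw [← ENNReal.ofReal_pow hδ.le, ← ENNReal.ofReal_coe_nnreal,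
            ← ENNReal.ofReal_mul (NNReal.coe_nonneg C)]
          exact ENNReal.ofReal_le_ofReal hδC
  have hsum : ∀ g : M → ℝ≥0∞, ∫⁻ x in U, g x ∂μ = ∑ i ∈ s, ∫⁻ x in Q i, g x ∂μ := by
    intro g
    rw [hUQ, lintegral_biUnion_finset (fun i _ j _ hij ↦ hQd hij) fun i _ ↦ hQm i]
  have hS : 0 ≤ ∑ h ∈ s.image e, inner ℝ h (lipschitzToL2 μ f) ^ 2 :=
    Finset.sum_nonneg fun h _ ↦ sq_nonneg _
  calc ∫⁻ x in U, ‖(f : M → ℝ) x‖ₑ ^ 2 ∂μ = ∑ i ∈ s, ∫⁻ x in Q i, ‖(f : M → ℝ) x‖ₑ ^ 2 ∂μ := hsum _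
    _ ≤ ∑ i ∈ s, (ENNReal.ofReal ε * ∫⁻ x in Q i, ‖riemannianGradient n f x‖ₑ ^ 2 ∂μ +
        ENNReal.ofReal ((μ.real (Q i))⁻¹ *
          ∑ h ∈ s.image e, inner ℝ h (lipschitzToL2 μ f) ^ 2)) := Finset.sum_le_sum hstep
    _ = ENNReal.ofReal ε * ∫⁻ x in U, ‖riemannianGradient n f x‖ₑ ^ 2 ∂μ +
          ENNReal.ofReal (∑ i ∈ s, (μ.real (Q i))⁻¹) *
            ENNReal.ofReal (∑ h ∈ s.image e, inner ℝ h (lipschitzToL2 μ f) ^ 2) := by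
        rw [Finset.sum_add_distrib, ← Finset.mul_sum, ← hsum,
          ← ENNReal.ofReal_sum_of_nonneg fun i _ ↦ by positivity, ← Finset.sum_mul,
          ENNReal.ofReal_mul (by positivity)]
    _ ≤ _ := by
        exact add_le_add (mul_le_mul_right (setLIntegral_le_lintegral _ _) _) le_rfl

/-- The Rellich compactness property of the Dirichlet form. -/
theorem norm_sq_lipschitzToL2_le (hμ : ∀ p, ∃ r c, IsChartBall n μ p r c) {ε : ℝ}
    (hε : 0 < ε) : ∃ (s : Finset (Lp ℝ 2 μ)) (C : ℝ),
      ∀ f : lipschitzFunctions M, ‖lipschitzToL2 μ f‖ ^ 2 ≤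
        ε * (‖lipschitzToL2 μ f‖ ^ 2 + energyForm hμ f f) +
          C * ∑ h ∈ s, inner ℝ h (lipschitzToL2 μ f) ^ 2 := by
  classical
  have key : ∀ ε : ℝ, 0 < ε → ∃ (s : Finset (Lp ℝ 2 μ)) (C : ℝ≥0),
      ∀ f : lipschitzFunctions M, ∫⁻ x in univ, ‖(f : M → ℝ) x‖ₑ ^ 2 ∂μ ≤
        ENNReal.ofReal ε * ∫⁻ x, ‖riemannianGradient n f x‖ₑ ^ 2 ∂μ +
          C * ENNReal.ofReal (∑ h ∈ s, inner ℝ h (lipschitzToL2 μ f) ^ 2) := by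
    -- The estimate for every ε passes to unions, because each piece can be given ε/2.
    refine isCompact_univ.induction_on (p := fun A ↦ ∀ ε : ℝ, 0 < ε →
      ∃ (s : Finset (Lp ℝ 2 μ)) (C : ℝ≥0),
      ∀ f : lipschitzFunctions M, ∫⁻ x in A, ‖(f : M → ℝ) x‖ₑ ^ 2 ∂μ ≤
        ENNReal.ofReal ε * ∫⁻ x, ‖riemannianGradient n f x‖ₑ ^ 2 ∂μ +
          C * ENNReal.ofReal (∑ h ∈ s, inner ℝ h (lipschitzToL2 μ f) ^ 2)) ?_ ?_ ?_ ?_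
    · intro ε hε
      exact ⟨∅, 0, fun f ↦ by simp⟩
    · intro A B hAB hB ε hε
      obtain ⟨s, C, h⟩ := hB ε hε
      exact ⟨s, C, fun f ↦ (lintegral_mono_set hAB).trans (h f)⟩
    · intro A B hA hB ε hε
      obtain ⟨s, C, h⟩ := hA (ε / 2) (half_pos hε)
      obtain ⟨t, D, h'⟩ := hB (ε / 2) (half_pos hε)
      refine ⟨s ∪ t, C + D, fun f ↦ (lintegral_union_le _ _ _).trans
        ((add_le_add (h f) (h' f)).trans ?_)⟩
      have h1 : ENNReal.ofReal (∑ h ∈ s, inner ℝ h (lipschitzToL2 μ f) ^ 2) ≤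
          ENNReal.ofReal (∑ h ∈ s ∪ t, inner ℝ h (lipschitzToL2 μ f) ^ 2) :=
        ENNReal.ofReal_le_ofReal (Finset.sum_le_sum_of_subset_of_nonneg
          Finset.subset_union_left fun h _ _ ↦ sq_nonneg _)
      have h2 : ENNReal.ofReal (∑ h ∈ t, inner ℝ h (lipschitzToL2 μ f) ^ 2) ≤
          ENNReal.ofReal (∑ h ∈ s ∪ t, inner ℝ h (lipschitzToL2 μ f) ^ 2) :=
        ENNReal.ofReal_le_ofReal (Finset.sum_le_sum_of_subset_of_nonneg
          Finset.subset_union_right fun h _ _ ↦ sq_nonneg _)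
      have h3 : ENNReal.ofReal ε = ENNReal.ofReal (ε / 2) + ENNReal.ofReal (ε / 2) := by
        rw [← ENNReal.ofReal_add (half_pos hε).le (half_pos hε).le, add_halves]
      rw [h3, ENNReal.coe_add, add_mul, add_mul, add_add_add_comm]
      gcongr
    · intro p _
      obtain ⟨U, hU, hp, h⟩ := exists_isOpen_lintegral_sq_le hμ p
      exact ⟨U, mem_nhdsWithin_of_mem_nhds (hU.mem_nhds hp), h⟩
  obtain ⟨s, C, h⟩ := key ε hε
  refine ⟨s, C, fun f ↦ ?_⟩
  have h1 := h f
  have hS : 0 ≤ ∑ h ∈ s, inner ℝ h (lipschitzToL2 μ f) ^ 2 :=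
    Finset.sum_nonneg fun h _ ↦ sq_nonneg _
  have hE : 0 ≤ dirichletForm n μ f f := dirichletForm_self_nonneg _
  rw [setLIntegral_univ, lintegral_sq_enorm_lipschitz,
    lintegral_sq_enorm_riemannianGradient hμ f.2, ← ENNReal.ofReal_mul hε.le,
    ← ENNReal.ofReal_coe_nnreal, ← ENNReal.ofReal_mul (NNReal.coe_nonneg C),
    ← ENNReal.ofReal_add (by positivity) (by positivity),
    ENNReal.ofReal_le_ofReal_iff (by positivity)] at h1
  have h2 : energyForm hμ f f = dirichletForm n μ f f := rfl
  rw [h2]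
  nlinarith [sq_nonneg ‖lipschitzToL2 μ f‖]

end WeightedManifold

/-! ### The global Poincaré inequality -/

namespace WeightedManifold
set_option linter.unusedSectionVars false

theorem sq_enorm_sub_le (a b c : ℝ) :
    ‖a - c‖ₑ ^ 2 ≤ 2 * ‖a - b‖ₑ ^ 2 + 2 * ‖b - c‖ₑ ^ 2 := by
  have h : ∀ x : ℝ, ‖x‖ₑ ^ 2 = ENNReal.ofReal (x ^ 2) := fun x ↦ by
    rw [← ofReal_norm, ← ENNReal.ofReal_pow (norm_nonneg _), Real.norm_eq_abs, sq_abs]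
  rw [h, h, h, ← mul_add, ← ENNReal.ofReal_add (sq_nonneg _) (sq_nonneg _),
    ← ENNReal.ofReal_ofNat 2, ← ENNReal.ofReal_mul zero_le_two]
  exact ENNReal.ofReal_le_ofReal (by nlinarith [sq_nonneg ((a - b) - (b - c))])

open scoped InnerProductSpace in
/-- A Poincaré inequality for the form `E` passes to weak eigenvectors. -/
theorem norm_sq_sub_inner_sq_le_of_tendsto {L H : Type*} [AddCommGroup L] [Module ℝ L]
    [NormedAddCommGroup H] [InnerProductSpace ℝ H] (ι : L →ₗ[ℝ] H) (E : L →ₗ[ℝ] L →ₗ[ℝ] ℝ)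
    (hsymm : ∀ f g, E f g = E g f) {e : H} {C : ℝ} (hC : 0 ≤ C)
    (hP : ∀ g, ‖ι g‖ ^ 2 - ⟪e, ι g⟫_ℝ ^ 2 ≤ C * E g g) {f : ℕ → L} {u : H} {a : ℝ}
    (hf : Tendsto (fun m ↦ ι (f m)) atTop (𝓝 u))
    (hcauchy : ∀ ε > 0, ∃ N, ∀ l ≥ N, ∀ m ≥ N, E (f l - f m) (f l - f m) < ε)
    (hweak : ∀ φ, Tendsto (fun m ↦ E (f m) φ) atTop (𝓝 (a * ⟪u, ι φ⟫_ℝ))) :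
    ‖u‖ ^ 2 - ⟪e, u⟫_ℝ ^ 2 ≤ C * (a * ‖u‖ ^ 2) := by
  have hv : Tendsto (fun m ↦ ‖ι (f m)‖ ^ 2 - ⟪e, ι (f m)⟫_ℝ ^ 2) atTop
      (𝓝 (‖u‖ ^ 2 - ⟪e, u⟫_ℝ ^ 2)) :=
    (hf.norm.pow 2).sub ((tendsto_const_nhds.inner hf).pow 2)
  -- The limit of E(f_m, f_m) is not given. The Cauchy condition bounds E(f_m, f_m) + E(f_l, f_l) by
  -- 2E(f_m, f_l) + ε, and the weak equation gives the limit of the mixed term: first m → ∞, then l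
  -- → ∞.
  have key : ∀ ε > 0, 2 * (‖u‖ ^ 2 - ⟪e, u⟫_ℝ ^ 2) ≤ C * (2 * (a * ‖u‖ ^ 2) + ε) := by
    intro ε hε
    obtain ⟨N, hN⟩ := hcauchy ε hε
    have h1 : ∀ l ≥ N, (‖u‖ ^ 2 - ⟪e, u⟫_ℝ ^ 2) + (‖ι (f l)‖ ^ 2 - ⟪e, ι (f l)⟫_ℝ ^ 2) ≤
        C * (2 * (a * ⟪u, ι (f l)⟫_ℝ) + ε) := by
      intro l hl
      refine le_of_tendsto_of_tendsto (hv.add_const _)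
        ((((hweak (f l)).const_mul 2).add_const ε).const_mul C) ?_
      filter_upwards [eventually_ge_atTop N] with m hm
      have h2 := hN m hm l hl
      simp only [map_sub, LinearMap.sub_apply] at h2
      rw [hsymm (f l) (f m)] at h2
      have h3 : C * (E (f m) (f m) + E (f l) (f l)) ≤ C * (2 * E (f m) (f l) + ε) :=
          mul_le_mul_of_nonneg_left (by linarith) hC
      linarith [hP (f m), hP (f l)]
    have h4 : Tendsto (fun l ↦ ⟪u, ι (f l)⟫_ℝ) atTop (𝓝 (‖u‖ ^ 2)) := by
      rw [← real_inner_self_eq_norm_sq]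
      exact tendsto_const_nhds.inner hf
    have h5 := le_of_tendsto_of_tendsto (hv.const_add _)
        ((((h4.const_mul a).const_mul 2).add_const ε).const_mul C)
        (eventually_atTop.2 ⟨N, h1⟩)
    linarith
  have h6 : Tendsto (fun ε : ℝ ↦ C * (2 * (a * ‖u‖ ^ 2) + ε)) (𝓝[>] 0)
      (𝓝 (C * (2 * (a * ‖u‖ ^ 2) + 0))) :=
    ((tendsto_id.mono_left nhdsWithin_le_nhds).const_add _).const_mul C
  have h7 := ge_of_tendsto h6 (by filter_upwards [self_mem_nhdsWithin] with ε hε using key ε hε)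
  linarith

variable {n : ℕ} {M : Type*} [MetricSpace M]
    [ChartedSpace (EuclideanSpace ℝ (Fin n)) M] [IsManifold (𝓡 n) ∞ M]
    [RiemannianBundle (fun x : M ↦ TangentSpace (𝓡 n) x)]
    [IsContMDiffRiemannianBundle (𝓡 n) ∞ (EuclideanSpace ℝ (Fin n))
      (fun x : M ↦ TangentSpace (𝓡 n) x)]
    [IsRiemannianManifold (𝓡 n) M] [CompactSpace M] [MeasurableSpace M] [BorelSpace M]
    {μ : Measure M}

/-- The constant m is the value f(x) at a point x where the inner integral of (f(x) - f(y))² does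
not exceed its average over U. -/
theorem exists_isOpen_lintegral_sq_enorm_sub_le [IsFiniteMeasure μ]
    (hμ : ∀ p, ∃ r c, IsChartBall n μ p r c) (p : M) :
    ∃ U, IsOpen U ∧ p ∈ U ∧ ∃ D : ℝ≥0∞, D ≠ ⊤ ∧ ∀ f : M → ℝ, IsLipschitz f → ∃ m : ℝ,
      ∫⁻ x in U, ‖f x - m‖ₑ ^ 2 ∂μ ≤ D * ∫⁻ x, ‖riemannianGradient n f x‖ₑ ^ 2 ∂μ := by
  obtain ⟨U, hU, hp, -, ⟨D, hD⟩, -⟩ := exists_cells hμ p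
  refine ⟨U, hU, hp, D, ENNReal.coe_ne_top, fun f hf ↦ ?_⟩
  have hU0 : μ U ≠ 0 := (measure_pos_of_isOpen hμ hU ⟨p, hp⟩).ne'
  have hm : Measurable fun x ↦ ∫⁻ y in U, ‖f x - f y‖ₑ ^ 2 ∂μ := by
    have h1 : Continuous fun z : M × M ↦ f z.1 - f z.2 := by
      have := hf.continuous
      fun_prop
    exact (h1.measurable.enorm.pow_const 2).lintegral_prod_right'
  obtain ⟨x, -, hx⟩ := exists_le_setLAverage hU0 (measure_ne_top μ U) hm.aemeasurable
  refine ⟨f x, ?_⟩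
  simp only [enorm_sub_rev _ (f x)]
  refine hx.trans ?_
  rw [setLAverage_eq]
  refine ENNReal.div_le_of_le_mul ((hD f hf).trans ?_)
  rw [mul_assoc, mul_assoc, mul_comm (μ U)]
  exact mul_le_mul_right (mul_le_mul_left (setLIntegral_le_lintegral _ _) _) _

/-- The Poincaré inequality. -/
theorem exists_lintegral_sq_enorm_sub_le [ConnectedSpace M] [IsFiniteMeasure μ]
    (hμ : ∀ p, ∃ r c, IsChartBall n μ p r c) :
    ∃ D : ℝ≥0∞, D ≠ ⊤ ∧ ∀ f : M → ℝ, IsLipschitz f → ∃ m : ℝ,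
      ∫⁻ x, ‖f x - m‖ₑ ^ 2 ∂μ ≤ D * ∫⁻ x, ‖riemannianGradient n f x‖ₑ ^ 2 ∂μ := by
  obtain ⟨p₀⟩ : Nonempty M := inferInstance
  obtain ⟨U₀, hU₀, hp₀, D₀, hD₀, h₀⟩ := exists_isOpen_lintegral_sq_enorm_sub_le hμ p₀
  choose! m hm using h₀
  -- The deviation is always measured from the constant belonging to the first neighbourhood U₀. The
  -- points with a neighbourhood satisfying Q form an open and closed set, and compactness then
  -- extends Q to all of M.
  let Q : Set M → Prop := fun A ↦ ∃ D : ℝ≥0∞, D ≠ ⊤ ∧ ∀ f : M → ℝ, IsLipschitz f →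
    ∫⁻ x in A, ‖f x - m f‖ₑ ^ 2 ∂μ ≤ D * ∫⁻ x, ‖riemannianGradient n f x‖ₑ ^ 2 ∂μ
  let S : Set M := {y | ∃ V, IsOpen V ∧ y ∈ V ∧ Q V}
  have hSo : IsOpen S := by
    refine isOpen_iff_mem_nhds.2 fun y ⟨V, hV, hyV, hQ⟩ ↦ ?_
    filter_upwards [hV.mem_nhds hyV] with z hz
    exact ⟨V, hV, hz, hQ⟩
  have hSc : IsClosed S := by
    refine isClosed_of_closure_subset fun y hy ↦ ?_
    obtain ⟨U, hU, hyU, D, hD, h⟩ := exists_isOpen_lintegral_sq_enorm_sub_le hμ y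
    obtain ⟨z, hzU, V, hV, hzV, C, hC, hQ⟩ := mem_closure_iff.1 hy U hU hyU
    have hW : μ (U ∩ V) ≠ 0 := (measure_pos_of_isOpen hμ (hU.inter hV) ⟨z, hzU, hzV⟩).ne'
    refine ⟨U, hU, hyU, 2 * D + 2 * μ U * ((μ (U ∩ V))⁻¹ * (2 * D + 2 * C)), by finiteness,
      fun f hf ↦ ?_⟩
    obtain ⟨m', hm'⟩ := h f hf
    set E := ∫⁻ x, ‖riemannianGradient n f x‖ₑ ^ 2 ∂μ
    have hfm : ∀ c : ℝ, Measurable fun x ↦ ‖f x - c‖ₑ ^ 2 := fun c ↦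
      (hf.continuous.sub continuous_const).measurable.enorm.pow_const 2
    -- The constants of two overlapping neighbourhoods are compared on the overlap, which is open
    -- and so has positive measure.
    have h1 : ‖m' - m f‖ₑ ^ 2 ≤ (μ (U ∩ V))⁻¹ * (2 * D + 2 * C) * E := by
      have h2 : μ (U ∩ V) * ‖m' - m f‖ₑ ^ 2 ≤ (2 * D + 2 * C) * E := by
        calc μ (U ∩ V) * ‖m' - m f‖ₑ ^ 2 = ∫⁻ x in U ∩ V, ‖m' - m f‖ₑ ^ 2 ∂μ := by
              rw [setLIntegral_const, mul_comm]
          _ ≤ ∫⁻ x in U ∩ V, (2 * ‖f x - m'‖ₑ ^ 2 + 2 * ‖f x - m f‖ₑ ^ 2) ∂μ := by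
              refine lintegral_mono fun x ↦ ?_
              have := sq_enorm_sub_le m' (f x) (m f)
              rwa [enorm_sub_rev m' (f x)] at this
          _ = 2 * ∫⁻ x in U ∩ V, ‖f x - m'‖ₑ ^ 2 ∂μ +
                2 * ∫⁻ x in U ∩ V, ‖f x - m f‖ₑ ^ 2 ∂μ := by
              rw [lintegral_add_left ((hfm _).const_mul _), lintegral_const_mul _ (hfm _),
                lintegral_const_mul _ (hfm _)]
          _ ≤ 2 * (D * E) + 2 * (C * E) := by
              gcongr
              · exact (lintegral_mono_set inter_subset_left).trans hm'
              · exact (lintegral_mono_set inter_subset_right).trans (hQ f hf)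
          _ = _ := by ring
      rw [mul_assoc]
      rwa [mul_comm, ← ENNReal.le_div_iff_mul_le (Or.inl hW) (Or.inl (measure_ne_top _ _)),
        ENNReal.div_eq_inv_mul] at h2
    calc ∫⁻ x in U, ‖f x - m f‖ₑ ^ 2 ∂μ
        ≤ ∫⁻ x in U, (2 * ‖f x - m'‖ₑ ^ 2 + 2 * ‖m' - m f‖ₑ ^ 2) ∂μ :=
          lintegral_mono fun x ↦ sq_enorm_sub_le _ _ _
      _ = 2 * ∫⁻ x in U, ‖f x - m'‖ₑ ^ 2 ∂μ + 2 * ‖m' - m f‖ₑ ^ 2 * μ U := by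
          rw [lintegral_add_left ((hfm _).const_mul _), lintegral_const_mul _ (hfm _),
            setLIntegral_const]
      _ ≤ 2 * (D * E) + 2 * ((μ (U ∩ V))⁻¹ * (2 * D + 2 * C) * E) * μ U := by gcongr
      _ = _ := by ring
  have hSu : S = univ := IsClopen.eq_univ ⟨hSc, hSo⟩ ⟨p₀, U₀, hU₀, hp₀, D₀, hD₀, hm⟩
  have hQ : Q univ := by
    refine isCompact_univ.induction_on (p := Q) ⟨0, by simp, fun f _ ↦ by simp⟩ ?_ ?_ ?_
    · rintro A B hAB ⟨D, hD, h⟩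
      exact ⟨D, hD, fun f hf ↦ (lintegral_mono_set hAB).trans (h f hf)⟩
    · rintro A B ⟨D, hD, h⟩ ⟨D', hD', h'⟩
      refine ⟨D + D', by finiteness, fun f hf ↦ (lintegral_union_le _ _ _).trans ?_⟩
      rw [add_mul]
      exact add_le_add (h f hf) (h' f hf)
    · intro y _
      obtain ⟨V, hV, hyV, hQ⟩ : y ∈ S := hSu ▸ mem_univ y
      exact ⟨V, mem_nhdsWithin_of_mem_nhds (hV.mem_nhds hyV), hQ⟩
  obtain ⟨D, hD, h⟩ := hQ
  exact ⟨D, hD, fun f hf ↦ ⟨m f, by rw [← setLIntegral_univ]; exact h f hf⟩⟩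

end WeightedManifold

/-! ### Eigenvalues: spectral gap, min-max bound and positivity -/

namespace WeightedManifold
set_option linter.unusedSectionVars false

variable {n : ℕ} {M : Type*} [MetricSpace M]
    [ChartedSpace (EuclideanSpace ℝ (Fin n)) M] [IsManifold (𝓡 n) ∞ M]
    [RiemannianBundle (fun x : M ↦ TangentSpace (𝓡 n) x)]
    [IsContMDiffRiemannianBundle (𝓡 n) ∞ (EuclideanSpace ℝ (Fin n))
      (fun x : M ↦ TangentSpace (𝓡 n) x)]
    [IsRiemannianManifold (𝓡 n) M] [CompactSpace M] [MeasurableSpace M] [BorelSpace M]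
    {μ : Measure M}

/-- The constant function `1`. -/
def lipschitzOne (X : Type*) [PseudoEMetricSpace X] : lipschitzFunctions X :=
  ⟨fun _ ↦ 1, isLipschitz_const 1⟩

theorem norm_lipschitzToL2_one [IsProbabilityMeasure μ] : ‖lipschitzToL2 μ (lipschitzOne M)‖ = 1 := by
  have h : ‖lipschitzToL2 μ (lipschitzOne M)‖ ^ 2 = 1 := by
    rw [norm_sq_lipschitzToL2]
    simp [lipschitzOne]
  exact (pow_eq_one_iff_of_nonneg (norm_nonneg _) two_ne_zero).1 h

theorem dirichletForm_one_right (f : M → ℝ) :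
    dirichletForm n μ f (lipschitzOne M : lipschitzFunctions M) = 0 := by
  have h : ∀ x, riemannianGradient n (lipschitzOne M : M → ℝ) x = 0 := fun x ↦
    riemannianGradient_eq_zero_of_isLocalMin (Eventually.of_forall fun y ↦ le_rfl)
  simp [dirichletForm, h]

theorem tendsto_lipschitzToL2_iff [IsFiniteMeasure μ] {u : Lp ℝ 2 μ} {f : ℕ → lipschitzFunctions M} :
    Tendsto (fun m ↦ lipschitzToL2 μ (f m)) atTop (𝓝 u) ↔
      Tendsto (fun m ↦ eLpNorm (fun x ↦ (f m : M → ℝ) x - u x) 2 μ) atTop (𝓝 0) := by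
  rw [Lp.tendsto_Lp_iff_tendsto_eLpNorm']
  refine tendsto_congr fun m ↦ eLpNorm_congr_ae ?_
  filter_upwards [coeFn_lipschitzToL2 (μ := μ) (f m)] with x hx
  simp [hx]

variable (M) in
theorem infinite_of_pos (hn : 0 < n) [Nonempty M] : Infinite M := by
  obtain ⟨p⟩ := ‹Nonempty M›
  have : Nonempty (Fin n) := ⟨⟨0, hn⟩⟩
  have h1 : (extChartAt (𝓡 n) p).target.Infinite :=
    infinite_of_mem_nhds _ (extChartAt_target_mem_nhds (I := 𝓡 n) p)
  have h2 := h1.image (extChartAt (𝓡 n) p).symm.injOn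
  exact Set.infinite_univ_iff.1 (h2.mono (subset_univ _))

/-- At every point one of the two functions vanishes, hence has a minimum there and zero gradient.
-/
theorem dirichletForm_eq_zero {f g : M → ℝ} (hf : ∀ x, 0 ≤ f x)
    (hg : ∀ x, 0 ≤ g x) (hfg : ∀ x, f x * g x = 0) :
    dirichletForm n μ f g = 0 := by
  have h : ∀ x, (inner ℝ (riemannianGradient n f x) (riemannianGradient n g x) : ℝ) = 0 := by
    intro x
    rcases mul_eq_zero.1 (hfg x) with h | h
    · rw [riemannianGradient_eq_zero_of_isLocalMin (f := f)
        (Eventually.of_forall fun y ↦ h ▸ hf y), inner_zero_left]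
    · rw [riemannianGradient_eq_zero_of_isLocalMin (f := g)
        (Eventually.of_forall fun y ↦ h ▸ hg y), inner_zero_right]
  simp [dirichletForm, h]

variable [IsProbabilityMeasure μ] (hμ : ∀ p, ∃ r c, IsChartBall n μ p r c)
include hμ

/-- Among constants the mean is the closest one to f in L², so the Poincaré inequality for some
constant m implies the one for the mean. -/
theorem exists_norm_sq_sub_inner_sq_le [ConnectedSpace M] :
    ∃ C > 0, ∀ f : lipschitzFunctions M, ‖lipschitzToL2 μ f‖ ^ 2 -
      inner ℝ (lipschitzToL2 μ (lipschitzOne M)) (lipschitzToL2 μ f) ^ 2 ≤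
        C * energyForm hμ f f := by
  obtain ⟨D, hD, h⟩ := exists_lintegral_sq_enorm_sub_le hμ
  refine ⟨D.toReal + 1, by positivity, fun f ↦ ?_⟩
  obtain ⟨m, hm⟩ := h f f.2
  have hE : 0 ≤ dirichletForm n μ f f := dirichletForm_self_nonneg _
  have h1 := lintegral_sq_enorm_lipschitz (μ := μ) (f - m • lipschitzOne M)
  have h2 : ∀ x, (f : M → ℝ) x - m = ((f - m • lipschitzOne M : lipschitzFunctions M) : M → ℝ) x :=
    fun x ↦ by simp [lipschitzOne]
  simp only [h2] at hm
  rw [h1, lintegral_sq_enorm_riemannianGradient hμ f.2, ← ENNReal.ofReal_toReal hD,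
    ← ENNReal.ofReal_mul ENNReal.toReal_nonneg, ENNReal.ofReal_le_ofReal_iff (by positivity),
    map_sub, map_smul, norm_sub_sq_real, norm_smul, norm_lipschitzToL2_one, inner_smul_right,
    real_inner_comm] at hm
  have h3 : energyForm hμ f f = dirichletForm n μ f f := rfl
  rw [h3]
  rw [mul_one, Real.norm_eq_abs, sq_abs] at hm
  nlinarith [sq_nonneg (m - inner ℝ (lipschitzToL2 μ (lipschitzOne M)) (lipschitzToL2 μ f))]

theorem isWeakEigenfunction_iff {a : ℝ} {u : Lp ℝ 2 μ} : IsWeakEigenfunction n μ a u ↔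
    ∃ f : ℕ → lipschitzFunctions M, Tendsto (fun m ↦ lipschitzToL2 μ (f m)) atTop (𝓝 u) ∧
      (∀ ε > 0, ∃ N, ∀ l ≥ N, ∀ m ≥ N, energyForm hμ (f l - f m) (f l - f m) < ε) ∧
      ∀ φ, Tendsto (fun m ↦ energyForm hμ (f m) φ) atTop
        (𝓝 (a * inner ℝ u (lipschitzToL2 μ φ))) := by
  constructor
  · rintro ⟨f, hf, hw⟩
    refine ⟨fun m ↦ ⟨f m, hf.lipschitz m⟩, tendsto_lipschitzToL2_iff.2 hf.tendsto, ?_, ?_⟩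
    · intro ε hε
      obtain ⟨N, hN⟩ := hf.cauchy ε hε
      refine ⟨N, fun l hl m hm ↦ ?_⟩
      have := hN l hl m hm
      rwa [integral_sq_norm_riemannianGradient_sub hμ (hf.lipschitz l) (hf.lipschitz m)] at this
    · intro φ
      rw [inner_lipschitzToL2]
      exact hw φ φ.2
  · rintro ⟨f, hf, hc, hw⟩
    refine ⟨fun m ↦ f m, ⟨fun m ↦ (f m).2, tendsto_lipschitzToL2_iff.1 hf, ?_⟩, ?_⟩
    · intro ε hε
      obtain ⟨N, hN⟩ := hc ε hε
      refine ⟨N, fun l hl m hm ↦ ?_⟩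
      rw [integral_sq_norm_riemannianGradient_sub hμ (f l).2 (f m).2]
      exact hN l hl m hm
    · intro φ hφ
      have := hw ⟨φ, hφ⟩
      rwa [inner_lipschitzToL2] at this

/-- Weak eigenfunctions with a small eigenvalue are constant. -/
theorem exists_pos_of_isWeakEigenfunction [ConnectedSpace M] :
    ∃ c > 0, ∀ (a : ℝ) (u : Lp ℝ 2 μ), IsWeakEigenfunction n μ a u → a < c →
      ∃ t : ℝ, u = t • lipschitzToL2 μ (lipschitzOne M) := by
  obtain ⟨C, hC, hP⟩ := exists_norm_sq_sub_inner_sq_le hμ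
  refine ⟨C⁻¹, inv_pos.2 hC, fun a u hu ha ↦ ?_⟩
  obtain ⟨f, hf, hc, hw⟩ := (isWeakEigenfunction_iff hμ).1 hu
  set e := lipschitzToL2 μ (lipschitzOne M) with he
  have h1 := norm_sq_sub_inner_sq_le_of_tendsto (lipschitzToL2 μ) (energyForm hμ)
    (fun f g ↦ dirichletForm_comm _ _) hC.le hP hf hc hw
  -- Testing the equation with the constant 1 leaves two cases: a = 0, where the Poincaré bound
  -- vanishes, or mean zero, where ‖u‖² ≤ C a ‖u‖² with C a < 1.
  have h2 : a * inner ℝ u e = 0 := by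
    refine tendsto_nhds_unique (hw (lipschitzOne M)) ?_
    have : ∀ m, energyForm hμ (f m) (lipschitzOne M) = 0 := fun m ↦ dirichletForm_one_right _
    simp [this]
  have h3 : C * a < 1 := by
    rw [← mul_inv_cancel₀ hC.ne']
    exact mul_lt_mul_of_pos_left ha hC
  have h4 : ‖u‖ ^ 2 - inner ℝ e u ^ 2 ≤ 0 := by
    rcases mul_eq_zero.1 h2 with h | h
    · simpa [h] using h1
    · rw [real_inner_comm] at h
      rw [h] at h1 ⊢
      nlinarith [sq_nonneg ‖u‖]
  refine ⟨inner ℝ e u, ?_⟩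
  have h5 : ‖u - (inner ℝ e u : ℝ) • e‖ ^ 2 = ‖u‖ ^ 2 - inner ℝ e u ^ 2 := by
    rw [norm_sub_sq_real, norm_smul, he, norm_lipschitzToL2_one, ← he, inner_smul_right,
      real_inner_comm e u, mul_one, Real.norm_eq_abs, sq_abs]
    ring
  have h6 : ‖u - (inner ℝ e u : ℝ) • e‖ = 0 := by
    refine pow_eq_zero_iff two_ne_zero |>.1 (le_antisymm ?_ (sq_nonneg _))
    rw [h5]
    exact h4
  exact sub_eq_zero.1 (norm_eq_zero.1 h6)

/-- Eigenfunctions below the gap all lie on the line of constants, which has no room for two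
independent ones. This bounds from below the set whose infimum is λ_k. -/
theorem exists_pos_le_of_linearIndependent [ConnectedSpace M] :
    ∃ c > 0, ∀ k, 1 ≤ k → ∀ (b : ℝ) (u : Fin (k + 1) → Lp ℝ 2 μ), LinearIndependent ℝ u →
      (∀ i, ∃ a ≤ b, IsWeakEigenfunction n μ a (u i)) → c ≤ b := by
  obtain ⟨c, hc, h⟩ := exists_pos_of_isWeakEigenfunction hμ
  refine ⟨c, hc, fun k hk b u hu hb ↦ ?_⟩
  by_contra! hcon
  have h' : ∀ i, ∃ t : ℝ, u i = t • lipschitzToL2 μ (lipschitzOne M) := by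
    intro i
    obtain ⟨a, ha, hai⟩ := hb i
    exact h a _ hai (ha.trans_lt hcon)
  have hne : (0 : Fin (k + 1)) ≠ Fin.last k := by
    rw [Ne, Fin.ext_iff]
    simp only [Fin.val_zero, Fin.val_last]
    omega
  obtain ⟨s, hs⟩ := h' 0
  obtain ⟨t, ht⟩ := h' (Fin.last k)
  have hpair : LinearIndependent ℝ ![u 0, u (Fin.last k)] := by
    convert hu.comp ![0, Fin.last k] (by
      simp [Function.Injective, Fin.forall_fin_two]
      omega) using 1
    ext i
    fin_cases i <;> rfl
  have h2 := LinearIndependent.pair_iff.1 hpair t (-s) (by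
    rw [hs, ht, smul_smul, smul_smul, ← add_smul, mul_comm t s, neg_mul, add_neg_cancel, zero_smul])
  refine hu.ne_zero (Fin.last k) ?_
  rw [ht, h2.1, zero_smul]

theorem eigenvalue_le [ConnectedSpace M] {k : ℕ} (hk : 1 ≤ k) {b : ℝ} {u : Fin (k + 1) → Lp ℝ 2 μ}
    (hu : LinearIndependent ℝ u) (hb : ∀ i, ∃ a ≤ b, IsWeakEigenfunction n μ a (u i)) :
    eigenvalue n μ k ≤ b := by
  obtain ⟨c, hc, h⟩ := exists_pos_le_of_linearIndependent hμ
  exact csInf_le ⟨c, fun b' ⟨v, hv, hv'⟩ ↦ h k hk b' v hv hv'⟩ ⟨u, hu, hb⟩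

/-- Disjointly supported functions with small Rayleigh quotients produce eigenvalues. -/
theorem exists_linearIndependent_isWeakEigenfunction {k : ℕ} {b : ℝ} (hb : 0 ≤ b)
    (g : Fin (k + 1) → lipschitzFunctions M) (hg : ∀ i x, 0 ≤ (g i : M → ℝ) x)
    (hgg : ∀ i j, i ≠ j → ∀ x, (g i : M → ℝ) x * (g j : M → ℝ) x = 0)
    (hpos : ∀ i, 0 < ∫ x, (g i : M → ℝ) x ^ 2 ∂μ)
    (hgb : ∀ i, dirichletForm n μ (g i) (g i) ≤ b * ∫ x, (g i : M → ℝ) x ^ 2 ∂μ) :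
    ∃ u : Fin (k + 1) → Lp ℝ 2 μ, LinearIndependent ℝ u ∧
      ∀ i, ∃ a ≤ b, IsWeakEigenfunction n μ a (u i) := by
  have hE : ∀ i j, i ≠ j → energyForm hμ (g i) (g j) = 0 := fun i j hij ↦
    dirichletForm_eq_zero (hg i) (hg j) (hgg i j hij)
  have hι : ∀ i j, i ≠ j → inner ℝ (lipschitzToL2 μ (g i)) (lipschitzToL2 μ (g j)) = (0 : ℝ) := by
    intro i j hij
    rw [inner_lipschitzToL2, ← integral_zero M ℝ (μ := μ)]
    refine integral_congr_ae ?_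
    filter_upwards [coeFn_lipschitzToL2 (μ := μ) (g i)] with x hx
    rw [hx, hgg i j hij]
  have hli : LinearIndependent ℝ (lipschitzToL2 μ ∘ g) := by
    refine linearIndependent_of_ne_zero_of_inner_eq_zero (fun i h0 ↦ ?_) fun i j hij ↦ hι i j hij
    have := hpos i
    rw [← norm_sq_lipschitzToL2] at this
    simp only [Function.comp_apply] at h0
    simp [h0] at this
  have hsum1 : ∀ c : Fin (k + 1) → ℝ, energyForm hμ (∑ i, c i • g i) (∑ i, c i • g i) =
      ∑ i, c i ^ 2 * energyForm hμ (g i) (g i) := by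
    intro c
    simp only [map_sum, map_smul, LinearMap.sum_apply, LinearMap.smul_apply, smul_eq_mul]
    refine Finset.sum_congr rfl fun i _ ↦ ?_
    rw [Finset.sum_eq_single i]
    · ring
    · intro j _ hji
      simp [hE j i hji]
    · simp
  have hsum2 : ∀ c : Fin (k + 1) → ℝ, ‖lipschitzToL2 μ (∑ i, c i • g i)‖ ^ 2 =
      ∑ i, c i ^ 2 * ‖lipschitzToL2 μ (g i)‖ ^ 2 := by
    intro c
    rw [← real_inner_self_eq_norm_sq]
    simp only [map_sum, map_smul, sum_inner, inner_sum, inner_smul_left, inner_smul_right,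
      RCLike.conj_to_real]
    refine Finset.sum_congr rfl fun i _ ↦ ?_
    rw [Finset.sum_eq_single i]
    · rw [real_inner_self_eq_norm_sq]
      ring
    · intro j _ hji
      simp [hι j i hji]
    · simp
  obtain ⟨u, hu, h⟩ := exists_linearIndependent_weak_eigenvectors (lipschitzToL2 μ) (energyForm hμ)
    (fun f g ↦ dirichletForm_comm _ _) (fun f ↦ dirichletForm_self_nonneg _)
    (fun ε hε ↦ norm_sq_lipschitzToL2_le hμ hε) hb g hli (fun c ↦ by
      rw [hsum1, hsum2, Finset.mul_sum]
      refine Finset.sum_le_sum fun i _ ↦ ?_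
      rw [mul_left_comm]
      refine mul_le_mul_of_nonneg_left ?_ (sq_nonneg _)
      rw [norm_sq_lipschitzToL2]
      exact hgb i)
  refine ⟨u, hu, fun i ↦ ?_⟩
  obtain ⟨a, ha, f, hf⟩ := h i
  exact ⟨a, ha, (isWeakEigenfunction_iff hμ).2 ⟨f, hf⟩⟩

/-- The infimum of the empty set of reals is 0, so admissible families must be exhibited: cones over
small disjoint balls around k + 1 distinct points, which exist because n > 0. -/
theorem eigenvalue_pos [ConnectedSpace M] (hn : 0 < n) {k : ℕ} (hk : 1 ≤ k) :
    0 < eigenvalue n μ k := by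
  obtain ⟨c, hc, h⟩ := exists_pos_le_of_linearIndependent hμ
  refine hc.trans_le (le_csInf ?_ fun b ⟨u, hu, hb⟩ ↦ h k hk b u hu hb)
  have := infinite_of_pos (n := n) M hn
  let p : Fin (k + 1) → M := fun i ↦ Infinite.natEmbedding M i
  have hp : Function.Injective p := (Infinite.natEmbedding M).injective.comp Fin.val_injective
  obtain ⟨d, hd, hdp⟩ : ∃ d > 0, ∀ i j, i ≠ j → d ≤ dist (p i) (p j) := by
    have : Nonempty {q : Fin (k + 1) × Fin (k + 1) // q.1 ≠ q.2} := by
      refine ⟨⟨(0, Fin.last k), ?_⟩⟩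
      rw [Ne, Fin.ext_iff]
      simp only [Fin.val_zero, Fin.val_last]
      omega
    obtain ⟨q, hq⟩ := Finite.exists_min
      fun q : {q : Fin (k + 1) × Fin (k + 1) // q.1 ≠ q.2} ↦ dist (p q.1.1) (p q.1.2)
    exact ⟨_, dist_pos.2 (hp.ne q.2), fun i j hij ↦ hq ⟨(i, j), hij⟩⟩
  -- The radius d/2 is half the least distance between the points, so the supports are essentially
  -- disjoint.
  let g : Fin (k + 1) → lipschitzFunctions M := fun i ↦
    ⟨fun x ↦ max (d / 2 - dist x (p i)) 0,
      ⟨_, ((LipschitzWith.const (d / 2)).sub (LipschitzWith.dist_left (p i))).max_const 0⟩⟩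
  have hpos : ∀ i, 0 < ∫ x, (g i : M → ℝ) x ^ 2 ∂μ := by
    intro i
    have : μ.IsOpenPosMeasure := ⟨fun U hU hne ↦ (measure_pos_of_isOpen hμ hU hne).ne'⟩
    refine ((g i).2.continuous.pow 2).integral_pos_of_hasCompactSupport_nonneg_nonzero
      (HasCompactSupport.of_compactSpace _) (fun x ↦ sq_nonneg _) (x := p i) ?_
    have : (g i : M → ℝ) (p i) = d / 2 := by
      simp only [g, dist_self, sub_zero]
      exact max_eq_left (by positivity)
    rw [this]
    positivity
  have hgg : ∀ i j, i ≠ j → ∀ x, (g i : M → ℝ) x * (g j : M → ℝ) x = 0 := by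
    intro i j hij x
    have h1 := hdp i j hij
    have h2 := dist_triangle_left (p i) (p j) x
    rcases le_total (d / 2) (dist x (p i)) with h3 | h3
    · simp only [g]
      rw [max_eq_right (by linarith), zero_mul]
    · simp only [g]
      rw [max_eq_right (a := d / 2 - dist x (p j)) (by linarith), mul_zero]
  obtain ⟨b, hb, hgb⟩ : ∃ b, 0 ≤ b ∧ ∀ i,
      dirichletForm n μ (g i) (g i) ≤ b * ∫ x, (g i : M → ℝ) x ^ 2 ∂μ := by
    refine ⟨∑ i, dirichletForm n μ (g i) (g i) / ∫ x, (g i : M → ℝ) x ^ 2 ∂μ,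
      Finset.sum_nonneg fun i _ ↦ div_nonneg (dirichletForm_self_nonneg _) (hpos i).le, fun i ↦ ?_⟩
    rw [← div_le_iff₀ (hpos i)]
    exact Finset.single_le_sum (f := fun i ↦ dirichletForm n μ (g i) (g i) /
      ∫ x, (g i : M → ℝ) x ^ 2 ∂μ)
      (fun i _ ↦ div_nonneg (dirichletForm_self_nonneg _) (hpos i).le) (Finset.mem_univ i)
  obtain ⟨u, hu, h⟩ := exists_linearIndependent_isWeakEigenfunction hμ hb g
    (fun i x ↦ le_max_right _ _) hgg hpos hgb
  exact ⟨b, u, hu, h⟩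

end WeightedManifold

/-! ### The coarea inequality -/

namespace WeightedManifold
set_option linter.unusedSectionVars false

section BallSup

variable {X : Type*} [MetricSpace X]

/-- The supremum of `h` over the balls of radius `r`. -/
noncomputable def ballSup (h : X → ℝ) (r : ℝ) (x : X) : ℝ := sSup (h '' Metric.ball x r)

theorem bddAbove_image_ball {h : X → ℝ} {K : ℝ≥0} (hK : LipschitzWith K h) (r : ℝ) (x : X) :
    h x + K * r ∈ upperBounds (h '' Metric.ball x r) := by
  rintro _ ⟨y, hy, rfl⟩
  have h1 := (le_abs_self _).trans (hK.dist_le_mul y x)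
  have h2 : K * dist y x ≤ K * r := mul_le_mul_of_nonneg_left (Metric.mem_ball.1 hy).le K.2
  linarith

theorem le_ballSup {h : X → ℝ} {K : ℝ≥0} (hK : LipschitzWith K h) {r : ℝ} (hr : 0 < r) (x : X) :
    h x ≤ ballSup h r x :=
  le_csSup ⟨_, bddAbove_image_ball hK r x⟩ (mem_image_of_mem h (Metric.mem_ball_self hr))

theorem ballSup_le {h : X → ℝ} {r : ℝ} (hr : 0 < r) {x : X} {a : ℝ}
    (ha : ∀ y, dist y x < r → h y ≤ a) : ballSup h r x ≤ a :=
  csSup_le ((Metric.nonempty_ball.2 hr).image h) (by rintro _ ⟨y, hy, rfl⟩; exact ha y hy)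

/-- Makes the neighbourhood of a superlevel set a superlevel set again, so that the layer cake
formula applies to both measures in the boundary quotient. -/
theorem thickening_setOf_lt {h : X → ℝ} {K : ℝ≥0} (hK : LipschitzWith K h) {r : ℝ} (hr : 0 < r)
    (s : ℝ) : Metric.thickening r {x | s < h x} = {x | s < ballSup h r x} := by
  ext x
  rw [Metric.mem_thickening_iff, mem_ofPred_eq, ballSup,
    lt_csSup_iff ⟨_, bddAbove_image_ball hK r x⟩ ((Metric.nonempty_ball.2 hr).image h)]
  constructor
  · rintro ⟨z, hz, hxz⟩
    exact ⟨h z, ⟨z, Metric.mem_ball'.2 hxz, rfl⟩, hz⟩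
  · rintro ⟨_, ⟨z, hz, rfl⟩, hsz⟩
    exact ⟨z, hsz, Metric.mem_ball'.1 hz⟩

variable [MeasurableSpace X] [BorelSpace X]

theorem measurable_ballSup {h : X → ℝ} {K : ℝ≥0} (hK : LipschitzWith K h) {r : ℝ} (hr : 0 < r) :
    Measurable (ballSup h r) := by
  refine measurable_of_Ioi fun s ↦ ?_
  have := thickening_setOf_lt hK hr s
  change MeasurableSet {x | s < ballSup h r x}
  rw [← this]
  exact Metric.isOpen_thickening.measurableSet

theorem measurable_measure_setOf_lt (μ : Measure X) (h : X → ℝ) :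
    Measurable fun s : ℝ ↦ μ {x | s < h x} :=
  Antitone.measurable fun _ _ hst ↦ measure_mono fun _ hx ↦ hst.trans_lt hx

variable [CompactSpace X] {μ : Measure X} [IsFiniteMeasure μ]

theorem lintegral_measure_thickening_sub_le {h : X → ℝ} {K : ℝ≥0} (hK : LipschitzWith K h)
    (h0 : ∀ x, 0 ≤ h x) {r : ℝ} (hr : 0 < r) :
    ∫⁻ s in Ioi 0, (μ (Metric.thickening r {x | s < h x}) - μ {x | s < h x}) ≤
      ∫⁻ x, ENNReal.ofReal (ballSup h r x - h x) ∂μ := by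
  have hfin : ∫⁻ x, ENNReal.ofReal (h x) ∂μ ≠ ⊤ := by
    have h1 : Integrable h μ := (IsLipschitz.memLp ⟨K, hK⟩ 1).integrable le_rfl
    rw [← ofReal_integral_eq_lintegral_ofReal h1 (Eventually.of_forall h0)]
    exact ENNReal.ofReal_ne_top
  have hlay : ∫⁻ s in Ioi 0, μ {x | s < h x} = ∫⁻ x, ENNReal.ofReal (h x) ∂μ :=
    (lintegral_eq_lintegral_meas_lt μ (Eventually.of_forall h0)
      hK.continuous.measurable.aemeasurable).symm
  have hlay' : ∫⁻ s in Ioi 0, μ {x | s < ballSup h r x} =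
      ∫⁻ x, ENNReal.ofReal (ballSup h r x) ∂μ :=
    (lintegral_eq_lintegral_meas_lt μ
      (Eventually.of_forall fun x ↦ (h0 x).trans (le_ballSup hK hr x))
      (measurable_ballSup hK hr).aemeasurable).symm
  simp only [thickening_setOf_lt hK hr]
  rw [lintegral_sub (measurable_measure_setOf_lt μ h) (hlay ▸ hfin), hlay, hlay',
    tsub_le_iff_right, ← lintegral_add_right _ hK.continuous.measurable.ennreal_ofReal]
  · refine lintegral_mono fun x ↦ ?_
    rw [← ENNReal.ofReal_add (sub_nonneg.2 (le_ballSup hK hr x)) (h0 x), sub_add_cancel]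
  · exact Eventually.of_forall fun s ↦ measure_mono fun x hx ↦ hx.trans_le (le_ballSup hK hr x)

end BallSup

variable {n : ℕ} {M : Type*} [MetricSpace M]
    [ChartedSpace (EuclideanSpace ℝ (Fin n)) M] [IsManifold (𝓡 n) ∞ M]
    [RiemannianBundle (fun x : M ↦ TangentSpace (𝓡 n) x)]
    [IsContMDiffRiemannianBundle (𝓡 n) ∞ (EuclideanSpace ℝ (Fin n))
      (fun x : M ↦ TangentSpace (𝓡 n) x)]
    [IsRiemannianManifold (𝓡 n) M] [CompactSpace M] [MeasurableSpace M] [BorelSpace M]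
    {μ : Measure M} [IsFiniteMeasure μ]

/-- Near x the function rises by at most (|∇h(x)| + δ)·r on a ball of radius r. -/
theorem limsup_ballSup_sub_le {h : M → ℝ} {x : M}
    (hx : MDifferentiableAt (𝓡 n) 𝓘(ℝ, ℝ) h x) :
    limsup (fun j : ℕ ↦ ENNReal.ofReal (ballSup h (1 / (j + 1)) x - h x) /
      ENNReal.ofReal (1 / (j + 1))) atTop ≤ ‖riemannianGradient n h x‖ₑ := by
  refine ENNReal.le_of_forall_pos_le_add fun δ hδ _ ↦ ?_
  have h1 := eventually_abs_sub_le_dist hx (NNReal.coe_pos.2 hδ)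
  obtain ⟨ε, hε, hball⟩ := Metric.eventually_nhds_iff.1 h1
  refine limsup_le_of_le (by isBoundedDefault) ?_
  have h2 : ∀ᶠ j : ℕ in atTop, 1 / ((j : ℝ) + 1) < ε :=
    tendsto_one_div_add_atTop_nhds_zero_nat.eventually_lt_const hε
  filter_upwards [h2] with j hj
  have hr : 0 < 1 / ((j : ℝ) + 1) := Nat.one_div_pos_of_nat
  have hN : 0 ≤ ‖riemannianGradient n h x‖ + δ := by positivity
  have h3 : ballSup h (1 / (j + 1)) x ≤
      h x + (‖riemannianGradient n h x‖ + δ) * (1 / (j + 1)) := by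
    refine ballSup_le hr fun y hy ↦ ?_
    have h4 := (le_abs_self _).trans (hball (hy.trans hj))
    have h5 : (‖riemannianGradient n h x‖ + δ) * dist x y ≤
        (‖riemannianGradient n h x‖ + δ) * (1 / (j + 1)) := by
      rw [dist_comm]
      exact mul_le_mul_of_nonneg_left hy.le hN
    linarith
  rw [← ENNReal.ofReal_div_of_pos hr]
  have h6 : (ballSup h (1 / (j + 1)) x - h x) / (1 / (j + 1)) ≤
      ‖riemannianGradient n h x‖ + δ := by
    rw [div_le_iff₀ hr]
    linarith
  refine (ENNReal.ofReal_le_ofReal h6).trans ?_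
  rw [ENNReal.ofReal_add (norm_nonneg _) (NNReal.coe_nonneg δ), ofReal_norm, ENNReal.ofReal_coe_nnreal]

/-- The coarea inequality. -/
theorem lintegral_boundaryMeasure_le (hμ : ∀ p, ∃ r c, IsChartBall n μ p r c) {h : M → ℝ}
    (hh : IsLipschitz h) (h0 : ∀ x, 0 ≤ h x) :
    ∫⁻ s in Ioi 0, boundaryMeasure μ {x | s < h x} ≤ ∫⁻ x, ‖riemannianGradient n h x‖ₑ ∂μ := by
  have hd := ae_mdifferentiableAt hμ hh
  obtain ⟨K, hK⟩ := hh
  have hr : ∀ j : ℕ, 0 < 1 / ((j : ℝ) + 1) := fun j ↦ Nat.one_div_pos_of_nat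
  have hr0 : Tendsto (fun j : ℕ ↦ 1 / ((j : ℝ) + 1)) atTop (𝓝[>] 0) :=
    tendsto_nhdsWithin_iff.2 ⟨tendsto_one_div_add_atTop_nhds_zero_nat, Eventually.of_forall hr⟩
  let F : ℕ → ℝ → ℝ≥0∞ := fun j s ↦
    (μ (Metric.thickening (1 / (j + 1)) {x | s < h x}) - μ {x | s < h x}) /
      ENNReal.ofReal (1 / (j + 1))
  let G : ℕ → M → ℝ≥0∞ := fun j x ↦ ENNReal.ofReal (ballSup h (1 / (j + 1)) x - h x) /
      ENNReal.ofReal (1 / (j + 1))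
  have hF : ∀ j, Measurable (F j) := by
    intro j
    simp only [F, thickening_setOf_lt hK (hr j)]
    exact ((measurable_measure_setOf_lt μ _).sub (measurable_measure_setOf_lt μ _)).div_const _
  have hG : ∀ j, Measurable (G j) := fun j ↦
    ((measurable_ballSup hK (hr j)).sub hK.continuous.measurable).ennreal_ofReal.div_const _
  have hFG : ∀ j, ∫⁻ s in Ioi 0, F j s ≤ ∫⁻ x, G j x ∂μ := by
    intro j
    simp only [F, G, @div_eq_mul_inv ℝ≥0∞]
    have h1 : (ENNReal.ofReal (1 / ((j : ℝ) + 1)))⁻¹ ≠ ⊤ :=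
      ENNReal.inv_ne_top.2 (ENNReal.ofReal_pos.2 (hr j)).ne'
    rw [lintegral_mul_const' _ _ h1, lintegral_mul_const' _ _ h1]
    exact mul_le_mul_left (lintegral_measure_thickening_sub_le hK h0 (hr j)) _
  -- The Lipschitz constant dominates all the quotients, as the reverse Fatou lemma below requires.
  have hGK : ∀ j, G j ≤ᵐ[μ] fun _ ↦ (K : ℝ≥0∞) := by
    intro j
    refine Eventually.of_forall fun x ↦ ?_
    simp only [G]
    rw [← ENNReal.ofReal_div_of_pos (hr j), ← ENNReal.ofReal_coe_nnreal]
    refine ENNReal.ofReal_le_ofReal ?_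
    rw [div_le_iff₀ (hr j), sub_le_iff_le_add']
    exact ballSup_le (hr j) fun y hy ↦ bddAbove_image_ball hK _ x (mem_image_of_mem h hy)
  calc ∫⁻ s in Ioi 0, boundaryMeasure μ {x | s < h x}
      ≤ ∫⁻ s in Ioi 0, liminf (fun j ↦ F j s) atTop := by
        refine lintegral_mono fun s ↦ ?_
        simp only [boundaryMeasure]
        -- The lower limit over all radii is at most the one along the sequence 1/(j + 1).
        have := liminf_le_liminf_of_le hr0 (u := fun r : ℝ ↦
          (μ (Metric.thickening r {x | s < h x}) - μ {x | s < h x}) / ENNReal.ofReal r)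
        exact this
    _ ≤ liminf (fun j ↦ ∫⁻ s in Ioi 0, F j s) atTop := lintegral_liminf_le hF
    _ ≤ liminf (fun j ↦ ∫⁻ x, G j x ∂μ) atTop := liminf_le_liminf (Eventually.of_forall hFG)
    _ ≤ limsup (fun j ↦ ∫⁻ x, G j x ∂μ) atTop := liminf_le_limsup
    _ ≤ ∫⁻ x, limsup (fun j ↦ G j x) atTop ∂μ :=
        limsup_lintegral_le _ hG hGK (by simp [ENNReal.mul_eq_top])
    _ ≤ ∫⁻ x, ‖riemannianGradient n h x‖ₑ ∂μ :=
        lintegral_mono_ae (hd.mono fun x hx ↦ limsup_ballSup_sub_le hx)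

/-- By the layer cake formula ∫h is the integral of μ{h > s} over s > 0, and φ(h)·μ{h > s} ≤ μ⁺{h >
s} at each level. -/
theorem levelSetRatio_mul_lintegral_le (hμ : ∀ p, ∃ r c, IsChartBall n μ p r c) {h : M → ℝ}
    (hh : IsLipschitz h) (h0 : ∀ x, 0 ≤ h x) :
    levelSetRatio μ h * ∫⁻ x, ENNReal.ofReal (h x) ∂μ ≤
      ∫⁻ x, ‖riemannianGradient n h x‖ₑ ∂μ := by
  refine le_trans ?_ (lintegral_boundaryMeasure_le hμ hh h0)
  rw [lintegral_eq_lintegral_meas_lt μ (Eventually.of_forall h0)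
    hh.continuous.measurable.aemeasurable, ← lintegral_const_mul _ (measurable_measure_setOf_lt μ h)]
  refine setLIntegral_mono' measurableSet_Ioi fun s hs ↦ ?_
  rcases eq_or_ne (μ {x | s < h x}) 0 with h1 | h1
  · rw [h1, mul_zero]
    exact zero_le
  · have h2 : levelSetRatio μ h ≤ isoRatio μ {x | s < h x} :=
      iInf₂_le s ⟨le_of_lt hs, pos_iff_ne_zero.2 h1⟩
    exact ENNReal.mul_le_of_le_div h2

end WeightedManifold

/-! ### Truncations of f and the bound on the eigenvalue -/

namespace WeightedManifold
set_option linter.unusedSectionVars false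

theorem isLipschitz_tent (a b : ℝ) : IsLipschitz (tent a b) :=
  ⟨1, LipschitzWith.of_dist_le_mul fun s t ↦ by
    rw [NNReal.coe_one, one_mul]
    exact abs_tent_sub_le a b s t⟩

theorem hasDerivAt_integral_zigzag (t : ℕ → ℝ) (N : ℕ) (s : ℝ) :
    HasDerivAt (fun s ↦ ∫ x in (0 : ℝ)..s, zigzag t N x) (zigzag t N s) s :=
  (continuous_zigzag t N).integral_hasStrictDerivAt 0 s |>.hasDerivAt

theorem isLipschitz_integral_zigzag {t : ℕ → ℝ} (ht : Monotone t) (N : ℕ) :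
    IsLipschitz fun s ↦ ∫ x in (0 : ℝ)..s, zigzag t N x := by
  refine ⟨(t N - t 0).toNNReal, lipschitzWith_of_nnnorm_deriv_le
    (fun s ↦ (hasDerivAt_integral_zigzag t N s).differentiableAt) fun s ↦ ?_⟩
  rw [(hasDerivAt_integral_zigzag t N s).deriv, ← NNReal.coe_le_coe, coe_nnnorm,
    Real.coe_toNNReal _ (sub_nonneg.2 (ht (Nat.zero_le N))),
    Real.norm_of_nonneg (zigzag_nonneg t N s)]
  exact zigzag_le ht N s

theorem monotone_integral_zigzag (t : ℕ → ℝ) (N : ℕ) :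
    Monotone fun s ↦ ∫ x in (0 : ℝ)..s, zigzag t N x :=
  monotone_of_deriv_nonneg (fun s ↦ (hasDerivAt_integral_zigzag t N s).differentiableAt) fun s ↦ by
    rw [(hasDerivAt_integral_zigzag t N s).deriv]
    exact zigzag_nonneg t N s

/-- Each superlevel set of H∘f at a level s ≥ 0 is the superlevel set of f at the largest τ ∈ [0, m]
with H(τ) ≤ s, so the infimum for f runs over at least as many sets. -/
theorem levelSetRatio_le_comp {X : Type*} [PseudoEMetricSpace X] [MeasurableSpace X]
    (μ : Measure X) {f : X → ℝ} {m : ℝ} (hf0 : ∀ x, 0 ≤ f x) (hm : ∀ x, f x ≤ m) {H : ℝ → ℝ}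
    (hHm : Monotone H) (hHc : Continuous H) (hH0 : H 0 = 0) :
    levelSetRatio μ f ≤ levelSetRatio μ (H ∘ f) := by
  refine le_iInf₂ fun s ⟨hs0, hs⟩ ↦ ?_
  obtain ⟨x₀⟩ : Nonempty X := by
    by_contra hcon
    rw [not_nonempty_iff] at hcon
    simp [eq_empty_of_isEmpty] at hs
  let A : Set ℝ := Icc 0 m ∩ {τ | H τ ≤ s}
  have hA : IsCompact A := isCompact_Icc.inter_right (isClosed_le hHc continuous_const)
  have hAne : A.Nonempty := ⟨0, ⟨le_rfl, (hf0 x₀).trans (hm x₀)⟩, by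
    rw [mem_ofPred_eq, hH0]
    exact hs0⟩
  have ht := hA.sSup_mem hAne
  have hset : {x | s < (H ∘ f) x} = {x | sSup A < f x} := by
    ext x
    simp only [mem_ofPred_eq, Function.comp_apply]
    constructor
    · intro h
      by_contra! hcon
      exact absurd ((hHm hcon).trans ht.2) h.not_ge
    · intro h
      by_contra! hcon
      exact absurd (le_csSup hA.bddAbove ⟨⟨hf0 x, hm x⟩, hcon⟩) h.not_ge
  rw [hset] at hs ⊢
  exact iInf₂_le _ ⟨ht.1.1, hs⟩

variable {n : ℕ} {M : Type*} [MetricSpace M]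
    [ChartedSpace (EuclideanSpace ℝ (Fin n)) M] [IsManifold (𝓡 n) ∞ M]
    [RiemannianBundle (fun x : M ↦ TangentSpace (𝓡 n) x)]
    [IsContMDiffRiemannianBundle (𝓡 n) ∞ (EuclideanSpace ℝ (Fin n))
      (fun x : M ↦ TangentSpace (𝓡 n) x)]
    [IsRiemannianManifold (𝓡 n) M]

theorem norm_riemannianGradient_comp_le {f : M → ℝ} {H : ℝ → ℝ} {H' : ℝ} {x : M}
    (hf : MDifferentiableAt (𝓡 n) 𝓘(ℝ, ℝ) f x) (hg : MDifferentiableAt (𝓡 n) 𝓘(ℝ, ℝ) (H ∘ f) x)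
    (hH : HasDerivAt H H' (f x)) :
    ‖riemannianGradient n (H ∘ f) x‖ ≤ |H'| * ‖riemannianGradient n f x‖ := by
  refine le_of_forall_pos_le_add fun ε hε ↦ ?_
  set δ := ε / (‖riemannianGradient n f x‖ + 1)
  have hδ : 0 < δ := by positivity
  have h1 : ∀ᶠ y in 𝓝 x, |(H ∘ f) y - (H ∘ f) x| ≤ (|H'| + δ) * |f y - f x| := by
    have h2 := hf.continuousAt.eventually ((hasDerivAt_iff_isLittleO.1 hH).def hδ)
    filter_upwards [h2] with y hy
    simp only [Real.norm_eq_abs, smul_eq_mul] at hy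
    have h3 := abs_add_le (H (f y) - H (f x) - (f y - f x) * H') ((f y - f x) * H')
    rw [sub_add_cancel, abs_mul] at h3
    simp only [Function.comp_apply]
    linarith
  have h4 := norm_riemannianGradient_le_norm hf hg (by positivity) h1
  have h5 : δ * ‖riemannianGradient n f x‖ ≤ ε := by
    simp only [δ]
    rw [div_mul_eq_mul_div, div_le_iff₀ (by positivity)]
    nlinarith [norm_nonneg (riemannianGradient n f x)]
  linarith

theorem norm_riemannianGradient_tent_comp_le {f : M → ℝ} {a b : ℝ} {x : M}
    (hf : MDifferentiableAt (𝓡 n) 𝓘(ℝ, ℝ) f x)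
    (hg : MDifferentiableAt (𝓡 n) 𝓘(ℝ, ℝ) (tent a b ∘ f) x) :
    ‖riemannianGradient n (tent a b ∘ f) x‖ ≤ ‖riemannianGradient n f x‖ := by
  have := norm_riemannianGradient_le_norm hf hg zero_le_one
    (Eventually.of_forall fun y ↦ by rw [one_mul]; exact abs_tent_sub_le _ _ _ _)
  rwa [one_mul] at this

theorem riemannianGradient_tent_comp_eq_zero {f : M → ℝ} {a b : ℝ} {x : M} (h : f x ∉ Ioo a b) :
    riemannianGradient n (tent a b ∘ f) x = 0 :=
  riemannianGradient_eq_zero_of_isLocalMin (Eventually.of_forall fun y ↦ by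
    simp only [Function.comp_apply, tent_eq_zero h]
    exact tent_nonneg _ _ _)

variable [CompactSpace M] [MeasurableSpace M] [BorelSpace M] {μ : Measure M}
  (hμ : ∀ p, ∃ r c, IsChartBall n μ p r c)
include hμ

/-- The energies of the disjointly supported truncations of `f` add up to at most the energy
of `f`. -/
theorem sum_dirichletForm_tent_comp_le [IsFiniteMeasure μ] {f : M → ℝ} (hf : IsLipschitz f)
    {t : ℕ → ℝ} (ht : Monotone t) (N : ℕ) :
    ∑ i ∈ Finset.range N, dirichletForm n μ (tent (t i) (t (i + 1)) ∘ f)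
      (tent (t i) (t (i + 1)) ∘ f) ≤ dirichletForm n μ f f := by
  have hg : ∀ i, IsLipschitz (tent (t i) (t (i + 1)) ∘ f) := fun i ↦
    IsLipschitz.comp (isLipschitz_tent _ _) hf
  simp only [dirichletForm_self]
  rw [← integral_finsetSum _ fun i _ ↦ integrable_sq_norm_riemannianGradient hμ (hg i)]
  refine integral_mono_ae
    (integrable_finsetSum _ fun i _ ↦ integrable_sq_norm_riemannianGradient hμ (hg i))
    (integrable_sq_norm_riemannianGradient hμ hf) ?_
  filter_upwards [ae_mdifferentiableAt hμ hf,
    ae_all_iff.2 fun i ↦ ae_mdifferentiableAt hμ (hg i)] with x hx hxg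
  -- At most one open interval contains f(x). Every other truncation vanishes at x, so its gradient
  -- there is 0, also when f(x) is a threshold.
  by_cases h : ∃ i, f x ∈ Ioo (t i) (t (i + 1))
  · obtain ⟨i, hi⟩ := h
    have hj : ∀ j, j ≠ i → riemannianGradient n (tent (t j) (t (j + 1)) ∘ f) x = 0 := by
      intro j hj
      refine riemannianGradient_tent_comp_eq_zero fun hj' ↦ ?_
      exact (mul_pos (tent_pos hj') (tent_pos hi)).ne' (tent_mul_tent_eq_zero ht hj (f x))
    calc ∑ j ∈ Finset.range N, ‖riemannianGradient n (tent (t j) (t (j + 1)) ∘ f) x‖ ^ 2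
        -- The index i may lie outside the range, so it is added first.
        ≤ ∑ j ∈ insert i (Finset.range N),
            ‖riemannianGradient n (tent (t j) (t (j + 1)) ∘ f) x‖ ^ 2 :=
          Finset.sum_le_sum_of_subset_of_nonneg (Finset.subset_insert _ _) fun _ _ _ ↦ by positivity
      _ = ‖riemannianGradient n (tent (t i) (t (i + 1)) ∘ f) x‖ ^ 2 :=
          Finset.sum_eq_single_of_mem i (Finset.mem_insert_self _ _) fun j _ hji ↦ by
            rw [hj j hji, norm_zero, zero_pow two_ne_zero]
      _ ≤ ‖riemannianGradient n f x‖ ^ 2 := by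
          gcongr
          exact norm_riemannianGradient_tent_comp_le hx (hxg i)
  · push Not at h
    refine (Finset.sum_eq_zero fun i _ ↦ ?_).trans_le (sq_nonneg _)
    rw [riemannianGradient_tent_comp_eq_zero (h i), norm_zero, zero_pow two_ne_zero]

/-- If the `2k` truncations of `f` all have the same norm, then `k + 1` of them bound `λ_k`. -/
theorem eigenvalue_le_of_truncations [ConnectedSpace M] [IsProbabilityMeasure μ] {k : ℕ}
    (hk : 1 ≤ k) {f : M → ℝ} (hf : IsLipschitz f) {t : ℕ → ℝ} (ht : Monotone t) {C : ℝ} (hC : 0 < C)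
    (h : ∀ i < 2 * k, ∫ x, tent (t i) (t (i + 1)) (f x) ^ 2 ∂μ = C) :
    eigenvalue n μ k ≤ dirichletForm n μ f f / (k * C) := by
  set E := dirichletForm n μ f f with hE
  have hE0 : 0 ≤ E := dirichletForm_self_nonneg _
  have hk0 : (0 : ℝ) < k := by exact_mod_cast hk
  let e : ℕ → ℝ := fun i ↦ dirichletForm n μ (tent (t i) (t (i + 1)) ∘ f)
      (tent (t i) (t (i + 1)) ∘ f)
  let S := (Finset.range (2 * k)).filter fun i ↦ e i ≤ E / k
  -- Otherwise at least k of the 2k truncations have energy strictly above E/k, and the total would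
  -- exceed E.
  have hS : k + 1 ≤ S.card := by
    by_contra! hcon
    let T := (Finset.range (2 * k)).filter fun i ↦ ¬ e i ≤ E / k
    have hST : S.card + T.card = 2 * k := by
      rw [Finset.card_filter_add_card_filter_not, Finset.card_range]
    have hT : k ≤ T.card := by omega
    have hTne : T.Nonempty := Finset.card_pos.1 (by omega)
    have h1 : T.card • (E / k) < ∑ i ∈ T, e i := by
      rw [← Finset.sum_const]
      exact Finset.sum_lt_sum_of_nonempty hTne fun i hi ↦ not_le.1 (Finset.mem_filter.1 hi).2
    have h2 : ∑ i ∈ T, e i ≤ ∑ i ∈ Finset.range (2 * k), e i :=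
      Finset.sum_le_sum_of_subset_of_nonneg (Finset.filter_subset _ _)
        fun i _ _ ↦ dirichletForm_self_nonneg _
    have h3 : E ≤ T.card • (E / k) := by
      rw [nsmul_eq_mul]
      calc E = k * (E / k) := by field_simp
        _ ≤ T.card * (E / k) := by gcongr
    exact absurd (sum_dirichletForm_tent_comp_le hμ hf ht (2 * k)) (by
      rw [not_le]
      exact h3.trans_lt (h1.trans_le h2))
  let σ := S.orderEmbOfCardLe hS
  have hσ : ∀ i, σ i < 2 * k ∧ e (σ i) ≤ E / k := fun i ↦ by
    have := Finset.mem_filter.1 (S.orderEmbOfCardLe_mem hS i)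
    exact ⟨Finset.mem_range.1 this.1, this.2⟩
  let g : Fin (k + 1) → lipschitzFunctions M := fun i ↦
    ⟨tent (t (σ i)) (t (σ i + 1)) ∘ f, IsLipschitz.comp (isLipschitz_tent _ _) hf⟩
  have hg2 : ∀ i, ∫ x, (g i : M → ℝ) x ^ 2 ∂μ = C := fun i ↦ h _ (hσ i).1
  obtain ⟨u, hu, hub⟩ := exists_linearIndependent_isWeakEigenfunction hμ
    (b := E / (k * C)) (by positivity) g (fun i x ↦ tent_nonneg _ _ _)
    (fun i j hij x ↦ tent_mul_tent_eq_zero ht (σ.injective.ne hij) (f x))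
    (fun i ↦ by rw [hg2]; exact hC) (fun i ↦ by
      rw [hg2]
      refine (hσ i).2.trans_eq ?_
      field_simp)
  exact eigenvalue_le hμ hk hu hub

end WeightedManifold

/-! ### Conclusion: the estimate for φ(f) -/

namespace WeightedManifold
set_option linter.unusedSectionVars false

variable {n : ℕ} {M : Type*} [MetricSpace M]
    [ChartedSpace (EuclideanSpace ℝ (Fin n)) M] [IsManifold (𝓡 n) ∞ M]
    [RiemannianBundle (fun x : M ↦ TangentSpace (𝓡 n) x)]
    [IsContMDiffRiemannianBundle (𝓡 n) ∞ (EuclideanSpace ℝ (Fin n))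
      (fun x : M ↦ TangentSpace (𝓡 n) x)]
    [IsRiemannianManifold (𝓡 n) M] [CompactSpace M] [MeasurableSpace M] [BorelSpace M]
    {μ : Measure M} (hμ : ∀ p, ∃ r c, IsChartBall n μ p r c)
include hμ

/-- The mean value of the gradient of `H ∘ f`, where `H` is the primitive of a zigzag function. -/
theorem lintegral_enorm_riemannianGradient_comp_le [IsFiniteMeasure μ] {f : M → ℝ}
    (hf : IsLipschitz f) {t : ℕ → ℝ} (ht : Monotone t) {N : ℕ} {C : ℝ}
    (hC : ∀ i, ∫ x, tent (t i) (t (i + 1)) (f x) ^ 2 ∂μ ≤ C) :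
    ∫⁻ x, ‖riemannianGradient n ((fun s ↦ ∫ x in (0 : ℝ)..s, zigzag t N x) ∘ f) x‖ₑ ∂μ ≤
      ENNReal.ofReal (√(N * C) * √(dirichletForm n μ f f)) := by
  set H : ℝ → ℝ := fun s ↦ ∫ x in (0 : ℝ)..s, zigzag t N x with hH
  have hHf : IsLipschitz (H ∘ f) := IsLipschitz.comp (isLipschitz_integral_zigzag ht N) hf
  have hgm := aemeasurable_norm_riemannianGradient hμ hf
  have hg2 : MemLp (fun x ↦ ‖riemannianGradient n f x‖) 2 μ :=
    (memLp_two_iff_integrable_sq hgm.aestronglyMeasurable).2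
      (integrable_sq_norm_riemannianGradient hμ hf)
  have htent : ∀ i, MemLp (fun x ↦ tent (t i) (t (i + 1)) (f x)) 2 μ := fun i ↦
    (IsLipschitz.comp (isLipschitz_tent _ _) hf).memLp 2
  have hz2 : MemLp (fun x ↦ zigzag t N (f x)) 2 μ := memLp_finsetSum _ fun i _ ↦ htent i
  have h1 : ∫⁻ x, ‖riemannianGradient n (H ∘ f) x‖ₑ ∂μ ≤
      ∫⁻ x, ENNReal.ofReal (zigzag t N (f x) * ‖riemannianGradient n f x‖) ∂μ := by
    refine lintegral_mono_ae ?_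
    filter_upwards [ae_mdifferentiableAt hμ hf, ae_mdifferentiableAt hμ hHf] with x hx hx'
    rw [← ofReal_norm]
    refine ENNReal.ofReal_le_ofReal ?_
    have := norm_riemannianGradient_comp_le hx hx' (hasDerivAt_integral_zigzag t N (f x))
    rwa [abs_of_nonneg (zigzag_nonneg _ _ _)] at this
  have hint : Integrable (fun x ↦ zigzag t N (f x) * ‖riemannianGradient n f x‖) μ :=
    hz2.integrable_mul hg2
  refine h1.trans ?_
  rw [← ofReal_integral_eq_lintegral_ofReal hint
    (Eventually.of_forall fun x ↦ mul_nonneg (zigzag_nonneg _ _ _) (norm_nonneg _))]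
  refine ENNReal.ofReal_le_ofReal ?_
  have h2 := integral_mul_le_Lp_mul_Lq_of_nonneg (μ := μ) Real.HolderConjugate.two_two
    (Eventually.of_forall fun x ↦ zigzag_nonneg t N (f x))
    (Eventually.of_forall fun x ↦ norm_nonneg (riemannianGradient n f x))
    (by simpa using hz2) (by simpa using hg2)
  refine h2.trans ?_
  simp only [Real.rpow_two, ← Real.sqrt_eq_rpow]
  rw [← dirichletForm_self]
  gcongr
  -- The tents have disjoint supports, so the squared norm of the zigzag is the sum of N squared
  -- norms, each at most C.
  simp only [sq_zigzag ht]
  rw [integral_finsetSum _ fun i _ ↦ (htent i).integrable_sq]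
  calc ∑ i ∈ Finset.range N, ∫ x, tent (t i) (t (i + 1)) (f x) ^ 2 ∂μ
      ≤ ∑ i ∈ Finset.range N, C := Finset.sum_le_sum fun i _ ↦ hC i
    _ = N * C := by simp

/-- Coarea is applied to H∘f rather than to f: H(f) dominates f²/(4N), while the derivative of H at
f has squared L² norm at most NC. -/
theorem levelSetRatio_mul_le [IsFiniteMeasure μ] {f : M → ℝ}
    (hf : IsLipschitz f) (hf0 : ∀ x, 0 ≤ f x) {t : ℕ → ℝ} (ht : Monotone t) (ht0 : t 0 = 0)
    {N : ℕ} (hN : 0 < N) (htN : ∀ x, f x ≤ t N) {C : ℝ}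
    (hC : ∀ i, ∫ x, tent (t i) (t (i + 1)) (f x) ^ 2 ∂μ ≤ C) :
    levelSetRatio μ f * ENNReal.ofReal ((∫ x, f x ^ 2 ∂μ) / (4 * N)) ≤
      ENNReal.ofReal (√(N * C) * √(dirichletForm n μ f f)) := by
  set H : ℝ → ℝ := fun s ↦ ∫ x in (0 : ℝ)..s, zigzag t N x with hH
  have hHf : IsLipschitz (H ∘ f) := IsLipschitz.comp (isLipschitz_integral_zigzag ht N) hf
  have hHm : Monotone H := monotone_integral_zigzag t N
  have hH0 : H 0 = 0 := intervalIntegral.integral_same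
  have h1 : levelSetRatio μ f ≤ levelSetRatio μ (H ∘ f) :=
    levelSetRatio_le_comp μ hf0 htN hHm (isLipschitz_integral_zigzag ht N).continuous hH0
  have h2 : ENNReal.ofReal ((∫ x, f x ^ 2 ∂μ) / (4 * N)) ≤
      ∫⁻ x, ENNReal.ofReal ((H ∘ f) x) ∂μ := by
    rw [← integral_div, ofReal_integral_eq_lintegral_ofReal
      ((hf.memLp 2).integrable_sq.div_const _) (Eventually.of_forall fun x ↦ by positivity)]
    refine lintegral_mono fun x ↦ ENNReal.ofReal_le_ofReal ?_
    have hN' : (0 : ℝ) < N := by exact_mod_cast hN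
    rw [div_le_iff₀ (by positivity), mul_comm]
    exact sq_div_le_integral_zigzag ht ht0 (hf0 x) (htN x)
  calc _ ≤ levelSetRatio μ (H ∘ f) * ∫⁻ x, ENNReal.ofReal ((H ∘ f) x) ∂μ := mul_le_mul' h1 h2
    _ ≤ ∫⁻ x, ‖riemannianGradient n (H ∘ f) x‖ₑ ∂μ :=
        levelSetRatio_mul_lintegral_le hμ hHf fun x ↦ by
          rw [Function.comp_apply, ← hH0]
          exact hHm (hf0 x)
    _ ≤ _ := lintegral_enorm_riemannianGradient_comp_le hμ hf ht hC

theorem levelSetRatio_le [ConnectedSpace M] [IsProbabilityMeasure μ] (hn : 0 < n) {k : ℕ}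
    (hk : 1 ≤ k) {f : M → ℝ} (hf : IsLipschitz f) (hf0 : ∀ x, 0 ≤ f x) (hfne : f ≠ 0) :
    levelSetRatio μ f ≤
      ENNReal.ofReal (8 * √2 * k * (rayleigh n μ f / √(eigenvalue n μ k))) := by
  have hl : 0 < eigenvalue n μ k := eigenvalue_pos hμ hn hk
  set l := eigenvalue n μ k with hl_def
  set E := dirichletForm n μ f f with hE
  have hE0 : 0 ≤ E := dirichletForm_self_nonneg _
  have hk0 : (0 : ℝ) < k := by exact_mod_cast hk
  obtain ⟨x₀, hx₀⟩ : ∃ x, f x ≠ 0 := Function.ne_iff.1 hfne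
  have hI : 0 < ∫ x, f x ^ 2 ∂μ := by
    have : μ.IsOpenPosMeasure := ⟨fun U hU hne ↦ (measure_pos_of_isOpen hμ hU hne).ne'⟩
    exact (hf.continuous.pow 2).integral_pos_of_hasCompactSupport_nonneg_nonzero
      (HasCompactSupport.of_compactSpace _) (fun x ↦ sq_nonneg _) (pow_ne_zero 2 hx₀)
  set I := ∫ x, f x ^ 2 ∂μ with hI_def
  obtain ⟨m, hm⟩ : ∃ m, ∀ x, f x ≤ m := by
    obtain ⟨y, -, hy⟩ := isCompact_univ.exists_isMaxOn univ_nonempty hf.continuous.continuousOn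
    exact ⟨f y, fun x ↦ hy (mem_univ x)⟩
  have hm0 : 0 ≤ m := (hf0 x₀).trans (hm x₀)
  -- For such C the first 2k thresholds exhaust the range of f: otherwise all 2k truncations have
  -- norm C and λ_k ≤ E/(kC), which the strict inequality excludes.
  have key : ∀ C, E / (k * l) < C →
      levelSetRatio μ f * ENNReal.ofReal (I / (4 * (2 * k : ℕ))) ≤
        ENNReal.ofReal (√((2 * k : ℕ) * C) * √E) := by
    intro C hC
    have hC0 : 0 < C := lt_of_le_of_lt (by positivity) hC
    obtain ⟨t, ht, ht0, htm, htC, htC'⟩ :=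
      exists_thresholds μ hf.continuous.measurable hC0.le hm0
    refine levelSetRatio_mul_le hμ hf hf0 ht ht0 (by omega) (fun x ↦ ?_) htC
    by_contra! hcon
    have h1 : t (2 * k) < m := hcon.trans_le (hm x)
    have h2 := eigenvalue_le_of_truncations hμ hk hf ht hC0 fun i hi ↦
      htC' i ((ht (Nat.succ_le_of_lt hi)).trans_lt h1)
    rw [← hl_def, ← hE, le_div_iff₀ (by positivity)] at h2
    rw [div_lt_iff₀ (by positivity)] at hC
    linarith
  have hlim : levelSetRatio μ f * ENNReal.ofReal (I / (4 * (2 * k : ℕ))) ≤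
      ENNReal.ofReal (√((2 * k : ℕ) * (E / (k * l))) * √E) := by
    have hcont : Continuous fun C : ℝ ↦ ENNReal.ofReal (√((2 * k : ℕ) * C) * √E) :=
      ENNReal.continuous_ofReal.comp (by fun_prop)
    refine ge_of_tendsto (x := 𝓝[>] (E / (k * l)))
      ((hcont.tendsto _).mono_left nhdsWithin_le_nhds) ?_
    filter_upwards [self_mem_nhdsWithin] with C hC using key C hC
  have hpos : 0 < I / (4 * (2 * k : ℕ)) := by
    push_cast
    positivity
  rw [← ENNReal.le_div_iff_mul_le (Or.inl (ENNReal.ofReal_pos.2 hpos).ne')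
    (Or.inl ENNReal.ofReal_ne_top), ← ENNReal.ofReal_div_of_pos hpos] at hlim
  refine hlim.trans_eq ?_
  congr 1
  -- The factor k cancels under the root, leaving √2·E/√λ_k; the factor 8k comes from I/(4·2k).
  have h1 : √((2 * k : ℕ) * (E / (k * l))) * √E = √2 * E / √l := by
    have : ((2 * k : ℕ) : ℝ) * (E / (k * l)) = 2 * E / l := by
      push_cast
      field_simp
    rw [this, Real.sqrt_div (by positivity), Real.sqrt_mul zero_le_two, div_mul_eq_mul_div,
      mul_assoc, Real.mul_self_sqrt hE0]
  have h2 : rayleigh n μ f = E / I := by rw [rayleigh, hE, dirichletForm_self]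
  rw [h1, h2]
  push_cast
  field_simp
  ring

end WeightedManifold

theorem mainTheorem4 {n : ℕ} (hn : 0 < n) {M : Type*} [MetricSpace M]
    [ChartedSpace (EuclideanSpace ℝ (Fin n)) M] [IsManifold (𝓡 n) ∞ M]
    [RiemannianBundle (fun x : M ↦ TangentSpace (𝓡 n) x)]
    [IsContMDiffRiemannianBundle (𝓡 n) ∞ (EuclideanSpace ℝ (Fin n))
      (fun x : M ↦ TangentSpace (𝓡 n) x)]
    [IsRiemannianManifold (𝓡 n) M] [CompactSpace M] [ConnectedSpace M]
    [MeasurableSpace M] [BorelSpace M]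
    (V : M → ℝ) (hV : ContMDiff (𝓡 n) 𝓘(ℝ, ℝ) 2 V)
    (μ : Measure M) (hμ : μ = WeightedManifold.weightedMeasure n V) [IsProbabilityMeasure μ]
    (k : ℕ) (hk : 1 ≤ k)
    (f : M → ℝ) (hf : WeightedManifold.IsLipschitz f) (hf_nonneg : ∀ x, 0 ≤ f x) (hf_ne : f ≠ 0) :
    WeightedManifold.levelSetRatio μ f ≤
      ENNReal.ofReal (8 * √2 * k *
        (WeightedManifold.rayleigh n μ f / √(WeightedManifold.eigenvalue n μ k))) := by
  have h : ∀ p, ∃ r c, WeightedManifold.IsChartBall n μ p r c := fun p ↦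
    hμ ▸ WeightedManifold.exists_isChartBall hV.continuous p
  exact WeightedManifold.levelSetRatio_le h hn hk hf hf_nonneg hf_ne
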